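/- Let $V_1,V_2$ be solid tori with oriented boundary tori $T_i=\partial V_i$. On each $T_i$ fix an oriented chosen cycle $w_i$, that is, a simple closed curve, not null-homotopic in $T_i$, that bounds an embedded disk in $V_i$ meeting $T_i$ only in $w_i$; and fix a parallel $v_i$, that is, an oriented simple closed curve on $T_i$ with algebraic intersection number $w_i\cdot v_i=1$. Let $G_i\subset T_i$ be embedded finite graphs and let $Z_i$ be the set of oriented non-self-intersecting cycles of $G_i$. For $z\in Z_i$ let $\alpha_i(z)=z\cdot w_i\in\mathbb Z$ be the algebraic intersection number of $z$ with $w_i$, and let $\beta_i(z)$ be the algebraic intersection number $z\cdot v_i$ taken modulo $\alpha_i(z)$ (its least non-negative residue modulo $|\alpha_i(z)|$ if $\alpha_i(z)\neq 0$, and the integer $z\cdot v_i$ itself if $\alpha_i(z)=0$). For a graph isomorphism $\varphi:G_1\to G_2$ let $\varphi^*(\alpha_1),\varphi^*(\beta_1):Z_2\to\mathbb Z$ be the functions $z\mapsto\alpha_1(\varphi^{-1}(z))$ and $z\mapsto\beta_1(\varphi^{-1}(z))$. Suppose that $\varphi$ extends to an orientation-preserving homeomorphism $T_1\to T_2$.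 Then: (1) there is an orientation-preserving homeomorphism $h:T_1\to T_2$ (possibly different from the given one) that extends $\varphi$, extends to a homeomorphism $V_1\to V_2$, and respects the oriented chosen cycles, i.e. $h\circ w_1$ is homotopic to $w_2$ in $T_2$, if and only if $\varphi^*(\alpha_1)=\alpha_2$ and $\varphi^*(\beta_1)=\beta_2$; (2) there is an orientation-preserving homeomorphism $h:T_1\to T_2$ that extends $\varphi$ and extends to a homeomorphism $V_1\to V_2$ (with no condition on the chosen cycles) if and only if $\varphi^*(\alpha_1)=\alpha_2$ and $\varphi^*(\beta_1)=\beta_2$ hold either for the given $w_2,v_2$ or after the orientations of both $w_2$ and $v_2$ are reversed. -/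

import Mathlib

noncomputable section

/-! ### Winding numbers -/

/-- `HasWindingNumber γ n`: the closed curve `γ : Circle → ℂ` avoids `0` and its argument, followed
continuously along the curve, grows by `2πn` when the circle is traversed once counterclockwise. -/
def HasWindingNumber (γ : Circle → ℂ) (n : ℤ) : Prop :=
  (∀ u, γ u ≠ 0) ∧
  ∃ θ : ℝ → ℝ, Continuous θ ∧
    (∀ t, γ (Circle.exp t) = (‖γ (Circle.exp t)‖ : ℂ) * (Circle.exp (θ t) : ℂ)) ∧
    ∀ t, θ (t + 2 * Real.pi) = θ t + 2 * Real.pi * n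

/-- Two continuous arguments of the same circle-valued function differ by a constant in `2πℤ`. -/
theorem exists_int_const_of_exp_eq {f g : ℝ → ℝ} (hf : Continuous f) (hg : Continuous g)
    (h : ∀ t, Circle.exp (f t) = Circle.exp (g t)) :
    ∃ n : ℤ, ∀ t, f t = g t + 2 * Real.pi * n := by
  have hpi : (2 * Real.pi) ≠ 0 := by positivity
  have key : ∀ t, ∃ m : ℤ, (f t - g t) / (2 * Real.pi) = m := by
    intro t
    obtain ⟨m, hm⟩ := Circle.exp_eq_exp.1 (h t)
    exact ⟨m, by rw [hm]; field_simp; ring⟩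
  choose m hm using key
  have hmc : Continuous m := by
    have hc : Continuous fun t => ((m t : ℤ) : ℝ) := by
      have he : (fun t => ((m t : ℤ) : ℝ)) = fun t => (f t - g t) / (2 * Real.pi) :=
        funext fun t => (hm t).symm
      rw [he]
      exact (hf.sub hg).div_const _
    exact Int.isClosedEmbedding_coe_real.isEmbedding.continuous_iff.2 hc
  refine ⟨m 0, fun t => ?_⟩
  have hcst : m t = m 0 := PreconnectedSpace.constant inferInstance hmc
  have h1 := hm t
  rw [hcst, div_eq_iff hpi] at h1
  linarith

/-- Every continuous self-map of the circle has exactly one winding number. -/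
theorem existsUnique_hasWindingNumber (f : C(Circle, Circle)) :
    ∃! n : ℤ, HasWindingNumber (fun u => (f u : ℂ)) n := by
  obtain ⟨F, ⟨-, hF⟩, -⟩ := Circle.isCoveringMap_exp.existsUnique_continuousMap_lifts
    (f.comp Circle.exp) 0 (Circle.exp_surjective (f.comp Circle.exp 0)).choose
    (Circle.exp_surjective (f.comp Circle.exp 0)).choose_spec
  have hF' : ∀ t, Circle.exp (F t) = f (Circle.exp t) := fun t => congrFun hF t
  obtain ⟨n, hn⟩ := exists_int_const_of_exp_eq (f := fun t => F (t + 2 * Real.pi)) (g := F)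
    (by fun_prop) F.continuous (fun t => by simp only [hF', Circle.exp_add_two_pi])
  refine ⟨n, ⟨fun u => Circle.coe_ne_zero _, F, F.continuous, fun t => ?_, hn⟩, ?_⟩
  · simp [hF', Circle.norm_coe]
  · rintro k ⟨-, θ, hθ, h1, h2⟩
    obtain ⟨j, hj⟩ := exists_int_const_of_exp_eq (f := θ) (g := F) hθ F.continuous (fun t => by
      have := h1 t
      simp only [Circle.norm_coe, Complex.ofReal_one, one_mul] at this
      rw [hF', ← Circle.coe_inj]
      exact this.symm)
    have a := h2 0
    have b := hn 0
    rw [hj, hj] at a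
    have c : (2 * Real.pi) * ((n : ℝ) - k) = 0 := by linarith
    rcases mul_eq_zero.1 c with c | c
    · exact absurd c (by positivity)
    · exact_mod_cast (sub_eq_zero.1 c).symm

/-- The degree of a continuous self-map of the circle. -/
def circleDegree (f : C(Circle, Circle)) : ℤ :=
  (existsUnique_hasWindingNumber f).choose

theorem circleDegree_spec (f : C(Circle, Circle)) :
    HasWindingNumber (fun u => (f u : ℂ)) (circleDegree f) :=
  (existsUnique_hasWindingNumber f).choose_spec.1

/-! ### Solid tori and their boundaries -/

/-- The closed unit disk. -/
abbrev UnitDisk : Type := Metric.closedBall (0 : ℂ) 1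

/-- An oriented solid torus structure on the space `V`: an identification with `S¹ × D²`. The
boundary of `V` gets the orientation transported from `S¹ × S¹`; as the identification may be
composed with a reflection, both orientations of the boundary occur. -/
abbrev SolidTorus (V : Type*) [TopologicalSpace V] : Type _ := V ≃ₜ Circle × UnitDisk

namespace SolidTorus

variable {V V₁ V₂ : Type*} [TopologicalSpace V] [TopologicalSpace V₁] [TopologicalSpace V₂]

/-- The boundary torus of a solid torus, as a subset. -/
def boundarySet (e : SolidTorus V) : Set V := {p | ‖((e p).2 : ℂ)‖ = 1}

/-- The boundary torus of a solid torus. -/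
abbrev Boundary (e : SolidTorus V) : Type _ := e.boundarySet

/-- The first (longitudinal) circle coordinate on the boundary torus. -/
def coordX (e : SolidTorus V) : C(e.Boundary, Circle) where
  toFun p := (e p.1).1
  continuous_toFun := by fun_prop

/-- The second (meridional) circle coordinate on the boundary torus. -/
def coordY (e : SolidTorus V) : C(e.Boundary, Circle) where
  toFun p := ⟨((e p.1).2 : ℂ), mem_sphere_zero_iff_norm.2 p.2⟩
  continuous_toFun := continuous_induced_rng.2 <| by
    change Continuous fun p : e.Boundary => ((e p.1).2 : ℂ)
    fun_prop

/-- The algebraic intersection number `a · b` of two closed curves on the oriented boundary torus: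
with `H₁ = ℤ[x] ⊕ ℤ[y]`, where `[x]`, `[y]` are the classes of the coordinate circles, it is the
bilinear alternating pairing of the homology classes with `[x] · [y] = 1`. For transverse curves it
is the number of common points counted with sign `+1` where the directions of `(a, b)` form a
positive frame and `-1` elsewhere. -/
def intersectionNumber (e : SolidTorus V) (a b : C(Circle, e.Boundary)) : ℤ :=
  circleDegree (e.coordX.comp a) * circleDegree (e.coordY.comp b) -
    circleDegree (e.coordY.comp a) * circleDegree (e.coordX.comp b)

/-- A homeomorphism of boundary tori preserves orientation: it has a lift `H` to the universal
covers `ℂ → S¹ × S¹`, `z ↦ (exp (i Re z), exp (i Im z))`, that maps every positively oriented round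
circle to a closed curve winding once in the positive sense around the image of the centre. -/
def OrientationPreserving (e₁ : SolidTorus V₁) (e₂ : SolidTorus V₂)
    (h : e₁.Boundary ≃ₜ e₂.Boundary) : Prop :=
  ∃ H : C(ℂ, ℂ),
    (∀ (p : e₁.Boundary) (z : ℂ),
      e₁.coordX p = Circle.exp z.re → e₁.coordY p = Circle.exp z.im →
        e₂.coordX (h p) = Circle.exp (H z).re ∧ e₂.coordY (h p) = Circle.exp (H z).im) ∧
    ∀ (z : ℂ) (r : ℝ), 0 < r → HasWindingNumber (fun u => H (z + r * u) - H z) 1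

/-- The homeomorphism `h` of the boundary tori extends to a homeomorphism of the solid tori. -/
def ExtendsToSolidTori (e₁ : SolidTorus V₁) (e₂ : SolidTorus V₂)
    (h : e₁.Boundary ≃ₜ e₂.Boundary) : Prop :=
  ∃ F : V₁ ≃ₜ V₂, ∀ p : e₁.Boundary, F p = h p

/-- A chosen cycle (meridian) of a solid torus: an oriented simple closed curve on the boundary
torus, not contractible there, which bounds an embedded disk meeting the boundary torus only in the
curve. -/
structure IsChosenCycle (e : SolidTorus V) (w : C(Circle, e.Boundary)) : Prop where
  injective : Function.Injective w
  not_nullhomotopic : ¬ w.Nullhomotopic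
  bounds_disk : ∃ d : C(UnitDisk, V), Function.Injective d ∧
    (∀ (z : UnitDisk) (u : Circle), (z : ℂ) = u → d z = w u) ∧
    ∀ z : UnitDisk, d z ∈ e.boundarySet → ‖(z : ℂ)‖ = 1

/-- A parallel with respect to the oriented chosen cycle `w`: an oriented simple closed curve `v`
on the boundary torus with algebraic intersection number `w · v = 1`. -/
structure IsParallel (e : SolidTorus V) (w v : C(Circle, e.Boundary)) : Prop where
  injective : Function.Injective v
  intersection : e.intersectionNumber w v = 1

end SolidTorus

/-- The same closed curve traversed in the opposite direction. -/
def reverseCurve {X : Type*} [TopologicalSpace X] (c : C(Circle, X)) : C(Circle, X) where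
  toFun u := c u⁻¹
  continuous_toFun := by fun_prop

/-! ### Embedded graphs -/

/-- A finite graph embedded in a space (loops, multiple edges and isolated vertices allowed): finitely
many vertices, and finitely many arcs with end points at vertices, which are otherwise injective,
pairwise disjoint and free of vertices. -/
structure EmbeddedGraph (X : Type*) [TopologicalSpace X] where
  vertices : Finset X
  numEdges : ℕ
  edge : Fin numEdges → C(unitInterval, X)
  source_mem : ∀ i, edge i 0 ∈ vertices
  target_mem : ∀ i, edge i 1 ∈ vertices
  interior_notMem : ∀ i, ∀ t ∈ Set.Ioo (0 : unitInterval) 1, edge i t ∉ vertices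
  interior_injective : ∀ i j, ∀ s ∈ Set.Ioo (0 : unitInterval) 1,
    ∀ t ∈ Set.Ioo (0 : unitInterval) 1, edge i s = edge j t → i = j ∧ s = t

namespace EmbeddedGraph

/-- The set of points of an embedded graph. -/
def carrier {X : Type*} [TopologicalSpace X] (G : EmbeddedGraph X) : Set X :=
  (G.vertices : Set X) ∪ ⋃ i, Set.range (G.edge i)

/-- An isomorphism of embedded graphs: a homeomorphism between them that maps the vertices onto the
vertices (and therefore edges onto edges). -/
structure Iso {X Y : Type*} [TopologicalSpace X] [TopologicalSpace Y]
    (G : EmbeddedGraph X) (G' : EmbeddedGraph Y) where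
  toHomeomorph : G.carrier ≃ₜ G'.carrier
  map_vertices : ∀ x : G.carrier,
    (toHomeomorph x : Y) ∈ G'.vertices ↔ (x : X) ∈ G.vertices

/-- The oriented non-self-intersecting cycles of an embedded graph, as oriented simple closed
curves in it. -/
def Cycle {X : Type*} [TopologicalSpace X] (G : EmbeddedGraph X) : Type _ :=
  {z : C(Circle, G.carrier) // Function.Injective z}

variable {X Y : Type*} [TopologicalSpace X] [TopologicalSpace Y]
  {G : EmbeddedGraph X} {G' : EmbeddedGraph Y}

/-- A cycle of the graph as a closed curve in the ambient space. -/
def Cycle.curve (z : G.Cycle) : C(Circle, X) where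
  toFun u := z.1 u
  continuous_toFun := by fun_prop

/-- The cycle `φ⁻¹(z)` of `G` for a cycle `z` of `G'`. -/
def Iso.cycleSymm (φ : Iso G G') (z : G'.Cycle) : G.Cycle :=
  ⟨⟨fun u => φ.toHomeomorph.symm (z.1 u), by fun_prop⟩,
    fun _ _ h => z.2 (φ.toHomeomorph.symm.injective h)⟩

/-- The transported function `φ^*(a)` on the cycles of `G'`, for a function `a` on the cycles of
`G`. -/
def Iso.transport (φ : Iso G G') (a : G.Cycle → ℤ) : G'.Cycle → ℤ :=
  fun z => a (φ.cycleSymm z)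

/-- The homeomorphism `h` of the ambient spaces extends the graph isomorphism `φ`. -/
def Iso.ExtendedBy (φ : Iso G G') (h : X ≃ₜ Y) : Prop :=
  ∀ x : G.carrier, h x = φ.toHomeomorph x

end EmbeddedGraph

/-! ### The invariants of the cycles -/

namespace SolidTorus

variable {V : Type*} [TopologicalSpace V]

/-- `α(z) = z · w`, the algebraic number of intersection points of the cycle `z` with the chosen
cycle `w`. -/
def alpha (e : SolidTorus V) {G : EmbeddedGraph e.Boundary} (w : C(Circle, e.Boundary))
    (z : G.Cycle) : ℤ :=
  e.intersectionNumber z.curve w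

/-- `β(z)`, the algebraic number `z · v` of intersection points of the cycle `z` with the parallel
`v`, taken modulo `α(z)`: its residue in `{0, …, |α(z)| - 1}`, and `z · v` itself if
`α(z) = 0`. -/
def beta (e : SolidTorus V) {G : EmbeddedGraph e.Boundary} (w v : C(Circle, e.Boundary))
    (z : G.Cycle) : ℤ :=
  Int.emod (e.intersectionNumber z.curve v) (e.alpha w z)

end SolidTorus

end

/-!
In the coordinates of the two solid tori, a homeomorphism of the boundary tori acts on the first
homology `ℤ²` by an integer matrix `M`; it preserves the orientation iff `det M = 1`, and then it
extends over the solid tori iff `M 0 1 = 0`, that is, iff it maps meridians to meridians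
(`SolidTorus.orientationPreserving_iff`, `SolidTorus.extendsToSolidTori_of_hasMatrix`,
`SolidTorus.ExtendsToSolidTori.apply_zero_one`). Such an `M` has rows `(δ, 0)` and `(k, δ)` with
`δ = ± 1`, and `δ` tells whether the orientations of the chosen cycles are respected. If `(x, y)` is
the homology class of a cycle of the second graph and `(x', y')` that of the corresponding cycle of
the first graph, the invariants `α`, `β` agree for all cycles iff always `x' = δ x` and
`x ∣ y' - δ y` (`SolidTorus.invariants_eq_iff`). These conditions are clearly necessary for the
existence of an extension with matrix `M`.

For the converse a given homeomorphism `h` with matrix `A` that extends `φ` is composed with a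
homeomorphism `g` of the torus that fixes the second graph pointwise, and the point is which matrices
such a `g` can have (`exists_correction`). If the classes of the cycles span a lattice of rank `2`,
then `A` itself has the required form. If they are multiples of a primitive class, the correction
needed is a transvection fixing this class, and if they all vanish, then it may be any matrix in
`SL₂(ℤ)`, hence a product of transvections.

Transvections are realized by Dehn twists along curves that avoid the graph
(`Realizable.transvection`). After a linear change of coordinates, all cycles of the graph have
degree `0` in the first coordinate `X`; so `X = exp v` on the graph for a real function `v`, built
up by adding the edges one at a time, and `v` extends to the whole torus by Tietze's theorem
(`EmbeddedGraph.exists_log_carrier`). On the universal cover the function `r = arg X - v`, in units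
of `2π`, is an integer on the graph and grows by `1` in the first direction. A simple closed curve
in the region `1 / 4 < r < 3 / 4` is found on a fine square grid. If no component of the set of grid points in this
region were invariant under a period in the second direction, the components would have bounded
extent, and the plane could be moved by a bounded distance so as to miss a point, contradicting
`surjective_of_bounded_distance` (`IsHeight.exists_reachable`, `IsHeight.exists_latticeCurve`). The
parallels of the grid curve form an embedded annulus disjoint from the graph
(`LatticeCurve.par_injective`, `LatticeCurve.mem_nbhd_iff`). The Dehn twist along it acts through a
map `q` to the circle that winds once across the annulus. The class of `q` is found by counting
crossings of the grid curve with a horizontal circle (`LatticeCurve.class_dual`), and it is primitive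
(`HasClass.eq_of_dual`), so the twist is exactly an elementary transvection
(`LatticeCurve.exists_twist`).
-/

noncomputable section

/-! ### Lifting circle-valued maps -/

/-- The standard torus `S¹ × S¹`. -/
abbrev Torus : Type := Circle × Circle

theorem Circle.exists_lift {A : Type*} [TopologicalSpace A] [SimplyConnectedSpace A]
    [LocallyPathConnectedSpace A] (f : C(A, Circle)) : ∃ F : C(A, ℝ), ∀ a, f a = Circle.exp (F a) := by
  obtain ⟨a₀⟩ := (inferInstance : Nonempty A)
  obtain ⟨t, ht⟩ := Circle.exp_surjective (f a₀)
  obtain ⟨F, ⟨-, hF⟩, -⟩ := Circle.isCoveringMap_exp.existsUnique_continuousMap_lifts f a₀ t ht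
  exact ⟨F, fun a => (congrFun hF a).symm⟩

theorem exists_int_const_of_exp_eq' {A : Type*} [TopologicalSpace A] [PreconnectedSpace A]
    {f g : A → ℝ} (hf : Continuous f) (hg : Continuous g)
    (h : ∀ t, Circle.exp (f t) = Circle.exp (g t)) :
    ∃ n : ℤ, ∀ t, f t = g t + 2 * Real.pi * n := by
  have hpi : (2 * Real.pi) ≠ 0 := by positivity
  rcases isEmpty_or_nonempty A with hA | ⟨⟨a₀⟩⟩
  · exact ⟨0, fun t => (hA.false t).elim⟩
  have key : ∀ t, ∃ m : ℤ, (f t - g t) / (2 * Real.pi) = m := by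
    intro t
    obtain ⟨m, hm⟩ := Circle.exp_eq_exp.1 (h t)
    exact ⟨m, by rw [hm]; field_simp; ring⟩
  choose m hm using key
  have hmc : Continuous m := by
    have hc : Continuous fun t => ((m t : ℤ) : ℝ) := by
      rw [show (fun t => ((m t : ℤ) : ℝ)) = fun t => (f t - g t) / (2 * Real.pi) from
        funext fun t => (hm t).symm]
      exact (hf.sub hg).div_const _
    exact Int.isClosedEmbedding_coe_real.isEmbedding.continuous_iff.2 hc
  refine ⟨m a₀, fun t => ?_⟩
  have hcst : m t = m a₀ := PreconnectedSpace.constant inferInstance hmc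
  have h1 := hm t
  rw [hcst, div_eq_iff hpi] at h1
  linarith

theorem HasWindingNumber.unique {γ : Circle → ℂ} {n k : ℤ} (hn : HasWindingNumber γ n)
    (hk : HasWindingNumber γ k) : n = k := by
  obtain ⟨h0, θ, hθ, h1, h2⟩ := hn
  obtain ⟨-, η, hη, h3, h4⟩ := hk
  obtain ⟨j, hj⟩ := exists_int_const_of_exp_eq hθ hη (fun t => by
    have := (h1 t).symm.trans (h3 t)
    have hne : (‖γ (Circle.exp t)‖ : ℂ) ≠ 0 := by simpa using h0 _
    exact Circle.ext (mul_left_cancel₀ hne this))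
  have a := h2 0
  rw [hj, hj, h4] at a
  have c : (2 * Real.pi) * ((n : ℝ) - k) = 0 := by linarith
  rcases mul_eq_zero.1 c with c | c
  · exact absurd c (by positivity)
  · exact_mod_cast sub_eq_zero.1 c

theorem exists_degree_lift (f : C(Circle, Circle)) :
    ∃ θ : ℝ → ℝ, Continuous θ ∧ (∀ t, f (Circle.exp t) = Circle.exp (θ t)) ∧
      ∀ t, θ (t + 2 * Real.pi) = θ t + 2 * Real.pi * circleDegree f := by
  obtain ⟨-, θ, hθ, h1, h2⟩ := circleDegree_spec f
  refine ⟨θ, hθ, fun t => ?_, h2⟩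
  have := h1 t
  simp only [Circle.norm_coe, Complex.ofReal_one, one_mul] at this
  exact Circle.ext this

theorem circleDegree_eq {f : C(Circle, Circle)} {θ : ℝ → ℝ} {n : ℤ} (hθ : Continuous θ)
    (h : ∀ t, f (Circle.exp t) = Circle.exp (θ t))
    (hp : ∀ t, θ (t + 2 * Real.pi) = θ t + 2 * Real.pi * n) : circleDegree f = n :=
  (circleDegree_spec f).unique ⟨fun _ => Circle.coe_ne_zero _, θ, hθ, fun t => by simp [h], hp⟩

theorem Circle.exp_isOpenQuotientMap : IsOpenQuotientMap (Circle.exp : ℝ → Circle) :=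
  ⟨Circle.exp_surjective, Circle.exp.continuous, Circle.isCoveringMap_exp.isOpenMap⟩

theorem exists_descend {v : ℝ × ℝ → ℝ} (hv : Continuous v)
    (h1 : ∀ x y, v (x + 2 * Real.pi, y) = v (x, y))
    (h2 : ∀ x y, v (x, y + 2 * Real.pi) = v (x, y)) :
    ∃ V : C(Torus, ℝ), ∀ x y, V (Circle.exp x, Circle.exp y) = v (x, y) := by
  have hq : Topology.IsQuotientMap (ContinuousMap.prodMap Circle.exp Circle.exp) :=
    (Circle.exp_isOpenQuotientMap.prodMap Circle.exp_isOpenQuotientMap).isQuotientMap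
  have p1 : ∀ y, Function.Periodic (fun x => v (x, y)) (2 * Real.pi) := fun y x => h1 x y
  have p2 : ∀ x, Function.Periodic (fun y => v (x, y)) (2 * Real.pi) := fun x y => h2 x y
  have hfac : Function.FactorsThrough (⟨v, hv⟩ : C(ℝ × ℝ, ℝ))
      (ContinuousMap.prodMap Circle.exp Circle.exp) := by
    rintro ⟨x, y⟩ ⟨x', y'⟩ h
    simp only [ContinuousMap.prodMap_apply, Prod.map_apply, Prod.mk.injEq] at h
    obtain ⟨m, hm⟩ := Circle.exp_eq_exp.1 h.1
    obtain ⟨n, hn⟩ := Circle.exp_eq_exp.1 h.2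
    rw [hm, hn, ContinuousMap.coe_mk]
    exact ((p1 _).int_mul m x').trans ((p2 _).int_mul n y')
  refine ⟨hq.lift ⟨v, hv⟩ hfac, fun x y => ?_⟩
  exact ContinuousMap.congr_fun (hq.lift_comp ⟨v, hv⟩ hfac) (x, y)

/-- The map `f : S¹ × S¹ → S¹` is homotopic to `(X, Y) ↦ X ^ a * Y ^ b`, expressed by a global
logarithm of the quotient. -/
def HasClass (f : C(Torus, Circle)) (a b : ℤ) : Prop :=
  ∃ v : C(Torus, ℝ), ∀ p, f p = p.1 ^ a * p.2 ^ b * Circle.exp (v p)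

theorem Circle.exp_mul_int (x : ℝ) (n : ℤ) : Circle.exp (x * n) = Circle.exp x ^ n := by
  rw [mul_comm, Circle.exp_intCast_mul]

theorem exists_hasClass (f : C(Torus, Circle)) : ∃ a b, HasClass f a b := by
  obtain ⟨F, hF⟩ := Circle.exists_lift (f.comp (ContinuousMap.prodMap Circle.exp Circle.exp))
  have hF' : ∀ x y, f (Circle.exp x, Circle.exp y) = Circle.exp (F (x, y)) := fun x y => hF (x, y)
  obtain ⟨a, ha⟩ := exists_int_const_of_exp_eq' (f := fun p : ℝ × ℝ => F (p.1 + 2 * Real.pi, p.2))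
    (g := F) (by fun_prop) F.continuous (fun p => by
      rw [← hF', Circle.exp_add_two_pi, hF'])
  obtain ⟨b, hb⟩ := exists_int_const_of_exp_eq' (f := fun p : ℝ × ℝ => F (p.1, p.2 + 2 * Real.pi))
    (g := F) (by fun_prop) F.continuous (fun p => by
      rw [← hF', Circle.exp_add_two_pi, hF'])
  obtain ⟨V, hV⟩ := exists_descend (v := fun p => F p - p.1 * a - p.2 * b) (by fun_prop)
    (fun x y => by have := ha (x, y); simp only at this ⊢; rw [this]; ring)
    (fun x y => by have := hb (x, y); simp only at this ⊢; rw [this]; ring)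
  refine ⟨a, b, V, ?_⟩
  rintro ⟨p, q⟩
  obtain ⟨x, rfl⟩ := Circle.exp_surjective p
  obtain ⟨y, rfl⟩ := Circle.exp_surjective q
  rw [hV, hF', ← Circle.exp_mul_int, ← Circle.exp_mul_int, ← Circle.exp_add, ← Circle.exp_add]
  congr 1
  ring

/-- The degree of a curve in the torus composed with a map of known class. -/
theorem HasClass.degree_comp {f : C(Torus, Circle)} {a b : ℤ} (hf : HasClass f a b)
    (c : C(Circle, Torus)) :
    circleDegree (f.comp c) = a * circleDegree (ContinuousMap.fst.comp c) +
      b * circleDegree (ContinuousMap.snd.comp c) := by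
  obtain ⟨v, hv⟩ := hf
  obtain ⟨θ, hθ, h1, h2⟩ := exists_degree_lift (ContinuousMap.fst.comp c)
  obtain ⟨η, hη, h3, h4⟩ := exists_degree_lift (ContinuousMap.snd.comp c)
  refine circleDegree_eq (θ := fun t => θ t * a + η t * b + v (c (Circle.exp t))) (by fun_prop)
    (fun t => ?_) (fun t => ?_)
  · have e1 : (c (Circle.exp t)).1 = Circle.exp (θ t) := h1 t
    have e2 : (c (Circle.exp t)).2 = Circle.exp (η t) := h3 t
    rw [ContinuousMap.comp_apply, hv, e1, e2, Circle.exp_add, Circle.exp_add, Circle.exp_mul_int,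
      Circle.exp_mul_int]
  · simp only [h2, h4, Circle.exp_add_two_pi]
    push_cast
    ring

theorem circleDegree_const (u : Circle) : circleDegree (ContinuousMap.const _ u) = 0 := by
  obtain ⟨t, rfl⟩ := Circle.exp_surjective u
  exact circleDegree_eq (θ := fun _ => t) continuous_const (fun _ => rfl) (fun _ => by simp)

theorem circleDegree_id : circleDegree (ContinuousMap.id _) = 1 :=
  circleDegree_eq (θ := fun t => t) continuous_id (fun _ => rfl) (fun _ => by simp)

/-- The loop `u ↦ (u, y)`. -/
def loopX (y : Circle) : C(Circle, Torus) := (ContinuousMap.id _).prodMk (ContinuousMap.const _ y)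

/-- The loop `u ↦ (x, u)`. -/
def loopY (x : Circle) : C(Circle, Torus) := (ContinuousMap.const _ x).prodMk (ContinuousMap.id _)

theorem HasClass.degree_loopX {f : C(Torus, Circle)} {a b : ℤ} (hf : HasClass f a b) (y : Circle) :
    circleDegree (f.comp (loopX y)) = a := by
  rw [hf.degree_comp, show ContinuousMap.fst.comp (loopX y) = ContinuousMap.id _ from rfl,
    show ContinuousMap.snd.comp (loopX y) = ContinuousMap.const _ y from rfl, circleDegree_id,
    circleDegree_const]
  ring

theorem HasClass.degree_loopY {f : C(Torus, Circle)} {a b : ℤ} (hf : HasClass f a b) (x : Circle) :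
    circleDegree (f.comp (loopY x)) = b := by
  rw [hf.degree_comp, show ContinuousMap.fst.comp (loopY x) = ContinuousMap.const _ x from rfl,
    show ContinuousMap.snd.comp (loopY x) = ContinuousMap.id _ from rfl, circleDegree_id,
    circleDegree_const]
  ring

theorem HasClass.unique {f : C(Torus, Circle)} {a b a' b' : ℤ} (hf : HasClass f a b)
    (hf' : HasClass f a' b') : a = a' ∧ b = b' :=
  ⟨(hf.degree_loopX 1).symm.trans (hf'.degree_loopX 1),
    (hf.degree_loopY 1).symm.trans (hf'.degree_loopY 1)⟩

/-- A map `S¹ × [0, 1] → S¹` is `u ^ m` times a map with a global logarithm. -/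
theorem exists_log_annulus (f : C(Circle × unitInterval, Circle)) :
    ∃ (m : ℤ) (w : C(Circle × unitInterval, ℝ)), ∀ p, f p = p.1 ^ m * Circle.exp (w p) := by
  -- The interval is a retract of the circle, with a section along which the logarithm is explicit.
  let ret : C(Circle, unitInterval) :=
    ⟨fun u => Set.projIcc 0 1 zero_le_one ((1 + (u : ℂ).re) / 2), by
      refine continuous_projIcc.comp ?_
      exact (continuous_const.add (Complex.continuous_re.comp continuous_subtype_val)).div_const _⟩
  let s : C(unitInterval, ℝ) := ⟨fun t => Real.arccos (2 * t - 1), by fun_prop⟩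
  have hs : ∀ t, ret (Circle.exp (s t)) = t := by
    intro t
    have h0 := t.2.1
    have h1 := t.2.2
    have : ((1 + ((Circle.exp (s t) : Circle) : ℂ).re) / 2) = (t : ℝ) := by
      rw [Circle.coe_exp, Complex.exp_ofReal_mul_I_re]
      simp only [s, ContinuousMap.coe_mk]
      rw [Real.cos_arccos (by linarith) (by linarith)]
      ring
    simp only [ret, ContinuousMap.coe_mk, this, Set.projIcc_val]
  obtain ⟨a, b, v, hv⟩ := exists_hasClass (f.comp ((ContinuousMap.id _).prodMap ret))
  refine ⟨a, ⟨fun p => s p.2 * b + v (p.1, Circle.exp (s p.2)), by fun_prop⟩, ?_⟩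
  rintro ⟨u, t⟩
  have := hv (u, Circle.exp (s t))
  simp only [ContinuousMap.comp_apply, ContinuousMap.prodMap_apply, Prod.map_apply, hs,
    ContinuousMap.id_apply] at this
  rw [this]
  change _ = u ^ a * Circle.exp (s t * b + v (u, Circle.exp (s t)))
  rw [Circle.exp_add, Circle.exp_mul_int, mul_assoc]

theorem circleDegree_slice {f : C(Circle × unitInterval, Circle)} {m : ℤ}
    {w : C(Circle × unitInterval, ℝ)} (h : ∀ p, f p = p.1 ^ m * Circle.exp (w p))
    (t : unitInterval) :
    circleDegree (f.comp ((ContinuousMap.id _).prodMk (ContinuousMap.const _ t))) = m := by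
  refine circleDegree_eq (θ := fun x => x * m + w (Circle.exp x, t)) (by fun_prop) (fun x => ?_)
    (fun x => ?_)
  · simp [h, Circle.exp_add, Circle.exp_mul_int]
  · simp only [Circle.exp_add_two_pi]; ring

theorem exists_log_circle (f : C(Circle, Circle)) :
    ∃ w : C(Circle, ℝ), ∀ u, f u = u ^ circleDegree f * Circle.exp (w u) := by
  obtain ⟨m, w, hw⟩ := exists_log_annulus (f.comp ContinuousMap.fst)
  have := circleDegree_slice hw 0
  change circleDegree f = m at this
  exact ⟨w.comp ((ContinuousMap.id _).prodMk (ContinuousMap.const _ 0)), fun u => by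
    rw [this]; exact hw (u, 0)⟩

theorem circleDegree_congr_homotopic {f g : C(Circle, Circle)} (h : f.Homotopic g) :
    circleDegree f = circleDegree g := by
  obtain ⟨F⟩ := h
  let F' : C(Circle × unitInterval, Circle) := F.toContinuousMap.comp ContinuousMap.prodSwap
  obtain ⟨m, w, hw⟩ := exists_log_annulus F'
  have h0 := circleDegree_slice hw 0
  have h1 := circleDegree_slice hw 1
  rw [show F'.comp ((ContinuousMap.id _).prodMk (ContinuousMap.const _ 0)) = f from
    ContinuousMap.ext fun u => F.apply_zero u] at h0
  rw [show F'.comp ((ContinuousMap.id _).prodMk (ContinuousMap.const _ 1)) = g from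
    ContinuousMap.ext fun u => F.apply_one u] at h1
  rw [h0, h1]

theorem homotopic_of_circleDegree_eq {f g : C(Circle, Circle)}
    (h : circleDegree f = circleDegree g) : f.Homotopic g := by
  obtain ⟨v, hv⟩ := exists_log_circle f
  obtain ⟨w, hw⟩ := exists_log_circle g
  refine ⟨⟨⟨fun p => p.2 ^ circleDegree f *
    Circle.exp ((1 - p.1 : ℝ) * v p.2 + p.1 * w p.2), ?_⟩, fun u => ?_, fun u => ?_⟩⟩
  · fun_prop
  · simp [hv u]
  · simp [hw u, h]

theorem homotopic_torus_iff {c d : C(Circle, Torus)} :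
    c.Homotopic d ↔
      circleDegree (ContinuousMap.fst.comp c) = circleDegree (ContinuousMap.fst.comp d) ∧
      circleDegree (ContinuousMap.snd.comp c) = circleDegree (ContinuousMap.snd.comp d) := by
  refine ⟨fun h => ⟨circleDegree_congr_homotopic (.comp (.refl _) h),
    circleDegree_congr_homotopic (.comp (.refl _) h)⟩, ?_⟩
  rintro ⟨h1, h2⟩
  exact (homotopic_of_circleDegree_eq h1).prodMk (homotopic_of_circleDegree_eq h2)

/-! ### Classes of self-maps of the torus -/

/-- The continuous self-map `Φ` of the torus acts on the first homology by the matrix `M`. -/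
def HasMatrix (Φ : C(Torus, Torus)) (M : Matrix (Fin 2) (Fin 2) ℤ) : Prop :=
  HasClass (ContinuousMap.fst.comp Φ) (M 0 0) (M 0 1) ∧
    HasClass (ContinuousMap.snd.comp Φ) (M 1 0) (M 1 1)

theorem exists_hasMatrix (Φ : C(Torus, Torus)) : ∃ M, HasMatrix Φ M := by
  obtain ⟨a, b, h⟩ := exists_hasClass (ContinuousMap.fst.comp Φ)
  obtain ⟨c, d, h'⟩ := exists_hasClass (ContinuousMap.snd.comp Φ)
  exact ⟨!![a, b; c, d], h, h'⟩

theorem HasClass.comp {f : C(Torus, Circle)} {a b : ℤ} (hf : HasClass f a b)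
    {Φ : C(Torus, Torus)} {M : Matrix (Fin 2) (Fin 2) ℤ} (hΦ : HasMatrix Φ M) :
    HasClass (f.comp Φ) (a * M 0 0 + b * M 1 0) (a * M 0 1 + b * M 1 1) := by
  obtain ⟨v, hv⟩ := hf
  obtain ⟨⟨v1, h1⟩, ⟨v2, h2⟩⟩ := hΦ
  refine ⟨⟨fun p => v1 p * a + v2 p * b + v (Φ p), by fun_prop⟩, fun p => ?_⟩
  have e1 : (Φ p).1 = _ := h1 p
  have e2 : (Φ p).2 = _ := h2 p
  rw [ContinuousMap.comp_apply, hv, e1, e2]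
  change _ = _ * Circle.exp (v1 p * a + v2 p * b + v (Φ p))
  rw [Circle.exp_add, Circle.exp_add, Circle.exp_mul_int, Circle.exp_mul_int]
  simp only [mul_zpow, zpow_add, zpow_mul']
  generalize Circle.exp (v1 p) ^ a = A
  generalize Circle.exp (v2 p) ^ b = B
  ac_rfl

theorem HasMatrix.comp {Φ Ψ : C(Torus, Torus)} {M N : Matrix (Fin 2) (Fin 2) ℤ}
    (hΦ : HasMatrix Φ M) (hΨ : HasMatrix Ψ N) : HasMatrix (Φ.comp Ψ) (M * N) := by
  have h1 := hΦ.1.comp hΨ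
  have h2 := hΦ.2.comp hΨ
  refine ⟨?_, ?_⟩ <;> simp only [Matrix.mul_apply, Fin.sum_univ_two]
  · exact h1
  · exact h2

theorem HasMatrix.id : HasMatrix (ContinuousMap.id _) 1 :=
  ⟨⟨0, fun p => by simp⟩, ⟨0, fun p => by simp⟩⟩

theorem HasMatrix.unique {Φ : C(Torus, Torus)} {M N : Matrix (Fin 2) (Fin 2) ℤ}
    (hM : HasMatrix Φ M) (hN : HasMatrix Φ N) : M = N := by
  obtain ⟨h1, h2⟩ := hM.1.unique hN.1
  obtain ⟨h3, h4⟩ := hM.2.unique hN.2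
  ext i j
  fin_cases i <;> fin_cases j <;> assumption

theorem HasMatrix.mul_symm {h : Torus ≃ₜ Torus} {M N : Matrix (Fin 2) (Fin 2) ℤ}
    (hM : HasMatrix (h : C(Torus, Torus)) M) (hN : HasMatrix (h.symm : C(Torus, Torus)) N) :
    M * N = 1 := by
  refine (hM.comp hN).unique ?_
  have : (h : C(Torus, Torus)).comp (h.symm : C(Torus, Torus)) = ContinuousMap.id _ := by
    ext1 p; simp
  rw [this]
  exact HasMatrix.id

/-- The linear self-map of the torus with the given integer matrix. -/
def linearMap (M : Matrix (Fin 2) (Fin 2) ℤ) : C(Torus, Torus) where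
  toFun p := (p.1 ^ M 0 0 * p.2 ^ M 0 1, p.1 ^ M 1 0 * p.2 ^ M 1 1)
  continuous_toFun := by fun_prop

theorem hasMatrix_linearMap (M : Matrix (Fin 2) (Fin 2) ℤ) : HasMatrix (linearMap M) M :=
  ⟨⟨0, fun p => by simp [linearMap]⟩, ⟨0, fun p => by simp [linearMap]⟩⟩

theorem linearMap_mul (M N : Matrix (Fin 2) (Fin 2) ℤ) (p : Torus) :
    linearMap (M * N) p = linearMap M (linearMap N p) := by
  simp only [linearMap, ContinuousMap.coe_mk, Matrix.mul_apply, Fin.sum_univ_two, mul_zpow,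
    zpow_add, Prod.mk.injEq, zpow_mul']
  constructor <;> ac_rfl

theorem linearMap_one (p : Torus) : linearMap 1 p = p := by simp [linearMap]

/-- The linear homeomorphism of the torus with the given pair of inverse integer matrices. -/
def linearHomeo (M N : Matrix (Fin 2) (Fin 2) ℤ) (h : M * N = 1) : Torus ≃ₜ Torus where
  toFun := linearMap M
  invFun := linearMap N
  left_inv p := by rw [← linearMap_mul, mul_eq_one_comm.1 h, linearMap_one]
  right_inv p := by rw [← linearMap_mul, h, linearMap_one]
  continuous_toFun := (linearMap M).continuous
  continuous_invFun := (linearMap N).continuous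

end

noncomputable section

/-! ### Winding numbers under homotopy -/

open ComplexConjugate

theorem HasWindingNumber.of_homotopy {Γ : ℝ → Circle → ℂ}
    (hΓ : Continuous fun p : ℝ × Circle => Γ p.1 p.2)
    (h0 : ∀ s ∈ Set.Icc (0 : ℝ) 1, ∀ u, Γ s u ≠ 0) {n : ℤ} (h : HasWindingNumber (Γ 0) n) :
    HasWindingNumber (Γ 1) n := by
  have hne : ∀ p : Circle × unitInterval, Γ p.2 p.1 ≠ 0 := fun p => h0 _ p.2.2 _
  have hc : Continuous fun p : Circle × unitInterval => Γ p.2 p.1 :=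
    hΓ.comp (f := fun p : Circle × unitInterval => ((p.2 : ℝ), p.1)) (by fun_prop)
  let f : C(Circle × unitInterval, Circle) :=
    ⟨fun p => ⟨Γ p.2 p.1 / ‖Γ p.2 p.1‖, mem_sphere_zero_iff_norm.2 (by
      rw [norm_div, Complex.norm_real, norm_norm, div_self (norm_ne_zero_iff.2 (hne p))])⟩,
      Continuous.subtype_mk (hc.div (Complex.continuous_ofReal.comp hc.norm) fun p =>
        Complex.ofReal_ne_zero.2 (norm_ne_zero_iff.2 (hne p))) _⟩
  obtain ⟨m, w, hw⟩ := exists_log_annulus f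
  have key : ∀ s : unitInterval, HasWindingNumber (Γ s) m := by
    refine fun s => ⟨fun u => hne (u, s), fun t => t * m + w (Circle.exp t, s), by fun_prop,
      fun t => ?_, fun t => ?_⟩
    · have h1 := hw (Circle.exp t, s)
      rw [Circle.exp_add, Circle.exp_mul_int, ← h1]
      have h2 := hne (Circle.exp t, s)
      have h3 : (‖Γ s (Circle.exp t)‖ : ℂ) ≠ 0 := Complex.ofReal_ne_zero.2 (norm_ne_zero_iff.2 h2)
      change _ = _ * (Γ s (Circle.exp t) / ‖Γ s (Circle.exp t)‖)
      rw [mul_div_cancel₀ _ h3]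
    · simp only [Circle.exp_add_two_pi]; ring
  have e0 := key 0
  have e1 := key 1
  simp only [Set.Icc.coe_zero, Set.Icc.coe_one] at e0 e1
  rwa [h.unique e0]

/-- Rouché's principle: a perturbation smaller than the distance to `0` keeps the winding number. -/
theorem HasWindingNumber.of_norm_sub_lt {γ γ' : Circle → ℂ} (hγ : Continuous γ)
    (hγ' : Continuous γ') (hlt : ∀ u, ‖γ' u - γ u‖ < ‖γ u‖) {n : ℤ} (h : HasWindingNumber γ n) :
    HasWindingNumber γ' n := by
  have key := HasWindingNumber.of_homotopy (Γ := fun s u => γ u + (s : ℂ) * (γ' u - γ u))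
    (n := n) (by fun_prop) (fun s hs u h0 => ?_) (by simpa using h)
  · simpa using key
  · have h1 : ‖γ u‖ = ‖(s : ℂ) * (γ' u - γ u)‖ := by
      rw [← norm_neg ((s : ℂ) * _), ← eq_neg_of_add_eq_zero_left h0]
    rw [norm_mul, Complex.norm_real, Real.norm_of_nonneg hs.1] at h1
    have := hlt u
    nlinarith [hs.1, hs.2, norm_nonneg (γ' u - γ u)]

theorem hasWindingNumber_const {c : ℂ} (hc : c ≠ 0) : HasWindingNumber (fun _ => c) 0 :=
  ⟨fun _ => hc, fun _ => c.arg, continuous_const, fun _ => by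
    rw [Circle.coe_exp, Complex.norm_mul_exp_arg_mul_I], fun _ => by simp⟩

theorem hasWindingNumber_mul {c : ℂ} (hc : c ≠ 0) : HasWindingNumber (fun u => c * u) 1 := by
  refine ⟨fun u => mul_ne_zero hc u.coe_ne_zero, fun t => c.arg + t, by fun_prop, fun t => ?_,
    fun t => by push_cast; ring⟩
  rw [norm_mul, Circle.norm_coe, mul_one, Circle.exp_add, Circle.coe_mul, ← mul_assoc,
    Circle.coe_exp c.arg, Complex.norm_mul_exp_arg_mul_I]

theorem hasWindingNumber_mul_conj {c : ℂ} (hc : c ≠ 0) :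
    HasWindingNumber (fun u => c * conj (u : ℂ)) (-1) := by
  refine ⟨fun u => mul_ne_zero hc ((map_ne_zero _).2 u.coe_ne_zero), fun t => c.arg - t,
    by fun_prop, fun t => ?_, fun t => by push_cast; ring⟩
  rw [norm_mul, RCLike.norm_conj, Circle.norm_coe, mul_one, Circle.exp_sub, div_eq_mul_inv,
    Circle.coe_mul, ← mul_assoc, Circle.coe_exp c.arg, Complex.norm_mul_exp_arg_mul_I,
    Circle.coe_inv_eq_conj]

/-- A continuous self-map of the plane at bounded distance from the identity is surjective. -/
theorem surjective_of_bounded_distance {Φ : ℂ → ℂ} (hΦ : Continuous Φ) {C : ℝ}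
    (hC : ∀ z, ‖Φ z - z‖ ≤ C) : Function.Surjective Φ := by
  intro w
  by_contra! hw
  have hC0 : 0 ≤ C := (norm_nonneg _).trans (hC 0)
  set R : ℝ := C + ‖w‖ + 1
  have hR : 0 < R := by positivity
  have h1 : HasWindingNumber (fun u : Circle => Φ (R * u) - w) 1 := by
    refine (hasWindingNumber_mul (Complex.ofReal_ne_zero.2 hR.ne')).of_norm_sub_lt
      (by fun_prop) (by fun_prop) (fun u => ?_)
    rw [norm_mul, Circle.norm_coe, Complex.norm_real, Real.norm_of_nonneg hR.le, mul_one]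
    have := norm_sub_le (Φ (R * u) - R * u) w
    rw [show Φ (R * u) - w - R * u = Φ (R * u) - R * u - w by ring]
    linarith [hC (R * u)]
  have h0 := HasWindingNumber.of_homotopy (Γ := fun s u => Φ (s * (R * u)) - w) (n := 0)
    (by fun_prop) (fun s _ u => sub_ne_zero.2 (hw _))
    (by simpa using hasWindingNumber_const (sub_ne_zero.2 (hw 0)))
  simp only [Complex.ofReal_one, one_mul] at h0
  exact absurd (h0.unique h1) (by norm_num)

/-! ### Lifts of torus maps to the plane -/

/-- The real linear self-map of the plane with the given integer matrix. -/
def planeLinear (M : Matrix (Fin 2) (Fin 2) ℤ) (z : ℂ) : ℂ :=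
  ⟨M 0 0 * z.re + M 0 1 * z.im, M 1 0 * z.re + M 1 1 * z.im⟩

theorem exists_planeLinear_eq (M : Matrix (Fin 2) (Fin 2) ℤ) : ∃ α β : ℂ,
    (∀ z, planeLinear M z = α * z + β * conj z) ∧ ‖α‖ ^ 2 - ‖β‖ ^ 2 = M.det := by
  refine ⟨⟨(M 0 0 + M 1 1) / 2, (M 1 0 - M 0 1) / 2⟩, ⟨(M 0 0 - M 1 1) / 2, (M 1 0 + M 0 1) / 2⟩,
    fun z => ?_, ?_⟩
  · apply Complex.ext <;> simp [planeLinear] <;> ring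
  · rw [← Complex.normSq_eq_norm_sq, ← Complex.normSq_eq_norm_sq, Complex.normSq_mk,
      Complex.normSq_mk, Matrix.det_fin_two]
    push_cast
    ring

theorem planeLinear_sub (M : Matrix (Fin 2) (Fin 2) ℤ) (z w : ℂ) :
    planeLinear M (z - w) = planeLinear M z - planeLinear M w := by
  apply Complex.ext <;> simp [planeLinear] <;> ring

/-- A linear map of non-zero determinant winds once around the origin, in the direction given by
the sign of its determinant, and so does each map that is close to it at infinity. -/
theorem exists_large_winding {M : Matrix (Fin 2) (Fin 2) ℤ} {n : ℤ}
    (hn : (0 < M.det ∧ n = 1) ∨ (M.det < 0 ∧ n = -1)) (C : ℝ) :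
    ∃ R : ℝ, ∀ r, R < r → 0 < r → ∀ γ : Circle → ℂ, Continuous γ →
      (∀ u : Circle, ‖γ u - planeLinear M (r * u)‖ ≤ C) → HasWindingNumber γ n := by
  obtain ⟨α, β, hαβ, hdet⟩ := exists_planeLinear_eq M
  have hne : |‖α‖ - ‖β‖| ≠ 0 := by
    rw [abs_ne_zero]
    intro h
    have h1 : (M.det : ℝ) = 0 := by rw [← hdet]; linear_combination (‖α‖ + ‖β‖) * h
    have : M.det = 0 := by exact_mod_cast h1
    omega
  have hpos : 0 < |‖α‖ - ‖β‖| := lt_of_le_of_ne (abs_nonneg _) hne.symm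
  have hfac : (‖α‖ - ‖β‖) * (‖α‖ + ‖β‖) = M.det := by rw [← hdet]; ring
  refine ⟨C / |‖α‖ - ‖β‖|, fun r hr hr0 γ hγ hC => ?_⟩
  rw [div_lt_iff₀ hpos] at hr
  have hrC : (r : ℂ) ≠ 0 := Complex.ofReal_ne_zero.2 hr0.ne'
  have hcont : Continuous fun u : Circle => planeLinear M (r * u) := by
    simp only [hαβ]; fun_prop
  have hnorm : ∀ (c : ℂ) (u : Circle), ‖c * (r * (u : ℂ))‖ = ‖c‖ * r := fun c u => by
    simp [abs_of_pos hr0, Circle.norm_coe]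
  have hnorm' : ∀ (c : ℂ) (u : Circle), ‖c * conj (r * (u : ℂ))‖ = ‖c‖ * r := fun c u => by
    simp [abs_of_pos hr0, Circle.norm_coe]
  have hlin : HasWindingNumber (fun u : Circle => planeLinear M (r * u)) n := by
    rcases hn with ⟨hd, rfl⟩ | ⟨hd, rfl⟩
    · have hd' : (0 : ℝ) < M.det := by exact_mod_cast hd
      have hlt : ‖β‖ < ‖α‖ := by
        by_contra! hle
        nlinarith [norm_nonneg α, norm_nonneg β]
      have hα : α ≠ 0 := norm_pos_iff.1 ((norm_nonneg β).trans_lt hlt)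
      refine (hasWindingNumber_mul (mul_ne_zero hα hrC)).of_norm_sub_lt (by fun_prop) hcont
        fun u => ?_
      rw [hαβ, mul_assoc, add_sub_cancel_left, hnorm, hnorm']
      exact mul_lt_mul_of_pos_right hlt hr0
    · have hd' : (M.det : ℝ) < 0 := by exact_mod_cast hd
      have hlt : ‖α‖ < ‖β‖ := by
        by_contra! hle
        nlinarith [norm_nonneg α, norm_nonneg β]
      have hβ : β ≠ 0 := norm_pos_iff.1 ((norm_nonneg α).trans_lt hlt)
      refine (hasWindingNumber_mul_conj (mul_ne_zero hβ hrC)).of_norm_sub_lt (by fun_prop) hcont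
        fun u => ?_
      have e : β * r * conj (u : ℂ) = β * conj (r * (u : ℂ)) := by simp [mul_assoc]
      rw [hαβ, e, add_sub_cancel_right, hnorm, hnorm']
      exact mul_lt_mul_of_pos_right hlt hr0
  refine hlin.of_norm_sub_lt hcont hγ fun u => (hC u).trans_lt ?_
  have h1 := abs_norm_sub_norm_le (α * (r * (u : ℂ))) (-(β * conj (r * (u : ℂ))))
  rw [norm_neg, hnorm, hnorm', sub_neg_eq_add, ← hαβ, ← sub_mul, abs_mul, abs_of_pos hr0] at h1
  linarith

theorem exists_planeLift {Φ : C(Torus, Torus)} {M : Matrix (Fin 2) (Fin 2) ℤ}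
    (h : HasMatrix Φ M) : ∃ H : C(ℂ, ℂ), ∃ V : C(Torus, ℂ),
      (∀ z, H z = planeLinear M z + V (Circle.exp z.re, Circle.exp z.im)) ∧
      ∀ z, Φ (Circle.exp z.re, Circle.exp z.im) = (Circle.exp (H z).re, Circle.exp (H z).im) := by
  obtain ⟨⟨v, hv⟩, ⟨w, hw⟩⟩ := h
  have hV : Continuous fun p : Torus => (⟨v p, w p⟩ : ℂ) :=
    Complex.equivRealProdCLM.symm.continuous.comp (v.continuous.prodMk w.continuous)
  have hL : Continuous (planeLinear M) := by
    obtain ⟨α, β, h, -⟩ := exists_planeLinear_eq M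
    rw [show planeLinear M = _ from funext h]
    fun_prop
  have hV' := hV.comp (f := fun z : ℂ => (Circle.exp z.re, Circle.exp z.im)) (by fun_prop)
  refine ⟨⟨fun z => planeLinear M z + (⟨v (Circle.exp z.re, Circle.exp z.im),
    w (Circle.exp z.re, Circle.exp z.im)⟩ : ℂ), hL.add hV'⟩, ⟨_, hV⟩, fun z => rfl, fun z => ?_⟩
  have e1 := hv (Circle.exp z.re, Circle.exp z.im)
  have e2 := hw (Circle.exp z.re, Circle.exp z.im)
  simp only [ContinuousMap.comp_apply] at e1 e2
  refine Prod.ext (e1.trans ?_) (e2.trans ?_)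
  · simp [planeLinear, Circle.exp_add]
  · simp [planeLinear, Circle.exp_add]

/-! ### Orientation -/

namespace SolidTorus

variable {V V₁ V₂ : Type*} [TopologicalSpace V] [TopologicalSpace V₁] [TopologicalSpace V₂]

/-- The identification of the boundary torus with `S¹ × S¹` by the two coordinates. -/
def boundaryHomeo (e : SolidTorus V) : e.Boundary ≃ₜ Torus where
  toFun p := (e.coordX p, e.coordY p)
  invFun q := ⟨e.symm (q.1, ⟨q.2, by simp [Circle.norm_coe]⟩), by
    simp [boundarySet, Circle.norm_coe]⟩
  left_inv p := by
    apply Subtype.ext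
    rw [Homeomorph.symm_apply_eq]
    rfl
  right_inv q := by
    refine Prod.ext ?_ ?_
    · simp [coordX]
    · apply Circle.ext
      change ((e (e.symm _)).2 : ℂ) = _
      rw [Homeomorph.apply_symm_apply]
  continuous_toFun := by fun_prop
  continuous_invFun := by
    refine Continuous.subtype_mk (e.symm.continuous.comp ?_) _
    exact continuous_fst.prodMk (Continuous.subtype_mk
      (continuous_subtype_val.comp continuous_snd) _)

/-- A homeomorphism of boundary tori in coordinates. -/
def inCoords (e₁ : SolidTorus V₁) (e₂ : SolidTorus V₂) (h : e₁.Boundary ≃ₜ e₂.Boundary) :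
    Torus ≃ₜ Torus :=
  e₁.boundaryHomeo.symm.trans (h.trans e₂.boundaryHomeo)

theorem inCoords_apply (e₁ : SolidTorus V₁) (e₂ : SolidTorus V₂) (h : e₁.Boundary ≃ₜ e₂.Boundary)
    (p : e₁.Boundary) : inCoords e₁ e₂ h (e₁.coordX p, e₁.coordY p) =
      (e₂.coordX (h p), e₂.coordY (h p)) := by
  change e₂.boundaryHomeo (h (e₁.boundaryHomeo.symm (e₁.boundaryHomeo p))) = _
  rw [Homeomorph.symm_apply_apply]
  rfl

/-- A homeomorphism of the boundary tori preserves the orientation if and only if it acts on the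
first homology with determinant `1`. -/
theorem orientationPreserving_iff {e₁ : SolidTorus V₁} {e₂ : SolidTorus V₂}
    {h : e₁.Boundary ≃ₜ e₂.Boundary} {M : Matrix (Fin 2) (Fin 2) ℤ}
    (hM : HasMatrix (inCoords e₁ e₂ h : C(Torus, Torus)) M) :
    OrientationPreserving e₁ e₂ h ↔ M.det = 1 := by
  obtain ⟨H, W, hHV, hH⟩ := exists_planeLift hM
  obtain ⟨C, hC⟩ : ∃ C, ∀ p, ‖W p‖ ≤ C := by
    obtain ⟨C, hC⟩ := (isCompact_range W.continuous).isBounded.exists_norm_le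
    exact ⟨C, fun p => hC _ ⟨p, rfl⟩⟩
  have hclose : ∀ z w, ‖H (z + w) - H z - planeLinear M w‖ ≤ 2 * C := by
    intro z w
    have e : planeLinear M (z + w) - planeLinear M z = planeLinear M w := by
      rw [← planeLinear_sub, add_sub_cancel_left]
    have h1 := hC (Circle.exp (z + w).re, Circle.exp (z + w).im)
    have h2 := hC (Circle.exp z.re, Circle.exp z.im)
    rw [hHV, hHV z, ← e]
    calc _ = ‖W (Circle.exp (z + w).re, Circle.exp (z + w).im) -
          W (Circle.exp z.re, Circle.exp z.im)‖ := by congr 1; ring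
      _ ≤ _ := (norm_sub_le _ _).trans (by linarith)
  have hlarge : ∀ n : ℤ, ((0 < M.det ∧ n = 1) ∨ (M.det < 0 ∧ n = -1)) → ∀ z : ℂ, ∀ r₀ : ℝ,
      ∃ r, r₀ < r ∧ 0 < r ∧ HasWindingNumber (fun u => H (z + r * u) - H z) n := by
    intro n hn z r₀
    obtain ⟨R, hR⟩ := exists_large_winding hn (2 * C)
    refine ⟨max (max R r₀) 0 + 1, ?_, ?_, ?_⟩
    · linarith [le_max_right R r₀, le_max_left (max R r₀) 0]
    · linarith [le_max_right (max R r₀) 0]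
    · exact hR _ (by linarith [le_max_left R r₀, le_max_left (max R r₀) 0])
        (by linarith [le_max_right (max R r₀) 0]) _ (by fun_prop) (fun u => hclose _ _)
  constructor
  · rintro ⟨H', hH', hwind⟩
    obtain ⟨N, hN⟩ := exists_hasMatrix ((inCoords e₁ e₂ h).symm : C(Torus, Torus))
    have hunit : IsUnit M.det := by
      have := congrArg Matrix.det (hM.mul_symm hN)
      rw [Matrix.det_mul, Matrix.det_one] at this
      exact IsUnit.of_mul_eq_one _ this
    rcases Int.isUnit_iff.1 hunit with hd | hd
    · exact hd
    exfalso
    -- Two lifts of the same map differ by a translation.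
    have hpi : ∀ z : ℂ, (Circle.exp (H' z).re, Circle.exp (H' z).im) =
        (Circle.exp (H z).re, Circle.exp (H z).im) := by
      intro z
      obtain ⟨p, hp⟩ := e₁.boundaryHomeo.surjective (Circle.exp z.re, Circle.exp z.im)
      have hp1 : e₁.coordX p = Circle.exp z.re := congrArg Prod.fst hp
      have hp2 : e₁.coordY p = Circle.exp z.im := congrArg Prod.snd hp
      obtain ⟨h1, h2⟩ := hH' p z hp1 hp2
      rw [← h1, ← h2, ← inCoords_apply, hp1, hp2, ← hH]
      rfl
    obtain ⟨m, hm⟩ := exists_int_const_of_exp_eq' (f := fun z => (H' z).re)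
      (g := fun z => (H z).re) (by fun_prop) (by fun_prop) (fun z => congrArg Prod.fst (hpi z))
    obtain ⟨k, hk⟩ := exists_int_const_of_exp_eq' (f := fun z => (H' z).im)
      (g := fun z => (H z).im) (by fun_prop) (by fun_prop) (fun z => congrArg Prod.snd (hpi z))
    obtain ⟨r, -, hr, hw⟩ := hlarge (-1) (Or.inr ⟨by omega, rfl⟩) 0 0
    have hsame : (fun u : Circle => H' (0 + r * u) - H' 0) = fun u : Circle =>
        H (0 + r * u) - H 0 := by
      funext u
      apply Complex.ext
      · simp only [Complex.sub_re]; rw [hm, hm 0]; ring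
      · simp only [Complex.sub_im]; rw [hk, hk 0]; ring
    have := hwind 0 r hr
    rw [hsame] at this
    exact absurd (this.unique hw) (by norm_num)
  · intro hd
    have hinj : Function.Injective H := by
      intro z w hzw
      have e := (hH z).trans ((by rw [hzw] : _ = _).trans (hH w).symm)
      have e' := (inCoords e₁ e₂ h).injective e
      have e'' := hHV z
      rw [hzw, hHV w, e'] at e''
      have h0 : planeLinear M (z - w) = 0 := by
        rw [planeLinear_sub, sub_eq_zero]
        exact (add_right_cancel e'').symm
      have hr := congrArg Complex.re h0
      have hi := congrArg Complex.im h0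
      simp only [planeLinear, Complex.zero_re, Complex.zero_im] at hr hi
      have hd' : (M 0 0 * M 1 1 - M 0 1 * M 1 0 : ℝ) = 1 := by
        rw [Matrix.det_fin_two] at hd
        exact_mod_cast hd
      have x0 : (z - w).re = 0 := by
        linear_combination (-(z - w).re) * hd' + M 1 1 * hr - M 0 1 * hi
      have y0 : (z - w).im = 0 := by
        linear_combination (-(z - w).im) * hd' - M 1 0 * hr + M 0 0 * hi
      exact sub_eq_zero.1 (Complex.ext x0 y0)
    refine ⟨H, fun p z hx hy => ?_, fun z r hr => ?_⟩
    · have := inCoords_apply e₁ e₂ h p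
      rw [hx, hy] at this
      have h2 := (hH z).symm.trans this
      exact ⟨(congrArg Prod.fst h2).symm, (congrArg Prod.snd h2).symm⟩
    · obtain ⟨R, hrR, hR, hw⟩ := hlarge 1 (Or.inl ⟨by omega, rfl⟩) z r
      have key := HasWindingNumber.of_homotopy (n := 1)
        (Γ := fun s u => H (z + ((R + s * (r - R) : ℝ) : ℂ) * u) - H z) (by fun_prop)
        (fun s hs u => ?_) (by simpa using hw)
      · simpa using key
      · refine sub_ne_zero.2 fun heq => ?_
        have h1 := hinj heq
        have h2 : ((R + s * (r - R) : ℝ) : ℂ) * u = 0 := by linear_combination h1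
        rcases mul_eq_zero.1 h2 with h3 | h3
        · have h4 : R + s * (r - R) = 0 := Complex.ofReal_eq_zero.1 h3
          nlinarith [hs.1, hs.2]
        · exact u.coe_ne_zero h3

end SolidTorus

end

noncomputable section

/-! ### Extension over the solid torus -/

namespace SpiralExtension

/-- The point of the solid torus with polar coordinates `(p, τ)`: as the depth `τ ≥ 0` grows, the
curve `τ ↦ polar (p, τ)` spirals from the boundary point `p` towards the core. -/
def polar (p : Torus) (τ : ℝ) (hτ : 0 ≤ τ) : Circle × UnitDisk :=
  (p.1 * Circle.exp (-τ), ⟨Real.exp (-τ) * (p.2 : ℂ), by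
    rw [mem_closedBall_zero_iff, norm_mul, Circle.norm_coe, mul_one, Complex.norm_real,
      Real.norm_of_nonneg (Real.exp_pos _).le]
    exact Real.exp_le_one_iff.2 (by linarith)⟩)

/-- The depth of a point of the solid torus off the core. -/
def depth (x : Circle × UnitDisk) : ℝ := -Real.log ‖(x.2 : ℂ)‖

/-- The boundary point from which the spiral through a point off the core starts. -/
def foot (x : Circle × UnitDisk) : Torus :=
  (x.1 * Circle.exp (depth x), Circle.exp (x.2 : ℂ).arg)

theorem depth_nonneg (x : Circle × UnitDisk) : 0 ≤ depth x := by
  have := mem_closedBall_zero_iff.1 x.2.2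
  exact neg_nonneg.2 (Real.log_nonpos (norm_nonneg _) this)

theorem polar_foot {x : Circle × UnitDisk} (hx : (x.2 : ℂ) ≠ 0) :
    polar (foot x) (depth x) (depth_nonneg x) = x := by
  have h0 : 0 < ‖(x.2 : ℂ)‖ := norm_pos_iff.2 hx
  refine Prod.ext ?_ (Subtype.ext ?_)
  · simp [polar, foot]
  · simp only [polar, foot, depth, neg_neg, Real.exp_log h0]
    rw [Circle.coe_exp, Complex.norm_mul_exp_arg_mul_I]

theorem polar_snd_ne_zero (p : Torus) (τ : ℝ) (hτ : 0 ≤ τ) : ((polar p τ hτ).2 : ℂ) ≠ 0 :=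
  mul_ne_zero (Complex.ofReal_ne_zero.2 (Real.exp_pos _).ne') p.2.coe_ne_zero

theorem polar_injective {p p' : Torus} {τ τ' : ℝ} {hτ : 0 ≤ τ} {hτ' : 0 ≤ τ'}
    (h : polar p τ hτ = polar p' τ' hτ') : p = p' ∧ τ = τ' := by
  have h2 : (Real.exp (-τ) * (p.2 : ℂ) : ℂ) = Real.exp (-τ') * (p'.2 : ℂ) :=
    congrArg (fun x : Circle × UnitDisk => (x.2 : ℂ)) h
  have h3 := congrArg norm h2
  simp only [norm_mul, Circle.norm_coe, mul_one, Complex.norm_real,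
    Real.norm_of_nonneg (Real.exp_pos _).le, Real.exp_eq_exp, neg_inj] at h3
  subst h3
  have h1 : p.1 * Circle.exp (-τ) = p'.1 * Circle.exp (-τ) := congrArg Prod.fst h
  exact ⟨Prod.ext (mul_right_cancel h1) (Circle.ext (mul_left_cancel₀
    (Complex.ofReal_ne_zero.2 (Real.exp_pos _).ne') h2)), rfl⟩

/-- The reparametrization of the depth: it shifts the depths beyond `K` by `u` and fixes `0`. -/
def shift (K u τ : ℝ) : ℝ := τ + u * (min τ K / K)

variable {K u : ℝ}

theorem shift_of_le (hK : 0 < K) {τ : ℝ} (h : K ≤ τ) : shift K u τ = τ + u := by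
  rw [shift, min_eq_right h, div_self hK.ne', mul_one]

theorem shift_of_ge (hK : 0 < K) {τ : ℝ} (h : τ ≤ K) : shift K u τ = τ * ((K + u) / K) := by
  rw [shift, min_eq_left h]
  field_simp

theorem shift_strictMono (hK : 0 < K) (hu : |u| < K) : StrictMono (shift K u) := by
  have h1 := neg_lt_of_abs_lt hu
  have hpos : 0 < (K + u) / K := div_pos (by linarith) hK
  have hKu : K * ((K + u) / K) = K + u := by field_simp
  intro τ τ' h
  rcases le_total τ' K with h2 | h2
  · rw [shift_of_ge hK h2, shift_of_ge hK (h.le.trans h2)]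
    exact mul_lt_mul_of_pos_right h hpos
  · rw [shift_of_le hK h2]
    rcases le_total τ K with h3 | h3
    · rw [shift_of_ge hK h3]
      rcases h3.lt_or_eq with h4 | h4
      · have := mul_lt_mul_of_pos_right h4 hpos
        linarith
      · rw [h4, hKu]; linarith
    · rw [shift_of_le hK h3]; linarith

theorem shift_zero (hK : 0 < K) : shift K u 0 = 0 := by simp [shift, hK.le]

theorem shift_nonneg (hK : 0 < K) (hu : |u| < K) {τ : ℝ} (hτ : 0 ≤ τ) : 0 ≤ shift K u τ := by
  rw [← shift_zero (u := u) hK]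
  exact (shift_strictMono hK hu).monotone hτ

theorem exists_shift_eq (hK : 0 < K) (hu : |u| < K) {t : ℝ} (ht : 0 ≤ t) :
    ∃ τ, 0 ≤ τ ∧ shift K u τ = t := by
  have h1 : 0 < K + u := by linarith [neg_lt_of_abs_lt hu]
  rcases le_total t (K + u) with h | h
  · refine ⟨t * (K / (K + u)), by positivity, ?_⟩
    rw [shift_of_ge hK]
    · field_simp
    · rw [← mul_div_assoc, div_le_iff₀ h1]
      nlinarith
  · exact ⟨t - u, by linarith, by rw [shift_of_le hK (by linarith)]; ring⟩

variable (h : Torus ≃ₜ Torus) (v : C(Torus, ℝ)) (hK : 0 < K) (hv : ∀ p, |v p| < K)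

/-- The extension of `h` over the solid torus: it fixes the core and maps spirals to spirals. -/
def extension (x : Circle × UnitDisk) : Circle × UnitDisk :=
  open Classical in
  if (x.2 : ℂ) = 0 then x else
    polar (h (foot x)) (shift K (v (foot x)) (depth x)) (shift_nonneg hK (hv _) (depth_nonneg x))

theorem extension_polar (p : Torus) (τ : ℝ) (hτ : 0 ≤ τ) :
    extension h v hK hv (polar p τ hτ) =
      polar (h p) (shift K (v p) τ) (shift_nonneg hK (hv _) hτ) := by
  have hne := polar_snd_ne_zero p τ hτ
  obtain ⟨h1, h2⟩ := polar_injective (polar_foot hne)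
  simp only [extension, if_neg hne, h1, h2]

theorem extension_core {x : Circle × UnitDisk} (hx : (x.2 : ℂ) = 0) :
    extension h v hK hv x = x := if_pos hx

theorem extension_bijective : Function.Bijective (extension h v hK hv) := by
  constructor
  · intro x y hxy
    by_cases hx : (x.2 : ℂ) = 0 <;> by_cases hy : (y.2 : ℂ) = 0
    · rwa [extension_core h v hK hv hx, extension_core h v hK hv hy] at hxy
    · rw [extension_core h v hK hv hx, ← polar_foot hy, extension_polar] at hxy
      exact absurd (hxy ▸ hx) (polar_snd_ne_zero _ _ _)
    · rw [extension_core h v hK hv hy, ← polar_foot hx, extension_polar] at hxy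
      exact absurd (hxy ▸ hy) (polar_snd_ne_zero _ _ _)
    · rw [← polar_foot hx, ← polar_foot hy, extension_polar, extension_polar] at hxy
      obtain ⟨h1, h2⟩ := polar_injective hxy
      have h3 := h.injective h1
      rw [h3] at h2
      have h4 := (shift_strictMono hK (hv _)).injective h2
      rw [← polar_foot hx, ← polar_foot hy]
      simp only [h3, h4]
  · intro y
    by_cases hy : (y.2 : ℂ) = 0
    · exact ⟨y, extension_core h v hK hv hy⟩
    · obtain ⟨τ, hτ, h1⟩ := exists_shift_eq hK (hv (h.symm (foot y))) (depth_nonneg y)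
      refine ⟨polar (h.symm (foot y)) τ hτ, ?_⟩
      rw [extension_polar]
      simp only [h1, Homeomorph.apply_symm_apply]
      exact polar_foot hy

theorem continuousAt_exp_arg {z : ℂ} (hz : z ≠ 0) :
    ContinuousAt (fun w : ℂ => Circle.exp w.arg) z := by
  have hind : Topology.IsInducing (fun u : Circle => (u : ℂ)) := ⟨rfl⟩
  rw [hind.continuousAt_iff]
  have : ((fun u : Circle => (u : ℂ)) ∘ fun w : ℂ => Circle.exp w.arg) =ᶠ[nhds z] fun w => w / ‖w‖ := by
    filter_upwards [isOpen_ne.mem_nhds hz] with w hw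
    have : (‖w‖ : ℂ) ≠ 0 := Complex.ofReal_ne_zero.2 (norm_ne_zero_iff.2 hw)
    rw [eq_div_iff this, mul_comm]
    exact Complex.norm_mul_exp_arg_mul_I w
  refine ContinuousAt.congr ?_ this.symm
  exact continuousAt_id.div (Complex.continuous_ofReal.continuousAt.comp continuous_norm.continuousAt)
    (Complex.ofReal_ne_zero.2 (norm_ne_zero_iff.2 hz))

theorem continuous_extension (hu : ∀ p, (h p).1 = p.1 * Circle.exp (v p)) :
    Continuous (extension h v hK hv) := by
  rw [continuous_iff_continuousAt]
  intro x
  have hcz : Continuous fun y : Circle × UnitDisk => (y.2 : ℂ) := by fun_prop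
  by_cases hx : (x.2 : ℂ) = 0
  · -- Near the core the first coordinate is preserved and the second one stays small.
    have hnear : ∀ᶠ y : Circle × UnitDisk in nhds x, ‖(y.2 : ℂ)‖ < Real.exp (-K) :=
      (hcz.norm.continuousAt (x := x)).eventually_lt_const (by simp [hx, Real.exp_pos])
    have hcalc : ∀ y : Circle × UnitDisk, ‖(y.2 : ℂ)‖ < Real.exp (-K) →
        (extension h v hK hv y).1 = y.1 ∧
          ‖((extension h v hK hv y).2 : ℂ)‖ ≤ Real.exp K * ‖(y.2 : ℂ)‖ := by
      intro y hy
      by_cases hy0 : (y.2 : ℂ) = 0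
      · rw [extension_core h v hK hv hy0]; simp [hy0]
      · have hpos := norm_pos_iff.2 hy0
        have hd : K ≤ depth y := by
          have := Real.log_lt_log hpos hy
          rw [Real.log_exp] at this
          unfold depth; linarith
        constructor
        · simp only [extension, if_neg hy0, polar, hu, shift_of_le hK hd]
          rw [foot, mul_assoc, mul_assoc, ← Circle.exp_add, ← Circle.exp_add]
          simp
        · simp only [extension, if_neg hy0, polar, norm_mul, Circle.norm_coe, mul_one,
            Complex.norm_real, Real.norm_of_nonneg (Real.exp_pos _).le, shift_of_le hK hd]
          have e : ‖(y.2 : ℂ)‖ = Real.exp (-depth y) := by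
            rw [depth, neg_neg, Real.exp_log hpos]
          rw [e, ← Real.exp_add]
          refine Real.exp_le_exp.2 ?_
          linarith [neg_lt_of_abs_lt (hv (foot y))]
    have hxe : extension h v hK hv x = x := extension_core h v hK hv hx
    refine ContinuousAt.prodMk (f := fun y => (extension h v hK hv y).1)
      (g := fun y => (extension h v hK hv y).2) ?_ ?_
    · refine continuous_fst.continuousAt.congr ?_
      filter_upwards [hnear] with y hy
      exact (hcalc y hy).1.symm
    · rw [Topology.IsInducing.subtypeVal.continuousAt_iff]
      change Filter.Tendsto _ _ (nhds ((extension h v hK hv x).2 : ℂ))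
      rw [hxe, hx]
      refine squeeze_zero_norm' (a := fun y : Circle × UnitDisk => Real.exp K * ‖(y.2 : ℂ)‖) ?_ ?_
      · filter_upwards [hnear] with y hy
        exact (hcalc y hy).2
      · have : Continuous fun y : Circle × UnitDisk => Real.exp K * ‖(y.2 : ℂ)‖ := by fun_prop
        simpa [hx] using this.tendsto x
  · have hd : ContinuousAt depth x :=
      ((Real.continuousAt_log (norm_ne_zero_iff.2 hx)).comp (f := fun y : Circle × UnitDisk =>
        ‖(y.2 : ℂ)‖) hcz.norm.continuousAt).neg
    have hf : ContinuousAt foot x := by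
      refine ContinuousAt.prodMk (continuous_fst.continuousAt.mul
        (Circle.exp.continuous.continuousAt.comp hd)) ?_
      exact (continuousAt_exp_arg hx).comp (f := fun y : Circle × UnitDisk => (y.2 : ℂ))
        hcz.continuousAt
    have hs : ContinuousAt (fun y => shift K (v (foot y)) (depth y)) x := by
      unfold shift
      exact hd.add ((v.continuous.continuousAt.comp hf).mul
        ((hd.min continuousAt_const).div_const _))
    have hhf : ContinuousAt (fun y => h (foot y)) x := h.continuous.continuousAt.comp hf
    have hev : (fun y => polar (h (foot y)) (shift K (v (foot y)) (depth y))
        (shift_nonneg hK (hv _) (depth_nonneg y))) =ᶠ[nhds x] extension h v hK hv := by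
      filter_upwards [(isOpen_ne.preimage hcz).mem_nhds hx] with y hy
      exact (if_neg hy).symm
    refine ContinuousAt.congr ?_ hev
    unfold polar
    refine ContinuousAt.prodMk ?_ ?_
    · exact (continuous_fst.continuousAt.comp hhf).mul
        (Circle.exp.continuous.continuousAt.comp hs.neg)
    · rw [Topology.IsInducing.subtypeVal.continuousAt_iff]
      refine ContinuousAt.mul (f := fun y => ((Real.exp (-shift K (v (foot y)) (depth y)) : ℝ) : ℂ))
        (g := fun y => ((h (foot y)).2 : ℂ)) ?_ ?_
      · exact Complex.continuous_ofReal.continuousAt.comp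
          (Real.continuous_exp.continuousAt.comp hs.neg)
      · exact (continuous_subtype_val.comp continuous_snd).continuousAt.comp hhf

end SpiralExtension

/-- The inclusion of the boundary torus in the standard solid torus. -/
def boundaryPoint (p : Torus) : Circle × UnitDisk := (p.1, ⟨p.2, by simp [Circle.norm_coe]⟩)

/-- A homeomorphism of the boundary torus that preserves the longitudinal coordinate up to homotopy
extends over the solid torus. -/
theorem exists_extension_of_hasClass {h : Torus ≃ₜ Torus}
    (hh : HasClass (ContinuousMap.fst.comp (h : C(Torus, Torus))) 1 0) :
    ∃ F : Circle × UnitDisk ≃ₜ Circle × UnitDisk,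
      ∀ p, F (boundaryPoint p) = boundaryPoint (h p) := by
  obtain ⟨v, hv⟩ := hh
  have hu : ∀ p, (h p).1 = p.1 * Circle.exp (v p) := fun p => by simpa using hv p
  obtain ⟨C, hC⟩ := (isCompact_range v.continuous).isBounded.exists_norm_le
  have hK : 0 < |C| + 1 := by positivity
  have hvK : ∀ p, |v p| < |C| + 1 := fun p => by
    have := hC _ ⟨p, rfl⟩
    rw [Real.norm_eq_abs] at this
    linarith [le_abs_self C]
  refine ⟨(SpiralExtension.continuous_extension h v hK hvK hu).homeoOfEquivCompactToT2
    (f := Equiv.ofBijective _ (SpiralExtension.extension_bijective h v hK hvK)), fun p => ?_⟩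
  have e : ∀ q : Torus, boundaryPoint q = SpiralExtension.polar q 0 le_rfl := fun q => by
    simp [boundaryPoint, SpiralExtension.polar]
  change SpiralExtension.extension h v hK hvK (boundaryPoint p) = _
  rw [e, e, SpiralExtension.extension_polar]
  simp only [SpiralExtension.shift_zero hK]

/-- Inversion of both coordinates of the torus. -/
def torusInv : Torus ≃ₜ Torus := (Homeomorph.inv Circle).prodCongr (Homeomorph.inv Circle)

/-- The extension of `torusInv` over the solid torus. -/
def solidInv : Circle × UnitDisk ≃ₜ Circle × UnitDisk :=
  (Homeomorph.inv Circle).prodCongr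
    { toFun := fun z => ⟨starRingEnd ℂ z, by
        rw [mem_closedBall_zero_iff, RCLike.norm_conj]; exact mem_closedBall_zero_iff.1 z.2⟩
      invFun := fun z => ⟨starRingEnd ℂ z, by
        rw [mem_closedBall_zero_iff, RCLike.norm_conj]; exact mem_closedBall_zero_iff.1 z.2⟩
      left_inv := fun z => by simp
      right_inv := fun z => by simp
      continuous_toFun := by fun_prop
      continuous_invFun := by fun_prop }

theorem solidInv_boundaryPoint (p : Torus) :
    solidInv (boundaryPoint p) = boundaryPoint (torusInv p) := by
  refine Prod.ext rfl (Subtype.ext ?_)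
  change starRingEnd ℂ (p.2 : ℂ) = ((p.2⁻¹ : Circle) : ℂ)
  rw [Circle.coe_inv_eq_conj]

theorem exists_extension_of_hasClass_neg {h : Torus ≃ₜ Torus}
    (hh : HasClass (ContinuousMap.fst.comp (h : C(Torus, Torus))) (-1) 0) :
    ∃ F : Circle × UnitDisk ≃ₜ Circle × UnitDisk,
      ∀ p, F (boundaryPoint p) = boundaryPoint (h p) := by
  obtain ⟨v, hv⟩ := hh
  obtain ⟨F, hF⟩ := exists_extension_of_hasClass (h := h.trans torusInv) ⟨-v, fun p => by
    have : (h p).1 = _ := hv p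
    change ((h p).1)⁻¹ = _
    rw [this]
    simp [mul_comm]⟩
  refine ⟨F.trans solidInv.symm, fun p => ?_⟩
  rw [Homeomorph.trans_apply, Homeomorph.symm_apply_eq, hF, solidInv_boundaryPoint]
  rfl

/-- A loop in the circle that extends over the disk has degree `0`. -/
theorem circleDegree_eq_zero_of_extends {f : C(Circle, Circle)} (g : C(UnitDisk, Circle))
    (hg : ∀ (z : UnitDisk) (u : Circle), (z : ℂ) = u → g z = f u) : circleDegree f = 0 := by
  have hmem : ∀ p : unitInterval × Circle, ((p.1 : ℝ) : ℂ) * (p.2 : ℂ) ∈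
      Metric.closedBall (0 : ℂ) 1 := fun p => by
    rw [mem_closedBall_zero_iff, norm_mul, Circle.norm_coe, mul_one, Complex.norm_real,
      Real.norm_of_nonneg p.1.2.1]
    exact p.1.2.2
  have hhom : (ContinuousMap.const _ (g ⟨0, by simp⟩) : C(Circle, Circle)).Homotopic f := by
    refine ⟨⟨⟨fun p => g ⟨((p.1 : ℝ) : ℂ) * (p.2 : ℂ), hmem p⟩, ?_⟩, fun u => ?_, fun u => ?_⟩⟩
    · refine g.continuous.comp (Continuous.subtype_mk ?_ _)
      exact (Complex.continuous_ofReal.comp (continuous_subtype_val.comp continuous_fst)).mul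
        (continuous_subtype_val.comp continuous_snd)
    · simp
    · exact hg _ u (by simp)
  rw [← circleDegree_congr_homotopic hhom, circleDegree_const]

namespace SolidTorus

variable {V₁ V₂ : Type*} [TopologicalSpace V₁] [TopologicalSpace V₂]
  {e₁ : SolidTorus V₁} {e₂ : SolidTorus V₂} {h : e₁.Boundary ≃ₜ e₂.Boundary}
  {M : Matrix (Fin 2) (Fin 2) ℤ}

theorem boundaryPoint_boundaryHomeo {V : Type*} [TopologicalSpace V] (e : SolidTorus V)
    (p : e.Boundary) : boundaryPoint (e.boundaryHomeo p) = e p := rfl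

/-- A homeomorphism of the boundary tori extends to the solid tori if its action on homology
preserves the class of the meridian up to sign. -/
theorem extendsToSolidTori_of_hasMatrix (hM : HasMatrix (inCoords e₁ e₂ h : C(Torus, Torus)) M)
    (hunit : M 0 0 = 1 ∨ M 0 0 = -1) (hzero : M 0 1 = 0) : ExtendsToSolidTori e₁ e₂ h := by
  obtain ⟨F, hF⟩ : ∃ F : Circle × UnitDisk ≃ₜ Circle × UnitDisk,
      ∀ p, F (boundaryPoint p) = boundaryPoint (inCoords e₁ e₂ h p) := by
    have h1 := hM.1
    rw [hzero] at h1
    rcases hunit with h2 | h2 <;> rw [h2] at h1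
    · exact exists_extension_of_hasClass h1
    · exact exists_extension_of_hasClass_neg h1
  refine ⟨e₁.trans (F.trans e₂.symm), fun p => ?_⟩
  change e₂.symm (F (e₁ p)) = _
  rw [Homeomorph.symm_apply_eq, ← boundaryPoint_boundaryHomeo, hF, ← boundaryPoint_boundaryHomeo]
  congr 1
  exact inCoords_apply e₁ e₂ h p

theorem ExtendsToSolidTori.apply_zero_one (hext : ExtendsToSolidTori e₁ e₂ h)
    (hM : HasMatrix (inCoords e₁ e₂ h : C(Torus, Torus)) M) : M 0 1 = 0 := by
  obtain ⟨F, hF⟩ := hext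
  rw [← hM.1.degree_loopY 1]
  refine circleDegree_eq_zero_of_extends ⟨fun z => (e₂ (F (e₁.symm (1, z)))).1, by fun_prop⟩
    fun z u hzu => ?_
  obtain ⟨p, hp⟩ := e₁.boundaryHomeo.surjective (1, u)
  have h1 : e₁.symm (1, z) = p := by
    rw [Homeomorph.symm_apply_eq, ← boundaryPoint_boundaryHomeo, hp]
    exact Prod.ext rfl (Subtype.ext hzu)
  have h2 : inCoords e₁ e₂ h (1, u) = (e₂.coordX (h p), e₂.coordY (h p)) := by
    rw [← inCoords_apply, ← hp]; rfl
  change (e₂ (F (e₁.symm (1, z)))).1 = (inCoords e₁ e₂ h (1, u)).1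
  rw [h1, hF, h2]
  rfl

theorem IsChosenCycle.degree_coordX {V : Type*} [TopologicalSpace V] {e : SolidTorus V}
    {w : C(Circle, e.Boundary)} (hw : e.IsChosenCycle w) : circleDegree (e.coordX.comp w) = 0 := by
  obtain ⟨d, -, hd, -⟩ := hw.bounds_disk
  refine circleDegree_eq_zero_of_extends ⟨fun z => (e (d z)).1, by fun_prop⟩ fun z u hzu => ?_
  change (e (d z)).1 = (e (w u)).1
  rw [hd z u hzu]

end SolidTorus

end

noncomputable section

/-! ### Arcs and simple closed curves -/

open Set

section Arcs

variable {X : Type*} [TopologicalSpace X]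

/-- Two points of `S` are joined by an embedded arc in `S`, which may be a single point. -/
def ArcJoined (S : Set X) (x y : X) : Prop :=
  ∃ (γ : ℝ → X) (l : ℝ), 0 ≤ l ∧ ContinuousOn γ (Icc 0 l) ∧ InjOn γ (Icc 0 l) ∧ γ 0 = x ∧ γ l = y ∧
    MapsTo γ (Icc 0 l) S

theorem ArcJoined.refl {S : Set X} {x : X} (hx : x ∈ S) : ArcJoined S x x :=
  ⟨fun _ => x, 0, le_rfl, continuousOn_const, by simp, rfl, rfl, fun _ _ => hx⟩

theorem ArcJoined.symm {S : Set X} {x y : X} (h : ArcJoined S x y) : ArcJoined S y x := by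
  obtain ⟨γ, l, hl, hc, hi, h0, h1, hm⟩ := h
  have hmaps : MapsTo (fun t => l - t) (Icc 0 l) (Icc 0 l) := fun t ht =>
    ⟨by linarith [ht.2], by linarith [ht.1]⟩
  refine ⟨fun t => γ (l - t), l, hl, hc.comp (by fun_prop) hmaps, fun t ht s hs hts => ?_, by simpa,
    by simpa, fun t ht => hm (hmaps ht)⟩
  have := hi (hmaps ht) (hmaps hs) hts
  linarith

/-- Embedded arcs are concatenated by following the first one up to its first point on the second
one. -/
theorem ArcJoined.trans [T2Space X] {S : Set X} {x y z : X} (h : ArcJoined S x y)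
    (h' : ArcJoined S y z) : ArcJoined S x z := by
  obtain ⟨p, l, hl, hpc, hpi, hp0, hp1, hpm⟩ := h
  obtain ⟨q, k, hk, hqc, hqi, hq0, hq1, hqm⟩ := h'
  have hcl : IsClosed (q '' Icc 0 k) := (isCompact_Icc.image_of_continuousOn hqc).isClosed
  have hA : IsCompact (Icc 0 l ∩ p ⁻¹' (q '' Icc 0 k)) :=
    isCompact_Icc.of_isClosed_subset (hpc.preimage_isClosed_of_isClosed isClosed_Icc hcl)
      inter_subset_left
  obtain ⟨t₀, ⟨ht₀, s₀, hs₀, hst⟩, hmin⟩ := hA.exists_isLeast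
    ⟨l, ⟨hl, le_rfl⟩, 0, ⟨le_rfl, hk⟩, hq0.trans hp1.symm⟩
  have hfirst : ∀ t ∈ Icc 0 l, t < t₀ → p t ∉ q '' Icc 0 k := fun t ht hlt hmem =>
    absurd (hmin ⟨ht, hmem⟩) (not_le.2 hlt)
  have hQ : ∀ t, t₀ ≤ t → t ≤ t₀ + (k - s₀) → t - t₀ + s₀ ∈ Icc 0 k := fun t h1 h2 =>
    ⟨by linarith [hs₀.1], by linarith⟩
  set γ : ℝ → X := fun t => if t ≤ t₀ then p t else q (t - t₀ + s₀) with hγ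
  have hγ1 : ∀ t, t ≤ t₀ → γ t = p t := fun t h => if_pos h
  have hγ2 : ∀ t, t₀ ≤ t → γ t = q (t - t₀ + s₀) := fun t h => by
    rcases h.eq_or_lt with rfl | h
    · rw [hγ1 _ le_rfl, ← hst]; simp
    · exact if_neg (not_le.2 h)
  have hIcc : Icc 0 (t₀ + (k - s₀)) = Icc 0 t₀ ∪ Icc t₀ (t₀ + (k - s₀)) :=
    (Icc_union_Icc_eq_Icc ht₀.1 (by linarith [hs₀.2])).symm
  refine ⟨γ, t₀ + (k - s₀), by linarith [hs₀.2, ht₀.1], ?_, ?_, ?_, ?_, ?_⟩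
  · rw [hIcc]
    refine ContinuousOn.union_of_isClosed ?_ ?_ isClosed_Icc isClosed_Icc
    · exact (hpc.mono (Icc_subset_Icc_right ht₀.2)).congr fun t ht => hγ1 t ht.2
    · exact (hqc.comp (f := fun t => t - t₀ + s₀) (by fun_prop) fun t ht => hQ t ht.1 ht.2).congr
        fun t ht => hγ2 t ht.1
  · have key : ∀ t ∈ Icc 0 (t₀ + (k - s₀)), ∀ s ∈ Icc 0 (t₀ + (k - s₀)), t ≤ s → γ t = γ s →
        t = s := by
      intro t ht s hs hts h
      rcases le_or_gt s t₀ with h1 | h1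
      · rw [hγ1 t (hts.trans h1), hγ1 s h1] at h
        exact hpi ⟨ht.1, (hts.trans h1).trans ht₀.2⟩ ⟨hs.1, h1.trans ht₀.2⟩ h
      · rcases lt_or_ge t t₀ with h2 | h2
        · rw [hγ1 t h2.le, hγ2 s h1.le] at h
          exact absurd ⟨_, hQ s h1.le hs.2, h.symm⟩ (hfirst t ⟨ht.1, h2.le.trans ht₀.2⟩ h2)
        · rw [hγ2 t h2, hγ2 s h1.le] at h
          have := hqi (hQ t h2 ht.2) (hQ s h1.le hs.2) h
          linarith
    intro t ht s hs h
    rcases le_total t s with h1 | h1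
    · exact key t ht s hs h1 h
    · exact (key s hs t ht h1 h.symm).symm
  · rw [hγ1 0 ht₀.1, hp0]
  · rw [hγ2 _ (by linarith [hs₀.2]), ← hq1]
    congr 1
    ring
  · intro t ht
    rcases le_total t t₀ with h1 | h1
    · rw [hγ1 t h1]; exact hpm ⟨ht.1, h1.trans ht₀.2⟩
    · rw [hγ2 t h1]; exact hqm (hQ t h1 ht.2)

/-- A path that is injective except that it returns to its starting point is a simple closed
curve. -/
theorem exists_injective_loop {γ : ℝ → X} {T : ℝ} (hT : 0 < T) (hc : ContinuousOn γ (Icc 0 T))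
    (hi : InjOn γ (Ico 0 T)) (h0 : γ T = γ 0) :
    ∃ c : C(Circle, X), Function.Injective c ∧
      ∀ t ∈ Icc 0 T, c (Circle.exp (2 * Real.pi * (t / T))) = γ t := by
  let π' : C(Icc 0 T, Circle) := ⟨fun t => Circle.exp (2 * Real.pi * (t / T)), by fun_prop⟩
  have hpi : 0 < 2 * Real.pi := by positivity
  have hsurj : ∀ u : Circle, ∃ t ∈ Ico 0 T, Circle.exp (2 * Real.pi * (t / T)) = u := by
    intro u
    obtain ⟨x, rfl⟩ := Circle.exp_surjective u
    refine ⟨Int.fract (x / (2 * Real.pi)) * T, ⟨mul_nonneg (Int.fract_nonneg _) hT.le,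
      (mul_lt_iff_lt_one_left hT).2 (Int.fract_lt_one _)⟩, ?_⟩
    rw [mul_div_cancel_right₀ _ hT.ne', Circle.exp_eq_exp]
    refine ⟨-⌊x / (2 * Real.pi)⌋, ?_⟩
    rw [Int.fract]
    field_simp
    push_cast
    ring
  have hexp : ∀ t ∈ Icc 0 T, ∀ s ∈ Icc 0 T,
      Circle.exp (2 * Real.pi * (t / T)) = Circle.exp (2 * Real.pi * (s / T)) →
        t = s ∨ (t = 0 ∧ s = T) ∨ (t = T ∧ s = 0) := by
    intro t ht s hs h
    obtain ⟨n, hn⟩ := Circle.exp_eq_exp.1 h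
    have h1 : t = s + n * T := by
      field_simp at hn
      linear_combination hn
    have h2 : -1 ≤ n := by
      by_contra! hlt
      have : (n : ℝ) ≤ -2 := by exact_mod_cast (show n ≤ -2 by omega)
      nlinarith [ht.1, hs.2]
    have h3 : n ≤ 1 := by
      by_contra! hlt
      have : (2 : ℝ) ≤ n := by exact_mod_cast (show 2 ≤ n by omega)
      nlinarith [ht.2, hs.1]
    obtain rfl | rfl | rfl : n = -1 ∨ n = 0 ∨ n = 1 := by omega
    · right; left
      push_cast at h1
      constructor <;> linarith [ht.1, ht.2, hs.1, hs.2]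
    · left; simpa using h1
    · right; right
      push_cast at h1
      constructor <;> linarith [ht.1, ht.2, hs.1, hs.2]
  have hq : Topology.IsQuotientMap π' := by
    refine IsClosedMap.isQuotientMap π'.continuous.isClosedMap π'.continuous fun u => ?_
    obtain ⟨t, ht, h⟩ := hsurj u
    exact ⟨⟨t, ht.1, ht.2.le⟩, h⟩
  let γ' : C(Icc 0 T, X) := ⟨fun t => γ t, hc.domRestrict⟩
  have hfac : Function.FactorsThrough γ' π' := by
    intro t s h
    change γ t = γ s
    rcases hexp t t.2 s s.2 h with h | ⟨h1, h2⟩ | ⟨h1, h2⟩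
    · rw [h]
    · rw [h1, h2, h0]
    · rw [h1, h2, h0]
  have hval : ∀ t ∈ Icc 0 T, hq.lift γ' hfac (Circle.exp (2 * Real.pi * (t / T))) = γ t :=
    fun t ht => ContinuousMap.congr_fun (hq.lift_comp γ' hfac) ⟨t, ht⟩
  refine ⟨hq.lift γ' hfac, fun u u' h => ?_, hval⟩
  obtain ⟨t, ht, rfl⟩ := hsurj u
  obtain ⟨s, hs, rfl⟩ := hsurj u'
  rw [hval t ⟨ht.1, ht.2.le⟩, hval s ⟨hs.1, hs.2.le⟩] at h
  rw [hi ht hs h]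

/-- Two continuous logarithms of a function on an interval have the same increment. -/
theorem sub_eq_sub_of_exp_eq {a b : ℝ → ℝ} {p q : ℝ} (hpq : p ≤ q) (ha : ContinuousOn a (Icc p q))
    (hb : ContinuousOn b (Icc p q)) (h : ∀ t ∈ Icc p q, Circle.exp (a t) = Circle.exp (b t)) :
    a q - a p = b q - b p := by
  have : PreconnectedSpace (Icc p q) := Subtype.preconnectedSpace isPreconnected_Icc
  obtain ⟨n, hn⟩ := exists_int_const_of_exp_eq' (A := Icc p q) (f := fun t => a t)
    (g := fun t => b t) ha.domRestrict hb.domRestrict (fun t => h t t.2)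
  rw [hn ⟨p, le_rfl, hpq⟩, hn ⟨q, hpq, le_rfl⟩]
  ring

end Arcs

/-! ### Logarithms on embedded graphs -/

namespace EmbeddedGraph

variable {X : Type*} [TopologicalSpace X] (G : EmbeddedGraph X)

/-- The subgraph with all vertices and the edges in `s`. -/
def partialCarrier (s : Finset (Fin G.numEdges)) : Set X :=
  (G.vertices : Set X) ∪ ⋃ i ∈ s, range (G.edge i)

variable {G} {s : Finset (Fin G.numEdges)}

theorem vertex_mem_partialCarrier {x : X} (hx : x ∈ G.vertices) : x ∈ G.partialCarrier s := Or.inl hx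

theorem edge_mem_partialCarrier {i : Fin G.numEdges} (hi : i ∈ s) (t : unitInterval) :
    G.edge i t ∈ G.partialCarrier s := Or.inr (mem_biUnion hi ⟨t, rfl⟩)

theorem endpoint_mem {i : Fin G.numEdges} {t : unitInterval} (ht : t = 0 ∨ t = 1) :
    G.edge i t ∈ G.vertices := by
  rcases ht with rfl | rfl
  · exact G.source_mem i
  · exact G.target_mem i

theorem mem_Ioo_or (t : unitInterval) : (t = 0 ∨ t = 1) ∨ t ∈ Ioo (0 : unitInterval) 1 := by
  rcases eq_or_lt_of_le (show 0 ≤ t from t.2.1) with h | h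
  · exact Or.inl (Or.inl h.symm)
  · rcases eq_or_lt_of_le (show t ≤ 1 from t.2.2) with h' | h'
    · exact Or.inl (Or.inr h')
    · exact Or.inr ⟨h, h'⟩

theorem interior_notMem_partialCarrier {j : Fin G.numEdges} (hj : j ∉ s) {t : unitInterval}
    (ht : t ∈ Ioo (0 : unitInterval) 1) : G.edge j t ∉ G.partialCarrier s := by
  rintro (h | h)
  · exact G.interior_notMem j t ht h
  · obtain ⟨i, hi, t', ht'⟩ := mem_iUnion₂.1 h
    rcases mem_Ioo_or t' with h1 | h1
    · exact G.interior_notMem j t ht (ht' ▸ endpoint_mem h1)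
    · exact hj ((G.interior_injective i j t' h1 t ht ht').1 ▸ hi)

theorem edge_eq_edge {i : Fin G.numEdges} {t t' : unitInterval} (h : G.edge i t = G.edge i t') :
    t = t' ∨ ((t = 0 ∨ t = 1) ∧ (t' = 0 ∨ t' = 1)) := by
  rcases mem_Ioo_or t with h1 | h1 <;> rcases mem_Ioo_or t' with h2 | h2
  · exact Or.inr ⟨h1, h2⟩
  · exact absurd (h ▸ endpoint_mem h1) (G.interior_notMem i t' h2)
  · exact absurd (h ▸ endpoint_mem h2) (G.interior_notMem i t h1)
  · exact Or.inl (G.interior_injective i i t h1 t' h2 h).2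

theorem arcJoined_edge_zero {i : Fin G.numEdges} (hi : i ∈ s) (t : unitInterval) :
    ArcJoined (G.partialCarrier s) (G.edge i 0) (G.edge i t) := by
  by_cases h0 : G.edge i 0 = G.edge i t
  · rw [← h0]; exact ArcJoined.refl (edge_mem_partialCarrier hi 0)
  have hle : ∀ r ∈ Icc (0 : ℝ) t, r ∈ Icc (0 : ℝ) 1 := fun r hr => ⟨hr.1, hr.2.trans t.2.2⟩
  refine ⟨fun r => G.edge i (projIcc 0 1 zero_le_one r), t, t.2.1,
    ((G.edge i).continuous.comp continuous_projIcc).continuousOn, ?_, ?_, ?_,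
    fun r _ => edge_mem_partialCarrier hi _⟩
  · intro r hr r' hr' h
    simp only [projIcc_of_mem _ (hle r hr), projIcc_of_mem _ (hle r' hr')] at h
    rcases edge_eq_edge h with h1 | ⟨h1, h2⟩
    · exact congrArg Subtype.val h1
    · simp only [Subtype.ext_iff, Icc.coe_zero, Icc.coe_one] at h1 h2
      -- The two end points of the edge can only coincide if it is a loop and `t = 1`.
      have hone : r = 1 ∨ r' = 1 → (t : ℝ) = 1 := by
        rintro (e | e)
        · exact le_antisymm t.2.2 (e ▸ hr.2)
        · exact le_antisymm t.2.2 (e ▸ hr'.2)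
      rcases h1 with h1 | h1 <;> rcases h2 with h2 | h2
      · rw [h1, h2]
      · refine absurd ?_ h0
        have ht : t = 1 := Subtype.ext (hone (Or.inr h2))
        subst h1 h2
        rw [ht]
        exact h
      · refine absurd ?_ h0
        have ht : t = 1 := Subtype.ext (hone (Or.inl h1))
        subst h1 h2
        rw [ht]
        exact h.symm
      · rw [h1, h2]
  · simp only [projIcc_left]; rfl
  · simp only [projIcc_val]

/-- A logarithm on a subgraph and a logarithm along a further edge have the same increments if the
end points of the edge are already joined in the subgraph: the arc between them closes up to a cycle
of degree `0`. -/
theorem log_increment_eq {f : C(X, Circle)} {j : Fin G.numEdges} (hj : j ∉ s)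
    (hdeg : ∀ c : C(Circle, X), Function.Injective c → (∀ u, c u ∈ G.carrier) →
      circleDegree (f.comp c) = 0) {v : X → ℝ} (hv : ContinuousOn v (G.partialCarrier s))
    (hfv : ∀ x ∈ G.partialCarrier s, f x = Circle.exp (v x)) {θ : ℝ → ℝ} (hθ : Continuous θ)
    (hfθ : ∀ t : unitInterval, f (G.edge j t) = Circle.exp (θ t))
    (harc : ArcJoined (G.partialCarrier s) (G.edge j 1) (G.edge j 0)) :
    v (G.edge j 1) - v (G.edge j 0) = θ 1 - θ 0 := by
  obtain ⟨γ, l, hl, hγc, hγi, hγ0, hγ1, hγm⟩ := harc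
  have hT : 0 < l + 1 := by linarith
  set E : ℝ → X := fun t => G.edge j (projIcc 0 1 zero_le_one (t - l)) with hE
  have hEc : Continuous E := (G.edge j).continuous.comp (continuous_projIcc.comp (by fun_prop))
  have hEmem : ∀ t ∈ Icc l (l + 1), t - l ∈ Icc (0 : ℝ) 1 := fun t ht =>
    ⟨by linarith [ht.1], by linarith [ht.2]⟩
  have hEl : E l = γ l := by
    simp only [hE, sub_self, projIcc_left, hγ1]
    rfl
  have hE1 : E (l + 1) = γ 0 := by
    simp only [hE, add_sub_cancel_left, projIcc_right, hγ0]
    rfl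
  set δ : ℝ → X := fun t => if t ≤ l then γ t else E t with hδ
  have hδ1 : ∀ t, t ≤ l → δ t = γ t := fun t h => if_pos h
  have hδ2 : ∀ t, l ≤ t → δ t = E t := fun t h => by
    rcases h.eq_or_lt with rfl | h
    · rw [hδ1 _ le_rfl, hEl]
    · exact if_neg (not_le.2 h)
  have hEout : ∀ t, l < t → t < l + 1 → E t ∉ G.partialCarrier s := by
    intro t h1 h2
    refine interior_notMem_partialCarrier hj ?_
    rw [projIcc_of_mem _ (hEmem t ⟨h1.le, h2.le⟩)]
    exact ⟨show (0 : ℝ) < t - l by linarith, show t - l < (1 : ℝ) by linarith⟩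
  have hδc : ContinuousOn δ (Icc 0 (l + 1)) := by
    rw [← Icc_union_Icc_eq_Icc hl (by linarith : l ≤ l + 1)]
    exact ContinuousOn.union_of_isClosed (hγc.congr fun t ht => hδ1 t ht.2)
      (hEc.continuousOn.congr fun t ht => hδ2 t ht.1) isClosed_Icc isClosed_Icc
  have hδi : InjOn δ (Ico 0 (l + 1)) := by
    intro t ht r hr h
    rcases le_or_gt t l with h1 | h1 <;> rcases le_or_gt r l with h2 | h2
    · rw [hδ1 t h1, hδ1 r h2] at h
      exact hγi ⟨ht.1, h1⟩ ⟨hr.1, h2⟩ h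
    · rw [hδ1 t h1, hδ2 r h2.le] at h
      exact absurd (h ▸ hγm ⟨ht.1, h1⟩) (hEout r h2 hr.2)
    · rw [hδ2 t h1.le, hδ1 r h2] at h
      exact absurd (h ▸ hγm ⟨hr.1, h2⟩) (hEout t h1 ht.2)
    · rw [hδ2 t h1.le, hδ2 r h2.le] at h
      simp only [hE, projIcc_of_mem _ (hEmem t ⟨h1.le, ht.2.le⟩),
        projIcc_of_mem _ (hEmem r ⟨h2.le, hr.2.le⟩)] at h
      have hmem : ∀ x : ℝ, ∀ hx : l < x ∧ x < l + 1, (⟨x - l, hEmem x ⟨hx.1.le, hx.2.le⟩⟩ :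
          unitInterval) ∈ Ioo (0 : unitInterval) 1 := fun x hx =>
        ⟨show (0 : ℝ) < x - l by linarith, show x - l < (1 : ℝ) by linarith⟩
      have := (G.interior_injective j j _ (hmem t ⟨h1, ht.2⟩) _ (hmem r ⟨h2, hr.2⟩) h).2
      have := congrArg Subtype.val this
      simp only at this
      linarith
  obtain ⟨c, hci, hc⟩ := exists_injective_loop hT hδc hδi
    (by rw [hδ2 _ (by linarith), hδ1 0 hl, hE1])
  have hsub : ∀ x ∈ G.partialCarrier s, x ∈ G.carrier := by
    rintro x (h | h)
    · exact Or.inl h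
    · obtain ⟨i, -, h⟩ := mem_iUnion₂.1 h
      exact Or.inr (mem_iUnion.2 ⟨i, h⟩)
  have hsurj : ∀ u : Circle, ∃ t ∈ Icc 0 (l + 1), Circle.exp (2 * Real.pi * (t / (l + 1))) = u := by
    intro u
    obtain ⟨x, rfl⟩ := Circle.exp_surjective u
    refine ⟨Int.fract (x / (2 * Real.pi)) * (l + 1), ⟨mul_nonneg (Int.fract_nonneg _) hT.le,
      mul_le_of_le_one_left hT.le (Int.fract_lt_one _).le⟩, ?_⟩
    rw [mul_div_cancel_right₀ _ hT.ne', Circle.exp_eq_exp]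
    refine ⟨-⌊x / (2 * Real.pi)⌋, ?_⟩
    rw [Int.fract]
    field_simp
    push_cast
    ring
  have hdeg0 : circleDegree (f.comp c) = 0 := by
    refine hdeg c hci fun u => ?_
    obtain ⟨t, ht, rfl⟩ := hsurj u
    rw [hc t ht]
    rcases le_total t l with h | h
    · rw [hδ1 t h]; exact hsub _ (hγm ⟨ht.1, h⟩)
    · rw [hδ2 t h]; exact Or.inr (mem_iUnion.2 ⟨j, _, rfl⟩)
  obtain ⟨η, hη, hη1, hη2⟩ := exists_degree_lift (f.comp c)
  rw [hdeg0] at hη2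
  have hper : η (2 * Real.pi * ((l + 1) / (l + 1))) = η (2 * Real.pi * (0 / (l + 1))) := by
    rw [div_self hT.ne', zero_div, mul_one, mul_zero, ← zero_add (2 * Real.pi), hη2]
    simp
  have hηc : Continuous fun t => η (2 * Real.pi * (t / (l + 1))) := by fun_prop
  have inc1 := sub_eq_sub_of_exp_eq hl hηc.continuousOn (hv.comp hγc hγm) (fun t ht => by
    rw [← hη1, ContinuousMap.comp_apply, hc t ⟨ht.1, by linarith [ht.2]⟩, hδ1 t ht.2,
      hfv _ (hγm ht)]
    rfl)
  have inc2 := sub_eq_sub_of_exp_eq (p := l) (q := l + 1) (by linarith) hηc.continuousOn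
    (b := fun t => θ (t - l)) (by fun_prop) (fun t ht => by
      rw [← hη1, ContinuousMap.comp_apply, hc t ⟨by linarith [ht.1], ht.2⟩, hδ2 t ht.1]
      simp only [hE, projIcc_of_mem _ (hEmem t ht), hfθ])
  simp only [Function.comp_apply, hγ0, hγ1, sub_self, add_sub_cancel_left] at inc1 inc2
  linarith

variable [T2Space X]

theorem isClosed_of_saturated {D : Set X} (hD : D ⊆ G.partialCarrier s)
    (hsat : ∀ i ∈ s, ∀ t, G.edge i t ∈ D ↔ G.edge i 0 ∈ D) : IsClosed D := by
  classical
  have : D = ((G.vertices : Set X) ∩ D) ∪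
      ⋃ i ∈ s.filter (fun i => G.edge i 0 ∈ D), range (G.edge i) := by
    ext x
    constructor
    · intro hx
      rcases hD hx with h | h
      · exact Or.inl ⟨h, hx⟩
      · obtain ⟨i, hi, t, rfl⟩ := mem_iUnion₂.1 h
        exact Or.inr (mem_biUnion (Finset.mem_filter.2 ⟨hi, (hsat i hi t).1 hx⟩) ⟨t, rfl⟩)
    · rintro (h | h)
      · exact h.2
      · obtain ⟨i, hi, t, rfl⟩ := mem_iUnion₂.1 h
        obtain ⟨hi, h0⟩ := Finset.mem_filter.1 hi
        exact (hsat i hi t).2 h0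
  rw [this]
  refine (G.vertices.finite_toSet.subset inter_subset_left).isClosed.union ?_
  exact (Finset.finite_toSet _).isClosed_biUnion fun i _ =>
    (isCompact_range (G.edge i).continuous).isClosed

theorem isClosed_partialCarrier : IsClosed (G.partialCarrier s) :=
  isClosed_of_saturated subset_rfl fun _ hi _ =>
    iff_of_true (edge_mem_partialCarrier hi _) (edge_mem_partialCarrier hi _)

theorem isClosed_carrier : IsClosed G.carrier := by
  have : G.carrier = G.partialCarrier Finset.univ := by simp [carrier, partialCarrier]
  rw [this]
  exact isClosed_partialCarrier

theorem exists_log_partialCarrier {f : C(X, Circle)}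
    (hdeg : ∀ c : C(Circle, X), Function.Injective c → (∀ u, c u ∈ G.carrier) →
      circleDegree (f.comp c) = 0) (s : Finset (Fin G.numEdges)) :
    ∃ v : X → ℝ, ContinuousOn v (G.partialCarrier s) ∧
      ∀ x ∈ G.partialCarrier s, f x = Circle.exp (v x) := by
  classical
  induction s using Finset.induction_on with
  | empty =>
    choose v hv using fun x => Circle.exp_surjective (f x)
    refine ⟨v, ?_, fun x _ => (hv x).symm⟩
    have : G.partialCarrier ∅ = (G.vertices : Set X) := by simp [partialCarrier]
    rw [this]
    exact G.vertices.finite_toSet.continuousOn v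
  | insert j s hj ih =>
    obtain ⟨v, hv, hfv⟩ := ih
    have ha : G.edge j 0 ∈ G.partialCarrier s := vertex_mem_partialCarrier (G.source_mem j)
    have hb : G.edge j 1 ∈ G.partialCarrier s := vertex_mem_partialCarrier (G.target_mem j)
    obtain ⟨Θ, hΘ⟩ := Circle.exists_lift ((f.comp (G.edge j)).comp
      ⟨projIcc (0 : ℝ) 1 zero_le_one, continuous_projIcc⟩)
    have hfΘ : ∀ t : unitInterval, f (G.edge j t) = Circle.exp (Θ t) := fun t => by
      rw [← hΘ]; simp
    -- After a shift on one component of the subgraph the increments agree.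
    obtain ⟨v', hv', hfv', hinc⟩ : ∃ v' : X → ℝ, ContinuousOn v' (G.partialCarrier s) ∧
        (∀ x ∈ G.partialCarrier s, f x = Circle.exp (v' x)) ∧
        v' (G.edge j 1) - v' (G.edge j 0) = Θ 1 - Θ 0 := by
      by_cases harc : ArcJoined (G.partialCarrier s) (G.edge j 1) (G.edge j 0)
      · exact ⟨v, hv, hfv, log_increment_eq hj hdeg hv hfv Θ.continuous hfΘ harc⟩
      set D : Set X := {x ∈ G.partialCarrier s | ArcJoined (G.partialCarrier s) (G.edge j 1) x}
      have hsat : ∀ i ∈ s, ∀ t, G.edge i t ∈ D ↔ G.edge i 0 ∈ D := fun i hi t =>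
        ⟨fun h => ⟨edge_mem_partialCarrier hi 0, h.2.trans (arcJoined_edge_zero hi t).symm⟩,
          fun h => ⟨edge_mem_partialCarrier hi t, h.2.trans (arcJoined_edge_zero hi t)⟩⟩
      have hD : IsClosed D := isClosed_of_saturated (fun x hx => hx.1) hsat
      have hD' : IsClosed (G.partialCarrier s \ D) :=
        isClosed_of_saturated sdiff_subset fun i hi t => by
          simp only [mem_sdiff, hsat i hi t, edge_mem_partialCarrier hi]
      obtain ⟨m, hm⟩ : ∃ m : ℤ, Θ 1 - Θ 0 - (v (G.edge j 1) - v (G.edge j 0)) =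
          m * (2 * Real.pi) := by
        have h1 := hfΘ 1
        have h0 := hfΘ 0
        rw [hfv _ hb] at h1
        rw [hfv _ ha] at h0
        obtain ⟨m, hm⟩ := Circle.exp_eq_exp.1 h1
        obtain ⟨k, hk⟩ := Circle.exp_eq_exp.1 h0
        simp only [Icc.coe_one, Icc.coe_zero] at hm hk
        exact ⟨k - m, by push_cast; linear_combination hk - hm⟩
      refine ⟨fun x => if x ∈ D then v x + m * (2 * Real.pi) else v x, ?_, fun x hx => ?_, ?_⟩
      · have hun : G.partialCarrier s = D ∪ (G.partialCarrier s \ D) :=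
          (union_sdiff_cancel fun x hx => hx.1).symm
        have h1 : ContinuousOn (fun x => if x ∈ D then v x + m * (2 * Real.pi) else v x) D :=
          ((hv.mono fun x hx => hx.1).add continuousOn_const).congr fun x hx => if_pos hx
        have h2 : ContinuousOn (fun x => if x ∈ D then v x + m * (2 * Real.pi) else v x)
            (G.partialCarrier s \ D) := (hv.mono sdiff_subset).congr fun x hx => if_neg hx.2
        exact (h1.union_of_isClosed h2 hD hD').mono hun.subset
      · dsimp only
        split_ifs
        · rw [hfv x hx]
          exact Circle.exp_eq_exp.2 ⟨-m, by push_cast; ring⟩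
        · exact hfv x hx
      · have h1 : G.edge j 1 ∈ D := ⟨hb, ArcJoined.refl hb⟩
        have h0 : G.edge j 0 ∉ D := fun h => harc h.2
        simp only [if_pos h1, if_neg h0]
        linarith
    set k := v' (G.edge j 0) - Θ 0 with hk
    have hk0 : Circle.exp k = 1 := by
      rw [hk, Circle.exp_sub, ← hfv' _ ha, hfΘ 0]
      simp
    set w : X → ℝ := fun x => if x ∈ G.partialCarrier s then v' x else
      if h : ∃ t, G.edge j t = x then Θ h.choose + k else 0 with hw
    have hw1 : ∀ x ∈ G.partialCarrier s, w x = v' x := fun x hx => if_pos hx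
    have hw2 : ∀ t : unitInterval, w (G.edge j t) = Θ t + k := by
      intro t
      rcases mem_Ioo_or t with (rfl | rfl) | ht
      · rw [hw1 _ ha, hk, Icc.coe_zero]; ring
      · rw [hw1 _ hb, hk, Icc.coe_one]; linarith
      · have hex : ∃ r, G.edge j r = G.edge j t := ⟨t, rfl⟩
        have : hex.choose = t := by
          rcases edge_eq_edge hex.choose_spec with h | ⟨-, rfl | rfl⟩
          · exact h
          · exact absurd ht.1 (lt_irrefl _)
          · exact absurd ht.2 (lt_irrefl _)
        simp only [hw]
        rw [if_neg (interior_notMem_partialCarrier hj ht), dif_pos hex, this]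
    have hcar : G.partialCarrier (insert j s) = G.partialCarrier s ∪ range (G.edge j) := by
      simp only [partialCarrier, Finset.set_biUnion_insert]
      rw [union_comm (range _), ← union_assoc]
    refine ⟨w, ?_, ?_⟩
    · rw [hcar]
      refine ContinuousOn.union_of_isClosed (hv'.congr hw1) ?_ isClosed_partialCarrier
        (isCompact_range (G.edge j).continuous).isClosed
      have hq : Topology.IsQuotientMap (rangeFactorization (G.edge j)) :=
        IsClosedMap.isQuotientMap (Continuous.isClosedMap
          (Continuous.subtype_mk (G.edge j).continuous _))
          (Continuous.subtype_mk (G.edge j).continuous _) rangeFactorization_surjective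
      rw [continuousOn_iff_continuous_domRestrict, hq.continuous_iff]
      have : (range (G.edge j)).domRestrict w ∘ rangeFactorization (G.edge j) =
          fun t : unitInterval => Θ t + k := funext hw2
      rw [this]
      fun_prop
    · rw [hcar]
      rintro x (hx | ⟨t, rfl⟩)
      · rw [hw1 x hx, hfv' x hx]
      · rw [hw2, Circle.exp_add, hk0, mul_one, hfΘ]

/-- A circle-valued map of degree `0` on all cycles of an embedded graph has a logarithm on the
graph; by Tietze's theorem the logarithm is the restriction of a global function. -/
theorem exists_log_carrier [NormalSpace X] {f : C(X, Circle)}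
    (hdeg : ∀ z : G.Cycle, circleDegree (f.comp z.curve) = 0) :
    ∃ v : C(X, ℝ), ∀ x ∈ G.carrier, f x = Circle.exp (v x) := by
  have huniv : G.carrier = G.partialCarrier Finset.univ := by simp [carrier, partialCarrier]
  obtain ⟨v, hv, hfv⟩ := exists_log_partialCarrier (f := f) (G := G) (fun c hc hmem =>
    hdeg ⟨⟨fun u => ⟨c u, hmem u⟩, by fun_prop⟩, fun a b h =>
      hc (congrArg Subtype.val h)⟩) Finset.univ
  rw [← huniv] at hv hfv
  obtain ⟨w, hw⟩ := ContinuousMap.exists_restrict_eq (isClosed_carrier (G := G))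
    (⟨G.carrier.domRestrict v, hv.domRestrict⟩ : C(G.carrier, ℝ))
  refine ⟨w, fun x hx => ?_⟩
  rw [hfv x hx, ← show w x = v x from ContinuousMap.congr_fun hw ⟨x, hx⟩]

end EmbeddedGraph

end

noncomputable section

/-! ### Twists along embedded annuli -/

open Set

section AnnulusTwist

variable {T : Type*} [TopologicalSpace T] [T2Space T] {P : C(Circle × unitInterval, T)}

/-- A continuous map on the complement of an open annulus and one on the closed annulus can be glued
if they agree on the two boundary curves. -/
theorem exists_glue {Z : Type*} [TopologicalSpace Z] (hP : Function.Injective P)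
    (hopen : IsOpen (P '' {a | a.2 ∈ Ioo (0 : unitInterval) 1})) (m : C(Circle × unitInterval, Z))
    (base : C(T, Z)) (h0 : ∀ u, m (u, 0) = base (P (u, 0))) (h1 : ∀ u, m (u, 1) = base (P (u, 1))) :
    ∃ G : C(T, Z), (∀ a, G (P a) = m a) ∧ ∀ x ∉ range P, G x = base x := by
  classical
  set G : T → Z := fun x => if h : ∃ a, P a = x then m h.choose else base x with hG
  have hGP : ∀ a, G (P a) = m a := by
    intro a
    have hex : ∃ b, P b = P a := ⟨a, rfl⟩
    simp only [hG]
    rw [dif_pos hex, hP hex.choose_spec]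
  have hGout : ∀ x ∉ range P, G x = base x := fun x hx => dif_neg hx
  have hGc : ∀ x ∈ (P '' {a | a.2 ∈ Ioo (0 : unitInterval) 1})ᶜ, G x = base x := by
    intro x hx
    by_cases hr : x ∈ range P
    · obtain ⟨⟨u, t⟩, rfl⟩ := hr
      rw [hGP]
      rcases EmbeddedGraph.mem_Ioo_or t with (rfl | rfl) | ht
      · exact h0 u
      · exact h1 u
      · exact absurd ⟨(u, t), ht, rfl⟩ hx
    · exact hGout x hr
  refine ⟨⟨G, ?_⟩, hGP, hGout⟩
  have hun : (univ : Set T) ⊆ range P ∪ (P '' {a | a.2 ∈ Ioo (0 : unitInterval) 1})ᶜ := by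
    intro x _
    by_cases hx : x ∈ P '' {a | a.2 ∈ Ioo (0 : unitInterval) 1}
    · exact Or.inl (image_subset_range _ _ hx)
    · exact Or.inr hx
  rw [← continuousOn_univ]
  refine ContinuousOn.mono (ContinuousOn.union_of_isClosed ?_ (base.continuous.continuousOn.congr hGc)
    (isCompact_range P.continuous).isClosed hopen.isClosed_compl) hun
  have hq : Topology.IsQuotientMap (rangeFactorization P) :=
    IsClosedMap.isQuotientMap (Continuous.isClosedMap (Continuous.subtype_mk P.continuous _))
      (Continuous.subtype_mk P.continuous _) rangeFactorization_surjective
  rw [continuousOn_iff_continuous_domRestrict, hq.continuous_iff]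
  have : (range P).domRestrict G ∘ rangeFactorization P = m := funext hGP
  rw [this]
  exact m.continuous

/-- The rotation of `S¹ × [0, 1]` whose angle grows from `0` to `2πn`. -/
def annulusRotation (n : ℤ) : C(Circle × unitInterval, Circle × unitInterval) where
  toFun a := (a.1 * Circle.exp (2 * Real.pi * n * a.2), a.2)
  continuous_toFun := by fun_prop

theorem annulusRotation_zero (n : ℤ) (u : Circle) : annulusRotation n (u, 0) = (u, 0) := by
  simp [annulusRotation]

theorem annulusRotation_one (n : ℤ) (u : Circle) : annulusRotation n (u, 1) = (u, 1) := by
  have : Circle.exp (2 * Real.pi * n) = 1 := by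
    rw [Circle.exp_mul_int, Circle.exp_two_pi, one_zpow]
  simp [annulusRotation, this]

theorem annulusRotation_neg (n : ℤ) (a : Circle × unitInterval) :
    annulusRotation (-n) (annulusRotation n a) = a := by
  refine Prod.ext ?_ rfl
  simp only [annulusRotation, ContinuousMap.coe_mk, mul_assoc, ← Circle.exp_add]
  simp

/-- The Dehn twist `g` along an embedded annulus `P`, together with the map `q` to the circle that is
dual to the annulus: `q` winds once across the annulus and is constant off it. A circle-valued map
`f` whose degree along the annulus is `m` satisfies `f ∘ g ≃ f * q ^ m`. -/
theorem exists_twist (hP : Function.Injective P)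
    (hopen : IsOpen (P '' {a | a.2 ∈ Ioo (0 : unitInterval) 1})) :
    ∃ (g : T ≃ₜ T) (q : C(T, Circle)), (∀ x ∉ range P, g x = x) ∧
      (∀ a, q (P a) = Circle.exp (2 * Real.pi * a.2)) ∧ (∀ x ∉ range P, q x = 1) ∧
      ∀ (f : C(T, Circle)) (s : unitInterval), ∃ v : C(T, ℝ), ∀ x, f (g x) = f x *
        q x ^ circleDegree (f.comp (P.comp ((ContinuousMap.id _).prodMk (ContinuousMap.const _ s)))) *
          Circle.exp (v x) := by
  have hglue : ∀ n : ℤ, ∃ G : C(T, T), (∀ a, G (P a) = P (annulusRotation n a)) ∧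
      ∀ x ∉ range P, G x = x := fun n => by
    refine exists_glue hP hopen (P.comp (annulusRotation n)) (ContinuousMap.id _) (fun u => ?_)
      (fun u => ?_)
    · simp [annulusRotation_zero]
    · simp [annulusRotation_one]
  obtain ⟨G, hG1, hG2⟩ := hglue 1
  obtain ⟨G', hG'1, hG'2⟩ := hglue (-1)
  obtain ⟨q, hq1, hq2⟩ := exists_glue hP hopen
    (⟨fun a => Circle.exp (2 * Real.pi * a.2), by fun_prop⟩ : C(Circle × unitInterval, Circle))
    (ContinuousMap.const _ 1) (fun u => by simp) (fun u => by simp)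
  have hinv : ∀ x, G' (G x) = x := by
    intro x
    by_cases hx : x ∈ range P
    · obtain ⟨a, rfl⟩ := hx
      rw [hG1, hG'1, annulusRotation_neg]
    · rw [hG2 x hx, hG'2 x hx]
  have hinv' : ∀ x, G (G' x) = x := by
    intro x
    by_cases hx : x ∈ range P
    · obtain ⟨a, rfl⟩ := hx
      have := annulusRotation_neg (-1) a
      rw [neg_neg] at this
      rw [hG'1, hG1, this]
    · rw [hG'2 x hx, hG2 x hx]
  refine ⟨⟨⟨G, G', hinv, hinv'⟩, G.continuous, G'.continuous⟩, q, hG2, hq1, hq2, fun f s => ?_⟩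
  obtain ⟨m, w, hw⟩ := exists_log_annulus (f.comp P)
  have hm := circleDegree_slice hw s
  rw [ContinuousMap.comp_assoc] at hm
  rw [hm]
  obtain ⟨v, hv1, hv2⟩ := exists_glue hP hopen (w.comp (annulusRotation 1) - w)
    (ContinuousMap.const _ 0) (fun u => by simp [annulusRotation_zero])
    (fun u => by simp [annulusRotation_one])
  refine ⟨v, fun x => ?_⟩
  change f (G x) = _
  by_cases hx : x ∈ range P
  · obtain ⟨a, rfl⟩ := hx
    have e1 : f (P a) = _ := hw a
    have e2 : f (P (annulusRotation 1 a)) = _ := hw (annulusRotation 1 a)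
    rw [hG1, hq1, hv1, e1, e2, ContinuousMap.sub_apply, Circle.exp_sub]
    have e3 : (annulusRotation 1 a).1 = a.1 * Circle.exp (2 * Real.pi * a.2) := by
      simp [annulusRotation]
    rw [e3, mul_zpow, ContinuousMap.comp_apply]
    generalize Circle.exp (w a) = A
    generalize Circle.exp (w _) = B
    generalize Circle.exp (2 * Real.pi * a.2) ^ m = C
    rw [mul_assoc (a.1 ^ m) C B, mul_assoc (a.1 ^ m) A, mul_assoc (a.1 ^ m)]
    congr 1
    rw [mul_comm A C, mul_assoc, mul_div_cancel]
  · rw [hG2 x hx, hq2 x hx, hv2 x hx]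
    simp

/-- A circle-valued map that misses a point has a logarithm. -/
theorem exists_log_of_notMem_range {X : Type*} [TopologicalSpace X] {f : C(X, Circle)} {u : Circle}
    (hu : u ∉ range f) : ∃ v : C(X, ℝ), ∀ x, f x = Circle.exp (v x) := by
  obtain ⟨t, ht⟩ := Circle.exp_surjective (-u)
  have hslit : ∀ x, ((f x / (-u) : Circle) : ℂ) ∈ Complex.slitPlane := by
    intro x
    rw [Complex.mem_slitPlane_iff_arg]
    refine ⟨fun h => hu ⟨x, ?_⟩, Circle.coe_ne_zero _⟩
    have h1 : ((f x / (-u) : Circle) : ℂ) = -1 := by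
      have := Complex.norm_mul_exp_arg_mul_I ((f x / (-u) : Circle) : ℂ)
      rw [Circle.norm_coe, h, Complex.exp_pi_mul_I] at this
      rw [← this]; simp
    have h2 : (f x / (-u) : Circle) = -1 := Circle.ext (by rw [h1]; simp)
    rw [div_eq_iff_eq_mul] at h2
    rw [h2]; simp
  refine ⟨⟨fun x => ((f x / (-u) : Circle) : ℂ).arg + t, ?_⟩, fun x => ?_⟩
  · refine Continuous.add ?_ continuous_const
    refine continuous_iff_continuousAt.2 fun x => ?_
    refine (Complex.continuousAt_arg (hslit x)).comp
      (f := fun x => ((f x / (-u) : Circle) : ℂ)) ?_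
    have : Continuous fun x => ((f x / (-u) : Circle) : ℂ) := by fun_prop
    exact this.continuousAt
  · change _ = Circle.exp (((f x / (-u) : Circle) : ℂ).arg + t)
    rw [Circle.exp_add, ht, Circle.exp_arg, div_mul_cancel]

theorem finite_setOf_zpow_eq_one {k : ℤ} (hk : k ≠ 0) : {u : Circle | u ^ k = 1}.Finite := by
  have hfin : {z : ℂ | z ^ k.natAbs = 1}.Finite := by
    refine (Polynomial.nthRootsFinset k.natAbs (1 : ℂ)).finite_toSet.subset fun z hz => ?_
    exact (Polynomial.mem_nthRootsFinset (Int.natAbs_pos.2 hk) _).2 hz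
  refine (hfin.preimage Circle.coe_injective.injOn).subset fun (u : Circle) hu => ?_
  have h1 : u ^ k = 1 := hu
  have h2 : u ^ k.natAbs = 1 := by
    rcases Int.natAbs_eq k with h | h
    · rw [h, zpow_natCast] at h1; exact h1
    · rw [h, zpow_neg, inv_eq_one, zpow_natCast] at h1; exact h1
  change (u : ℂ) ^ k.natAbs = 1
  rw [← Circle.coe_pow, h2, Circle.coe_one]

/-- The class of the map dual to an embedded annulus in the torus is not divisible: a root of the map
would take values in an arc, because the torus is connected and each side of the annulus lies in a
single level set. -/
theorem HasClass.eq_of_dual {P : C(Circle × unitInterval, Torus)} {q : C(Torus, Circle)}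
    (hq : ∀ a, q (P a) = Circle.exp (2 * Real.pi * a.2)) (hq' : ∀ x ∉ range P, q x = 1) {k : ℤ}
    (hk : HasClass q k 0) : k = 0 ∨ k = 1 ∨ k = -1 := by
  by_contra! hcon
  obtain ⟨hk0, hk1, hk2⟩ := hcon
  have hkR : (k : ℝ) ≠ 0 := Int.cast_ne_zero.2 hk0
  have hpi : (2 * Real.pi) ≠ 0 := by positivity
  obtain ⟨v, hv⟩ := hk
  let r : C(Torus, Circle) := ⟨fun p => p.1 * Circle.exp (v p / k), by fun_prop⟩
  have hrk : ∀ p, r p ^ k = q p := fun p => by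
    change (p.1 * Circle.exp (v p / k)) ^ k = _
    rw [mul_zpow, ← Circle.exp_mul_int, div_mul_cancel₀ _ hkR, hv]
    simp
  -- On the annulus the root is determined up to a constant.
  let σ : C(Circle × unitInterval, Circle) :=
    ⟨fun a => r (P a) * Circle.exp (-(2 * Real.pi * a.2 / k)), by fun_prop⟩
  have hσk : ∀ a, σ a ^ k = 1 := fun a => by
    change (r (P a) * Circle.exp (-(2 * Real.pi * a.2 / k))) ^ k = 1
    rw [mul_zpow, hrk, hq, ← Circle.exp_mul_int, ← Circle.exp_add, neg_mul, div_mul_cancel₀ _ hkR,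
      add_neg_cancel, Circle.exp_zero]
  obtain ⟨ζ, hζ⟩ : ∃ ζ, ∀ a, σ a = ζ := by
    have hpre := (isPreconnected_range σ.continuous)
    have hsub := ((finite_setOf_zpow_eq_one hk0).subset
      (range_subset_iff.2 hσk)).countable.isTotallyDisconnected _ subset_rfl hpre
    exact ⟨σ (1, 0), fun a => hsub ⟨a, rfl⟩ ⟨_, rfl⟩⟩
  have hζk : ζ ^ k = 1 := hζ (1, 0) ▸ hσk _
  have hrP : ∀ a, r (P a) = ζ * Circle.exp (2 * Real.pi * a.2 / k) := fun a => by
    rw [← hζ a]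
    change _ = r (P a) * Circle.exp (-(2 * Real.pi * a.2 / k)) * _
    rw [mul_assoc, ← Circle.exp_add, neg_add_cancel, Circle.exp_zero, mul_one]
  set Λ : Set Circle := range fun t : unitInterval => ζ * Circle.exp (2 * Real.pi * t / k)
  have hΛ : IsClosed Λ := (isCompact_range (by fun_prop)).isClosed
  have hclopen : IsClopen (r ⁻¹' Λ) := by
    refine ⟨hΛ.preimage r.continuous, ?_⟩
    have : r ⁻¹' Λ = (r ⁻¹' ({u | u ^ k = 1} \ Λ))ᶜ := by
      ext x
      simp only [mem_preimage, mem_compl_iff, mem_sdiff, not_and, not_not, mem_ofPred_eq]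
      refine ⟨fun h _ => h, fun h => ?_⟩
      by_cases hx : x ∈ range P
      · obtain ⟨a, rfl⟩ := hx
        exact ⟨a.2, (hrP a).symm⟩
      · exact h (by rw [hrk, hq' x hx])
    rw [this]
    exact ((((finite_setOf_zpow_eq_one hk0).subset sdiff_subset).isClosed).preimage
      r.continuous).isOpen_compl
  have huniv : r ⁻¹' Λ = univ := hclopen.eq_univ ⟨P (1, 0), 0, (hrP (1, 0)).symm⟩
  have hmiss : ζ * Circle.exp (-(Real.pi / k)) ∉ range r := by
    rintro ⟨x, hx⟩
    obtain ⟨t, ht⟩ : r x ∈ Λ := by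
      have : x ∈ r ⁻¹' Λ := huniv ▸ mem_univ x
      exact this
    rw [hx] at ht
    obtain ⟨n, hn⟩ := Circle.exp_eq_exp.1 (mul_left_cancel ht)
    have h1 : (t : ℝ) + 1 / 2 = n * k := by
      have hpi' : Real.pi ≠ 0 := Real.pi_ne_zero
      field_simp at hn
      linear_combination hn / 2
    have h2 : (0 : ℝ) < ((n * k : ℤ) : ℝ) := by push_cast; rw [← h1]; linarith [t.2.1]
    have h3 : ((n * k : ℤ) : ℝ) < (2 : ℤ) := by push_cast; rw [← h1]; linarith [t.2.2]
    have h2' : 0 < n * k := by exact_mod_cast h2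
    have h3' : n * k < 2 := by exact_mod_cast h3
    have h4 : k * n = 1 := by rw [mul_comm]; omega
    rcases Int.isUnit_iff.1 (IsUnit.of_mul_eq_one _ h4) with h | h
    · exact hk1 h
    · exact hk2 h
  obtain ⟨w, hw⟩ := exists_log_of_notMem_range hmiss
  have c1 : HasClass r 1 0 := ⟨⟨fun p => v p / k, by fun_prop⟩, fun p => by simp [r]⟩
  have c2 : HasClass r 0 0 := ⟨w, fun p => by simp [hw]⟩
  exact absurd (c1.unique c2).1 one_ne_zero

end AnnulusTwist

end

noncomputable section

/-! ### Piecewise linear interpolation -/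

open Set

/-- The piecewise linear function with the values `c i` at the integers `i`. -/
def lerp (c : ℤ → ℝ) (τ : ℝ) : ℝ := c ⌊τ⌋ + Int.fract τ * (c (⌊τ⌋ + 1) - c ⌊τ⌋)

theorem lerp_add (c : ℤ → ℝ) (i : ℤ) {s : ℝ} (h0 : 0 ≤ s) (h1 : s ≤ 1) :
    lerp c (i + s) = (1 - s) * c i + s * c (i + 1) := by
  rcases h1.lt_or_eq with h | rfl
  · have hf : ⌊(i : ℝ) + s⌋ = i := by
      rw [Int.floor_eq_iff]
      constructor <;> linarith
    rw [lerp, Int.fract, hf]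
    ring
  · rw [lerp]
    have : ⌊(i : ℝ) + 1⌋ = i + 1 := by simp
    rw [Int.fract, this]
    push_cast
    ring

theorem continuous_lerp (c : ℤ → ℝ) : Continuous (lerp c) := by
  rw [continuous_iff_continuousAt]
  intro τ₀
  set n := ⌊τ₀⌋
  have hloc : lerp c =ᶠ[nhds τ₀] fun τ => c n + max 0 (τ - n) * (c (n + 1) - c n) -
      max 0 (n - τ) * (c n - c (n - 1)) := by
    have h1 : (n : ℝ) ≤ τ₀ := Int.floor_le _
    have h2 : τ₀ < n + 1 := Int.lt_floor_add_one _
    filter_upwards [Ioo_mem_nhds (show (n : ℝ) - 1 < τ₀ by linarith) h2] with τ hτ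
    rcases le_total (n : ℝ) τ with h | h
    · have := lerp_add c n (s := τ - n) (by linarith) (by linarith [hτ.2])
      rw [add_sub_cancel] at this
      rw [this, max_eq_right (by linarith), max_eq_left (by linarith)]
      ring
    · have := lerp_add c (n - 1) (s := τ - n + 1) (by linarith [hτ.1]) (by linarith)
      rw [show ((n - 1 : ℤ) : ℝ) + (τ - n + 1) = τ by push_cast; ring, sub_add_cancel] at this
      rw [this, max_eq_left (by linarith), max_eq_right (by linarith)]
      ring
  refine ContinuousAt.congr ?_ hloc.symm
  fun_prop

theorem lerp_shift {c : ℤ → ℝ} {L : ℤ} {k : ℝ} (h : ∀ i, c (i + L) = c i + k) (τ : ℝ) :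
    lerp c (τ + L) = lerp c τ + k := by
  rw [lerp, lerp, Int.floor_add_intCast, Int.fract_add_intCast, h,
    show ⌊τ⌋ + L + 1 = ⌊τ⌋ + 1 + L by ring, h]
  ring

/-! ### Simple closed lattice curves and their annular neighbourhoods -/

/-- A simple closed curve in the grid `ℤ² / N ℤ²` on the torus, given by a lift `(x i, y i)` of its
vertices to `ℤ²`; one turn around the curve takes `L` unit steps and moves the lift by
`N • (mx, my)`. -/
structure LatticeCurve (N : ℕ) where
  L : ℕ
  x : ℤ → ℤ
  y : ℤ → ℤ
  mx : ℤ
  my : ℤ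
  four_le : 4 ≤ N
  three_le : 3 ≤ L
  step : ∀ i, (x (i + 1) - x i) ^ 2 + (y (i + 1) - y i) ^ 2 = 1
  shift_x : ∀ i, x (i + L) = x i + N * mx
  shift_y : ∀ i, y (i + L) = y i + N * my
  simple : ∀ i j, (N : ℤ) ∣ x i - x j → (N : ℤ) ∣ y i - y j → (L : ℤ) ∣ i - j

namespace LatticeCurve

variable {N : ℕ} (c : LatticeCurve N)

/-- The `x`-component of the `i`-th step. -/
def dx (i : ℤ) : ℤ := c.x (i + 1) - c.x i

/-- The `y`-component of the `i`-th step. -/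
def dy (i : ℤ) : ℤ := c.y (i + 1) - c.y i

/-- The turn of the curve at its `i`-th vertex: `1` to the left, `-1` to the right, `0` if the curve
goes straight on. -/
def turn (i : ℤ) : ℤ := c.dy i * c.dx (i - 1) - c.dx i * c.dy (i - 1)

theorem int_sq_add_sq_eq_one {a b : ℤ} (h : a ^ 2 + b ^ 2 = 1) :
    (a = 1 ∧ b = 0) ∨ (a = -1 ∧ b = 0) ∨ (a = 0 ∧ b = 1) ∨ (a = 0 ∧ b = -1) := by
  have ha : -1 ≤ a ∧ a ≤ 1 := ⟨by nlinarith [sq_nonneg b], by nlinarith [sq_nonneg b]⟩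
  have hb : -1 ≤ b ∧ b ≤ 1 := ⟨by nlinarith [sq_nonneg a], by nlinarith [sq_nonneg a]⟩
  obtain ⟨h1, h2⟩ := ha
  obtain ⟨h3, h4⟩ := hb
  interval_cases a <;> interval_cases b <;> simp_all

theorem dir (i : ℤ) : (c.dx i = 1 ∧ c.dy i = 0) ∨ (c.dx i = -1 ∧ c.dy i = 0) ∨
    (c.dx i = 0 ∧ c.dy i = 1) ∨ (c.dx i = 0 ∧ c.dy i = -1) :=
  int_sq_add_sq_eq_one (c.step i)

theorem dx_shift (i : ℤ) : c.dx (i + c.L) = c.dx i := by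
  rw [dx, dx, show i + c.L + 1 = i + 1 + c.L by ring, c.shift_x, c.shift_x]
  ring

theorem dy_shift (i : ℤ) : c.dy (i + c.L) = c.dy i := by
  rw [dy, dy, show i + c.L + 1 = i + 1 + c.L by ring, c.shift_y, c.shift_y]
  ring

theorem turn_shift (i : ℤ) : c.turn (i + c.L) = c.turn i := by
  rw [turn, turn, dx_shift, dy_shift, show i + c.L - 1 = i - 1 + c.L by ring, dx_shift, dy_shift]

/-- Consecutive steps are related by a rotation by `0` or `± π / 2`, because a simple curve does not
turn back. -/
theorem turn_cases (i : ℤ) :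
    (c.dx i = c.dx (i - 1) ∧ c.dy i = c.dy (i - 1) ∧ c.turn i = 0) ∨
    (c.dx i = -c.dy (i - 1) ∧ c.dy i = c.dx (i - 1) ∧ c.turn i = 1) ∨
    (c.dx i = c.dy (i - 1) ∧ c.dy i = -c.dx (i - 1) ∧ c.turn i = -1) := by
  have hback : ¬ (c.dx i = -c.dx (i - 1) ∧ c.dy i = -c.dy (i - 1)) := by
    rintro ⟨h1, h2⟩
    simp only [dx, dy, sub_add_cancel] at h1 h2
    have hx : c.x (i + 1) - c.x (i - 1) = 0 := by linarith
    have hy : c.y (i + 1) - c.y (i - 1) = 0 := by linarith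
    have := c.simple (i + 1) (i - 1) (hx ▸ dvd_zero _) (hy ▸ dvd_zero _)
    have h3 := Int.le_of_dvd (by omega) this
    have := c.three_le
    omega
  rcases c.dir i with ⟨h1, h2⟩ | ⟨h1, h2⟩ | ⟨h1, h2⟩ | ⟨h1, h2⟩ <;>
  rcases c.dir (i - 1) with ⟨h3, h4⟩ | ⟨h3, h4⟩ | ⟨h3, h4⟩ | ⟨h3, h4⟩ <;>
  simp [turn, h1, h2, h3, h4] at hback ⊢

/-- The `x`-coordinate of the point at position `(a, b)` in the frame of the `i`-th step. -/
def ptX (i : ℤ) (a b : ℝ) : ℝ := c.x i + a * c.dx i - b * c.dy i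

/-- The `y`-coordinate of the point at position `(a, b)` in the frame of the `i`-th step. -/
def ptY (i : ℤ) (a b : ℝ) : ℝ := c.y i + a * c.dy i + b * c.dx i

/-- The mitred position along the `i`-th step: for `s = 0` and `s = 1` the points with lateral
offset `b` lie on the bisectors of the curve at the two ends of the step. -/
def along (i : ℤ) (s b : ℝ) : ℝ := s + b * ((1 - s) * c.turn i - s * c.turn (i + 1))

/-- The `x`-coordinate of the curve parallel to `c` with lateral offset `b`. -/
def parX (τ b : ℝ) : ℝ :=
  lerp (fun i => c.x i) τ + b * lerp (fun i => c.turn i * c.dx i - c.dy i) τ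

/-- The `y`-coordinate of the curve parallel to `c` with lateral offset `b`. -/
def parY (τ b : ℝ) : ℝ :=
  lerp (fun i => c.y i) τ + b * lerp (fun i => c.turn i * c.dy i + c.dx i) τ

theorem parX_add (i : ℤ) {s : ℝ} (h0 : 0 ≤ s) (h1 : s ≤ 1) (b : ℝ) :
    c.parX (i + s) b = c.ptX i (c.along i s b) b := by
  rw [parX, lerp_add _ _ h0 h1, lerp_add _ _ h0 h1, ptX, along]
  have e : (c.turn (i + 1) * c.dx (i + 1) - c.dy (i + 1) : ℤ) = -c.turn (i + 1) * c.dx i - c.dy i := by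
    have := c.turn_cases (i + 1)
    rw [add_sub_cancel_right] at this
    rcases this with ⟨h1, h2, h3⟩ | ⟨h1, h2, h3⟩ | ⟨h1, h2, h3⟩ <;> rw [h1, h2, h3] <;> ring
  have e' : (c.turn (i + 1) * c.dx (i + 1) - c.dy (i + 1) : ℝ) =
      -c.turn (i + 1) * c.dx i - c.dy i := by exact_mod_cast e
  have ex : (c.x (i + 1) : ℝ) = c.x i + c.dx i := by rw [dx]; push_cast; ring
  rw [e', ex]
  ring

theorem parY_add (i : ℤ) {s : ℝ} (h0 : 0 ≤ s) (h1 : s ≤ 1) (b : ℝ) :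
    c.parY (i + s) b = c.ptY i (c.along i s b) b := by
  rw [parY, lerp_add _ _ h0 h1, lerp_add _ _ h0 h1, ptY, along]
  have e : (c.turn (i + 1) * c.dy (i + 1) + c.dx (i + 1) : ℤ) = -c.turn (i + 1) * c.dy i + c.dx i := by
    have := c.turn_cases (i + 1)
    rw [add_sub_cancel_right] at this
    rcases this with ⟨h1, h2, h3⟩ | ⟨h1, h2, h3⟩ | ⟨h1, h2, h3⟩ <;> rw [h1, h2, h3] <;> ring
  have e' : (c.turn (i + 1) * c.dy (i + 1) + c.dx (i + 1) : ℝ) =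
      -c.turn (i + 1) * c.dy i + c.dx i := by exact_mod_cast e
  have ey : (c.y (i + 1) : ℝ) = c.y i + c.dy i := by rw [dy]; push_cast; ring
  rw [e', ey]
  ring

theorem parX_shift (n : ℤ) (τ b : ℝ) : c.parX (τ + n * c.L) b = c.parX τ b + N * (n * c.mx) := by
  have hx : ∀ i, c.x (i + n * c.L) = c.x i + N * (n * c.mx) ∧ c.dx (i + n * c.L) = c.dx i ∧
      c.dy (i + n * c.L) = c.dy i ∧ c.turn (i + n * c.L) = c.turn i := by
    induction n using Int.induction_on with
    | zero => simp
    | succ k ih =>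
      intro i
      rw [show i + ((k : ℤ) + 1) * c.L = i + k * c.L + c.L by ring, c.shift_x, c.dx_shift,
        c.dy_shift, c.turn_shift, (ih i).1]
      exact ⟨by ring, (ih i).2⟩
    | pred k ih =>
      intro i
      have e : i + -(k : ℤ) * c.L = i + (-(k : ℤ) - 1) * c.L + c.L := by ring
      have := ih i
      rw [e, c.shift_x, c.dx_shift, c.dy_shift, c.turn_shift] at this
      exact ⟨by linear_combination this.1, this.2⟩
  have h1 := lerp_shift (c := fun i => (c.x i : ℝ)) (L := n * c.L) (k := N * (n * c.mx))
    (fun i => by rw [(hx i).1]; push_cast; ring) τ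
  have h2 := lerp_shift (c := fun i => (c.turn i * c.dx i - c.dy i : ℝ)) (L := n * c.L) (k := 0)
    (fun i => by rw [(hx i).2.1, (hx i).2.2.1, (hx i).2.2.2, add_zero]) τ
  push_cast at h1 h2
  rw [parX, parX, h1, h2]
  ring

theorem parY_shift (n : ℤ) (τ b : ℝ) : c.parY (τ + n * c.L) b = c.parY τ b + N * (n * c.my) := by
  have hx : ∀ i, c.y (i + n * c.L) = c.y i + N * (n * c.my) ∧ c.dx (i + n * c.L) = c.dx i ∧
      c.dy (i + n * c.L) = c.dy i ∧ c.turn (i + n * c.L) = c.turn i := by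
    induction n using Int.induction_on with
    | zero => simp
    | succ k ih =>
      intro i
      rw [show i + ((k : ℤ) + 1) * c.L = i + k * c.L + c.L by ring, c.shift_y, c.dx_shift,
        c.dy_shift, c.turn_shift, (ih i).1]
      exact ⟨by ring, (ih i).2⟩
    | pred k ih =>
      intro i
      have e : i + -(k : ℤ) * c.L = i + (-(k : ℤ) - 1) * c.L + c.L := by ring
      have := ih i
      rw [e, c.shift_y, c.dx_shift, c.dy_shift, c.turn_shift] at this
      exact ⟨by linear_combination this.1, this.2⟩
  have h1 := lerp_shift (c := fun i => (c.y i : ℝ)) (L := n * c.L) (k := N * (n * c.my))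
    (fun i => by rw [(hx i).1]; push_cast; ring) τ
  have h2 := lerp_shift (c := fun i => (c.turn i * c.dy i + c.dx i : ℝ)) (L := n * c.L) (k := 0)
    (fun i => by rw [(hx i).2.1, (hx i).2.2.1, (hx i).2.2.2, add_zero]) τ
  push_cast at h1 h2
  rw [parY, parY, h1, h2]
  ring

theorem abs_turn_le (i : ℤ) : |(c.turn i : ℝ)| ≤ 1 := by
  rcases c.turn_cases i with ⟨-, -, h⟩ | ⟨-, -, h⟩ | ⟨-, -, h⟩ <;> rw [h] <;> simp

theorem abs_mul_turn_le (i : ℤ) {b : ℝ} (hb : |b| ≤ 1 / 4) :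
    |b * (c.turn i : ℝ)| ≤ 1 / 4 := by
  rw [abs_mul]
  nlinarith [abs_nonneg b, abs_nonneg (c.turn i : ℝ), c.abs_turn_le i]

theorem along_mem {i : ℤ} {s b : ℝ} (h0 : 0 ≤ s) (h1 : s ≤ 1) (hb : |b| ≤ 1 / 4) :
    b * c.turn i ≤ c.along i s b ∧ c.along i s b ≤ 1 - b * c.turn (i + 1) := by
  have t1 := abs_le.1 (c.abs_mul_turn_le i hb)
  have t2 := abs_le.1 (c.abs_mul_turn_le (i + 1) hb)
  rw [along]
  constructor <;> nlinarith

theorem along_bounds {i : ℤ} {s b : ℝ} (h0 : 0 ≤ s) (h1 : s ≤ 1) (hb : |b| ≤ 1 / 4) :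
    -(1 / 4) ≤ c.along i s b ∧ c.along i s b ≤ 5 / 4 := by
  have t1 := abs_le.1 (c.abs_mul_turn_le i hb)
  have t2 := abs_le.1 (c.abs_mul_turn_le (i + 1) hb)
  have := c.along_mem (i := i) h0 h1 hb
  constructor <;> linarith [this.1, this.2]

theorem exists_along_eq {i : ℤ} {a b : ℝ} (hb : |b| ≤ 1 / 4) (h1 : b * c.turn i ≤ a)
    (h2 : a ≤ 1 - b * c.turn (i + 1)) : ∃ s, 0 ≤ s ∧ s ≤ 1 ∧ c.along i s b = a := by
  have t1 := abs_le.1 (c.abs_mul_turn_le i hb)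
  have t2 := abs_le.1 (c.abs_mul_turn_le (i + 1) hb)
  have hpos : 0 < 1 - b * c.turn i - b * c.turn (i + 1) := by linarith
  refine ⟨(a - b * c.turn i) / (1 - b * c.turn i - b * c.turn (i + 1)),
    div_nonneg (by linarith) hpos.le, (div_le_one hpos).2 (by linarith), ?_⟩
  rw [along]
  have := div_mul_cancel₀ (a - b * c.turn i) hpos.ne'
  linear_combination this

theorem along_injective {i : ℤ} {s s' b : ℝ} (hb : |b| ≤ 1 / 4)
    (h : c.along i s b = c.along i s' b) : s = s' := by
  have t1 := abs_le.1 (c.abs_mul_turn_le i hb)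
  have t2 := abs_le.1 (c.abs_mul_turn_le (i + 1) hb)
  rw [along, along] at h
  have : (s - s') * (1 - b * c.turn i - b * c.turn (i + 1)) = 0 := by linear_combination h
  rcases mul_eq_zero.1 this with h | h
  · linarith
  · linarith

theorem eq_zero_of_abs_mul_lt {k : ℤ} (hN : 4 ≤ N) (h : |(N : ℝ) * k| < 4) : k = 0 := by
  by_contra hk
  have h1 : (1 : ℝ) ≤ |(k : ℝ)| := by
    have := Int.one_le_abs hk
    exact_mod_cast this
  have h2 : (4 : ℝ) ≤ N := by exact_mod_cast hN
  rw [abs_mul, Nat.abs_cast] at h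
  nlinarith

theorem same_piece {i : ℤ} {s b s' b' : ℝ} (h0 : 0 ≤ s) (h1 : s ≤ 1) (h0' : 0 ≤ s') (h1' : s' ≤ 1)
    (hb : |b| ≤ 1 / 4) (hb' : |b'| ≤ 1 / 4) {p q : ℤ}
    (hX : c.ptX i (c.along i s b) b = c.ptX i (c.along i s' b') b' + N * p)
    (hY : c.ptY i (c.along i s b) b = c.ptY i (c.along i s' b') b' + N * q) : b = b' ∧ s = s' := by
  have ha := c.along_bounds (i := i) h0 h1 hb
  have ha' := c.along_bounds (i := i) h0' h1' hb'
  have hb1 := abs_le.1 hb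
  have hb2 := abs_le.1 hb'
  have key : b = b' ∧ c.along i s b = c.along i s' b' := by
    rw [ptX, ptX] at hX
    rw [ptY, ptY] at hY
    rcases c.dir i with ⟨d1, d2⟩ | ⟨d1, d2⟩ | ⟨d1, d2⟩ | ⟨d1, d2⟩ <;> rw [d1, d2] at hX hY <;>
    push_cast at hX hY <;>
    · obtain rfl : p = 0 := eq_zero_of_abs_mul_lt c.four_le
        (abs_lt.2 ⟨by linarith [ha.1, ha.2, ha'.1, ha'.2], by linarith [ha.1, ha.2, ha'.1, ha'.2]⟩)
      obtain rfl : q = 0 := eq_zero_of_abs_mul_lt c.four_le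
        (abs_lt.2 ⟨by linarith [ha.1, ha.2, ha'.1, ha'.2], by linarith [ha.1, ha.2, ha'.1, ha'.2]⟩)
      push_cast at hX hY
      constructor <;> linarith
  refine ⟨key.1, ?_⟩
  have h2 := key.2
  rw [← key.1] at h2
  exact c.along_injective hb h2

/-- The passage from the frame of a step to that of the preceding step. -/
theorem frame_change (i : ℤ) (a b : ℝ) : ∃ a' b', c.ptX i a b = c.ptX (i - 1) a' b' ∧
    c.ptY i a b = c.ptY (i - 1) a' b' ∧
    ((c.turn i = 0 ∧ a' = 1 + a ∧ b' = b) ∨ (c.turn i = 1 ∧ a' = 1 - b ∧ b' = a) ∨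
      (c.turn i = -1 ∧ a' = 1 + b ∧ b' = -a)) := by
  have ex : (c.x i : ℝ) = c.x (i - 1) + c.dx (i - 1) := by rw [dx, sub_add_cancel]; push_cast; ring
  have ey : (c.y i : ℝ) = c.y (i - 1) + c.dy (i - 1) := by rw [dy, sub_add_cancel]; push_cast; ring
  simp only [ptX, ptY, ex, ey]
  rcases c.turn_cases i with ⟨h1, h2, h3⟩ | ⟨h1, h2, h3⟩ | ⟨h1, h2, h3⟩ <;> rw [h1, h2]
  · exact ⟨1 + a, b, by ring, by ring, Or.inl ⟨h3, rfl, rfl⟩⟩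
  · exact ⟨1 - b, a, by push_cast; ring, by push_cast; ring, Or.inr (Or.inl ⟨h3, rfl, rfl⟩)⟩
  · exact ⟨1 + b, -a, by push_cast; ring, by push_cast; ring, Or.inr (Or.inr ⟨h3, rfl, rfl⟩)⟩

/-- Consecutive pieces of the annulus only meet along the bisector. -/
theorem adjacent_piece {i : ℤ} {s b s' b' : ℝ} (h0 : 0 ≤ s) (h1 : s ≤ 1) (h0' : 0 ≤ s')
    (h1' : s' ≤ 1) (hb : |b| ≤ 1 / 4) (hb' : |b'| ≤ 1 / 4) {p q : ℤ}
    (hX : c.ptX i (c.along i s b) b = c.ptX (i - 1) (c.along (i - 1) s' b') b' + N * p)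
    (hY : c.ptY i (c.along i s b) b = c.ptY (i - 1) (c.along (i - 1) s' b') b' + N * q) :
    b = b' ∧ s = 0 ∧ s' = 1 := by
  have ha := c.along_bounds (i := i) h0 h1 hb
  have ha' := c.along_bounds (i := i - 1) h0' h1' hb'
  have hm := (c.along_mem (i := i) h0 h1 hb).1
  have hm' := (c.along_mem (i := i - 1) h0' h1' hb').2
  rw [sub_add_cancel] at hm'
  have hb1 := abs_le.1 hb
  have hb2 := abs_le.1 hb'
  obtain ⟨A, B, hA, hB, hcases⟩ := c.frame_change i (c.along i s b) b
  rw [hA] at hX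
  rw [hB] at hY
  have hAB : -(1 / 4) ≤ A ∧ A ≤ 9 / 4 ∧ -(5 / 4) ≤ B ∧ B ≤ 5 / 4 := by
    rcases hcases with ⟨-, h2, h3⟩ | ⟨-, h2, h3⟩ | ⟨-, h2, h3⟩ <;>
    refine ⟨?_, ?_, ?_, ?_⟩ <;> linarith [ha.1, ha.2]
  have key : B = b' ∧ A = c.along (i - 1) s' b' := by
    rw [ptX, ptX] at hX
    rw [ptY, ptY] at hY
    rcases c.dir (i - 1) with ⟨d1, d2⟩ | ⟨d1, d2⟩ | ⟨d1, d2⟩ | ⟨d1, d2⟩ <;> rw [d1, d2] at hX hY <;>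
    push_cast at hX hY <;>
    · obtain rfl : p = 0 := eq_zero_of_abs_mul_lt c.four_le
        (abs_lt.2 ⟨by linarith [hAB.1, hAB.2.1, ha'.1, ha'.2, hAB.2.2.1, hAB.2.2.2],
          by linarith [hAB.1, hAB.2.1, ha'.1, ha'.2, hAB.2.2.1, hAB.2.2.2]⟩)
      obtain rfl : q = 0 := eq_zero_of_abs_mul_lt c.four_le
        (abs_lt.2 ⟨by linarith [hAB.1, hAB.2.1, ha'.1, ha'.2, hAB.2.2.1, hAB.2.2.2],
          by linarith [hAB.1, hAB.2.1, ha'.1, ha'.2, hAB.2.2.1, hAB.2.2.2]⟩)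
      push_cast at hX hY
      constructor <;> linarith
  have hres : b = b' ∧ c.along i s b = b * c.turn i ∧
      c.along (i - 1) s' b' = 1 - b' * c.turn i := by
    rcases hcases with ⟨h1, h2, h3⟩ | ⟨h1, h2, h3⟩ | ⟨h1, h2, h3⟩ <;> rw [h1] at hm hm' ⊢ <;>
    push_cast at hm hm' ⊢ <;> refine ⟨?_, ?_, ?_⟩ <;> linarith [key.1, key.2]
  refine ⟨hres.1, c.along_injective (i := i) hb ?_, c.along_injective (i := i - 1) hb' ?_⟩
  · rw [hres.2.1, along]; ring
  · rw [hres.2.2, along, sub_add_cancel]; ring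

/-- Two unit grid segments with points at sup-distance less than `1` share a vertex. -/
theorem share_vertex {vx vy wx wy dx dy ex ey : ℤ} (hd : dx ^ 2 + dy ^ 2 = 1)
    (he : ex ^ 2 + ey ^ 2 = 1) {a b a' b' : ℝ} (ha : -(1 / 4) ≤ a ∧ a ≤ 5 / 4)
    (ha' : -(1 / 4) ≤ a' ∧ a' ≤ 5 / 4) (hb : |b| ≤ 1 / 4) (hb' : |b'| ≤ 1 / 4)
    (hX : (vx + a * dx - b * dy : ℝ) = wx + a' * ex - b' * ey)
    (hY : (vy + a * dy + b * dx : ℝ) = wy + a' * ey + b' * ex) :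
    (vx = wx ∧ vy = wy) ∨ (vx = wx + ex ∧ vy = wy + ey) ∨ (vx + dx = wx ∧ vy + dy = wy) ∨
      (vx + dx = wx + ex ∧ vy + dy = wy + ey) := by
  have hb1 := abs_le.1 hb
  have hb2 := abs_le.1 hb'
  have hints : -(1 + dx ^ 2 + ex ^ 2) ≤ 2 * (vx - wx) - (ex - dx) ∧
      2 * (vx - wx) - (ex - dx) ≤ 1 + dx ^ 2 + ex ^ 2 ∧
      -(1 + dy ^ 2 + ey ^ 2) ≤ 2 * (vy - wy) - (ey - dy) ∧
      2 * (vy - wy) - (ey - dy) ≤ 1 + dy ^ 2 + ey ^ 2 := by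
    have : -(1 + dx ^ 2 + ex ^ 2) ≤ (2 * (vx - wx) - (ex - dx) : ℝ) ∧
      (2 * (vx - wx) - (ex - dx) : ℝ) ≤ 1 + dx ^ 2 + ex ^ 2 ∧
      -(1 + dy ^ 2 + ey ^ 2) ≤ (2 * (vy - wy) - (ey - dy) : ℝ) ∧
      (2 * (vy - wy) - (ey - dy) : ℝ) ≤ 1 + dy ^ 2 + ey ^ 2 := by
      rcases int_sq_add_sq_eq_one hd with ⟨rfl, rfl⟩ | ⟨rfl, rfl⟩ | ⟨rfl, rfl⟩ | ⟨rfl, rfl⟩ <;>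
      rcases int_sq_add_sq_eq_one he with ⟨rfl, rfl⟩ | ⟨rfl, rfl⟩ | ⟨rfl, rfl⟩ | ⟨rfl, rfl⟩ <;>
      push_cast at hX hY ⊢ <;>
      refine ⟨?_, ?_, ?_, ?_⟩ <;> linarith [ha.1, ha.2, ha'.1, ha'.2, hb1.1, hb1.2, hb2.1, hb2.2]
    exact_mod_cast this
  obtain ⟨i1, i2, i3, i4⟩ := hints
  rcases int_sq_add_sq_eq_one hd with ⟨rfl, rfl⟩ | ⟨rfl, rfl⟩ | ⟨rfl, rfl⟩ | ⟨rfl, rfl⟩ <;>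
  rcases int_sq_add_sq_eq_one he with ⟨rfl, rfl⟩ | ⟨rfl, rfl⟩ | ⟨rfl, rfl⟩ | ⟨rfl, rfl⟩ <;>
  simp only [one_pow, neg_sq, ne_eq, OfNat.ofNat_ne_zero, not_false_eq_true, zero_pow] at i1 i2 i3 i4 <;>
  omega

/-- The parallel curves with offsets at most `1 / 4` are simple and disjoint in the torus. -/
theorem par_injective {τ τ' b b' : ℝ} (hb : |b| ≤ 1 / 4) (hb' : |b'| ≤ 1 / 4) {p q : ℤ}
    (hX : c.parX τ b = c.parX τ' b' + N * p) (hY : c.parY τ b = c.parY τ' b' + N * q) :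
    b = b' ∧ ∃ n : ℤ, τ = τ' + n * c.L := by
  -- Move the second point by full turns until its step is in a prescribed residue class.
  have reduce : ∀ n : ℤ, ∃ p' q' : ℤ,
      c.parX τ b = c.parX (τ' + n * c.L) b' + N * p' ∧
      c.parY τ b = c.parY (τ' + n * c.L) b' + N * q' := fun n =>
    ⟨p - n * c.mx, q - n * c.my, by rw [parX_shift, hX]; push_cast; ring,
      by rw [parY_shift, hY]; push_cast; ring⟩
  set i := ⌊τ⌋ with hi
  set j := ⌊τ'⌋ with hj
  have hτ : τ = i + Int.fract τ := (Int.floor_add_fract τ).symm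
  have hτ' : τ' = j + Int.fract τ' := (Int.floor_add_fract τ').symm
  have s0 := Int.fract_nonneg τ
  have s1 := (Int.fract_lt_one τ).le
  have s0' := Int.fract_nonneg τ'
  have s1' := (Int.fract_lt_one τ').le
  generalize Int.fract τ = s at hτ s0 s1
  generalize Int.fract τ' = s' at hτ' s0' s1'
  have hre : ∀ n : ℤ, τ' + n * c.L = ((j + n * c.L : ℤ) : ℝ) + s' := fun n => by
    rw [hτ']; push_cast; ring
  have hdvd : (c.L : ℤ) ∣ i - j ∨ (c.L : ℤ) ∣ i - (j + 1) ∨ (c.L : ℤ) ∣ i + 1 - j := by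
    have hX' := hX
    have hY' := hY
    rw [hτ, hτ', parX_add _ _ s0 s1, parX_add _ _ s0' s1', ptX, ptX] at hX'
    rw [hτ, hτ', parY_add _ _ s0 s1, parY_add _ _ s0' s1', ptY, ptY] at hY'
    have := share_vertex (vx := c.x i) (vy := c.y i) (wx := c.x j + N * p) (wy := c.y j + N * q)
      (c.step i) (c.step j) (c.along_bounds (i := i) s0 s1 hb)
      (c.along_bounds (i := j) s0' s1' hb') hb hb'
      (by push_cast [dx, dy] at hX' ⊢; linear_combination hX')
      (by push_cast [dx, dy] at hY' ⊢; linear_combination hY')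
    rcases this with ⟨h1, h2⟩ | ⟨h1, h2⟩ | ⟨h1, h2⟩ | ⟨h1, h2⟩
    · exact Or.inl (c.simple _ _ ⟨p, by linarith⟩ ⟨q, by linarith⟩)
    · exact Or.inr (Or.inl (c.simple _ _ ⟨p, by linarith⟩ ⟨q, by linarith⟩))
    · exact Or.inr (Or.inr (c.simple _ _ ⟨p, by linarith⟩ ⟨q, by linarith⟩))
    · have := c.simple (i + 1) (j + 1) ⟨p, by linarith⟩ ⟨q, by linarith⟩
      rw [add_sub_add_right_eq_sub] at this
      exact Or.inl this
  rcases hdvd with ⟨n, hn⟩ | ⟨n, hn⟩ | ⟨n, hn⟩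
  · obtain ⟨p', q', hX', hY'⟩ := reduce n
    have hij : j + n * c.L = i := by linarith
    rw [hre, hij, hτ, parX_add _ _ s0 s1, parX_add _ _ s0' s1'] at hX'
    rw [hre, hij, hτ, parY_add _ _ s0 s1, parY_add _ _ s0' s1'] at hY'
    obtain ⟨h1, h2⟩ := c.same_piece s0 s1 s0' s1' hb hb' hX' hY'
    exact ⟨h1, n, by rw [hre, hij, hτ, h2]⟩
  · obtain ⟨p', q', hX', hY'⟩ := reduce n
    have hij : j + n * c.L = i - 1 := by linarith
    rw [hre, hij, hτ, parX_add _ _ s0 s1, parX_add _ _ s0' s1'] at hX'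
    rw [hre, hij, hτ, parY_add _ _ s0 s1, parY_add _ _ s0' s1'] at hY'
    obtain ⟨h1, h2, h3⟩ := c.adjacent_piece s0 s1 s0' s1' hb hb' hX' hY'
    exact ⟨h1, n, by rw [hre, hij, hτ, h2, h3]; push_cast; ring⟩
  · obtain ⟨p', q', hX', hY'⟩ := reduce n
    have hij : i = j + n * c.L - 1 := by linarith
    rw [hre, hτ, parX_add _ _ s0 s1, parX_add _ _ s0' s1', hij] at hX'
    rw [hre, hτ, parY_add _ _ s0 s1, parY_add _ _ s0' s1', hij] at hY'
    obtain ⟨h1, h2, h3⟩ := c.adjacent_piece (i := j + n * c.L) s0' s1' s0 s1 hb' hb (p := -p')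
      (q := -q') (by rw [hX']; push_cast; ring) (by rw [hY']; push_cast; ring)
    exact ⟨h1.symm, n, by rw [hre, hτ, hij, h2, h3]; push_cast; ring⟩

end LatticeCurve

end

noncomputable section

open Set

/-! ### The projection of the plane onto the torus -/

/-- The covering `ℝ² → Torus` with period lattice `N ℤ²`. -/
def gridPoint (N : ℕ) (z : ℝ × ℝ) : Torus :=
  (Circle.exp (2 * Real.pi * z.1 / N), Circle.exp (2 * Real.pi * z.2 / N))

theorem continuous_gridPoint (N : ℕ) : Continuous (gridPoint N) := by
  unfold gridPoint
  fun_prop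

theorem exp_two_pi_div_eq_iff {N : ℕ} (hN : 0 < N) {x y : ℝ} :
    Circle.exp (2 * Real.pi * x / N) = Circle.exp (2 * Real.pi * y / N) ↔
      ∃ p : ℤ, x = y + N * p := by
  have hN' : (N : ℝ) ≠ 0 := by positivity
  have hpi := Real.pi_ne_zero
  rw [Circle.exp_eq_exp]
  refine exists_congr fun p => ?_
  constructor
  · intro h
    field_simp at h
    linarith
  · rintro rfl
    field_simp

theorem gridPoint_eq_iff {N : ℕ} (hN : 0 < N) {z w : ℝ × ℝ} :
    gridPoint N z = gridPoint N w ↔ ∃ p q : ℤ, z.1 = w.1 + N * p ∧ z.2 = w.2 + N * q := by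
  rw [gridPoint, gridPoint, Prod.mk.injEq, exp_two_pi_div_eq_iff hN, exp_two_pi_div_eq_iff hN]
  constructor
  · rintro ⟨⟨p, hp⟩, q, hq⟩
    exact ⟨p, q, hp, hq⟩
  · rintro ⟨p, q, hp, hq⟩
    exact ⟨⟨p, hp⟩, q, hq⟩

theorem exp_two_pi_div_isOpenQuotientMap {N : ℕ} (hN : 0 < N) :
    IsOpenQuotientMap fun x : ℝ => Circle.exp (2 * Real.pi * x / N) := by
  have hr : 2 * Real.pi / N ≠ 0 := by positivity
  have h := Circle.exp_isOpenQuotientMap.comp (Homeomorph.mulLeft₀ _ hr).isOpenQuotientMap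
  convert h using 1
  funext x
  simp only [Function.comp, Homeomorph.coe_mulLeft₀]
  congr 1
  ring

theorem gridPoint_isOpenQuotientMap {N : ℕ} (hN : 0 < N) : IsOpenQuotientMap (gridPoint N) :=
  (exp_two_pi_div_isOpenQuotientMap hN).prodMap (exp_two_pi_div_isOpenQuotientMap hN)

namespace LatticeCurve

variable {N : ℕ} (c : LatticeCurve N)

theorem pos (c : LatticeCurve N) : 0 < N := lt_of_lt_of_le (by norm_num) c.four_le

theorem L_pos : (0 : ℝ) < c.L := by
  have := c.three_le
  exact_mod_cast (by omega : 0 < c.L)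

theorem continuous_par : Continuous fun a : ℝ × ℝ => (c.parX a.1 a.2, c.parY a.1 a.2) := by
  unfold parX parY
  have h1 := continuous_lerp fun i => (c.x i : ℝ)
  have h2 := continuous_lerp fun i => (c.turn i * c.dx i - c.dy i : ℝ)
  have h3 := continuous_lerp fun i => (c.y i : ℝ)
  have h4 := continuous_lerp fun i => (c.turn i * c.dy i + c.dx i : ℝ)
  fun_prop

/-- The union of the parallel curves with offsets at most `1 / 4`, as a map of the annulus into the
torus. -/
theorem exists_annulus : ∃ P : C(Circle × unitInterval, Torus), ∀ (τ : ℝ) (t : unitInterval),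
    P (Circle.exp (2 * Real.pi * τ / c.L), t) =
      gridPoint N (c.parX τ ((t - 1 / 2) / 2), c.parY τ ((t - 1 / 2) / 2)) := by
  have hL0 : 0 < c.L := by exact_mod_cast c.L_pos
  let χ : C(ℝ × unitInterval, Circle × unitInterval) :=
    ⟨Prod.map (fun x : ℝ => Circle.exp (2 * Real.pi * x / c.L)) id, by fun_prop⟩
  have hq : Topology.IsQuotientMap χ :=
    ((exp_two_pi_div_isOpenQuotientMap hL0).prodMap .id).isQuotientMap
  let offset : C(ℝ × unitInterval, ℝ × ℝ) := ⟨fun a => (a.1, (a.2 - 1 / 2) / 2), by fun_prop⟩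
  let Q : C(ℝ × unitInterval, Torus) :=
    ((⟨gridPoint N, continuous_gridPoint N⟩ : C(ℝ × ℝ, Torus)).comp ⟨_, c.continuous_par⟩).comp
      offset
  have hQ : Function.FactorsThrough Q χ := by
    rintro ⟨τ, t⟩ ⟨τ', t'⟩ h
    have h1 : Circle.exp (2 * Real.pi * τ / c.L) = Circle.exp (2 * Real.pi * τ' / c.L) :=
      congrArg Prod.fst h
    have h2 : t = t' := congrArg Prod.snd h
    obtain ⟨n, hn⟩ := (exp_two_pi_div_eq_iff hL0).1 h1
    have hn' : τ = τ' + n * c.L := by rw [hn]; ring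
    rw [hn', h2]
    refine (gridPoint_eq_iff c.pos).2 ⟨n * c.mx, n * c.my, ?_, ?_⟩
    · exact (c.parX_shift n τ' _).trans (by push_cast; rfl)
    · exact (c.parY_shift n τ' _).trans (by push_cast; rfl)
  refine ⟨hq.lift Q hQ, fun τ t => ?_⟩
  exact ContinuousMap.congr_fun (hq.lift_comp Q hQ) (τ, t)

/-- The open neighbourhood of the curve formed by the points at sup-distance less than `1 / 4`. -/
def nbhd : Set (ℝ × ℝ) :=
  ⋃ i : ℤ, ⋃ s ∈ Icc (0 : ℝ) 1,
    {z | |z.1 - (c.x i + s * c.dx i)| < 1 / 4 ∧ |z.2 - (c.y i + s * c.dy i)| < 1 / 4}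

theorem isOpen_nbhd : IsOpen c.nbhd := by
  refine isOpen_iUnion fun i => isOpen_biUnion fun s _ => ?_
  have h1 : Continuous fun z : ℝ × ℝ => |z.1 - (c.x i + s * c.dx i)| := by fun_prop
  have h2 : Continuous fun z : ℝ × ℝ => |z.2 - (c.y i + s * c.dy i)| := by fun_prop
  exact (isOpen_lt h1 continuous_const).inter (isOpen_lt h2 continuous_const)

theorem exists_frame (i : ℤ) (z : ℝ × ℝ) : ∃ a b, z = (c.ptX i a b, c.ptY i a b) ∧
    a = (z.1 - c.x i) * c.dx i + (z.2 - c.y i) * c.dy i ∧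
    b = (z.2 - c.y i) * c.dx i - (z.1 - c.x i) * c.dy i := by
  refine ⟨_, _, ?_, rfl, rfl⟩
  have h : ((c.dx i : ℝ)) ^ 2 + (c.dy i : ℝ) ^ 2 = 1 := by exact_mod_cast c.step i
  ext
  · simp only [ptX]
    linear_combination (c.x i - z.1) * h
  · simp only [ptY]
    linear_combination (c.y i - z.2) * h

/-- The passage from the frame of a step to that of the following step. -/
theorem frame_change' (i : ℤ) (a b : ℝ) : ∃ a' b', c.ptX i a b = c.ptX (i + 1) a' b' ∧
    c.ptY i a b = c.ptY (i + 1) a' b' ∧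
    ((c.turn (i + 1) = 0 ∧ a' = a - 1 ∧ b' = b) ∨ (c.turn (i + 1) = 1 ∧ a' = b ∧ b' = 1 - a) ∨
      (c.turn (i + 1) = -1 ∧ a' = -b ∧ b' = a - 1)) := by
  have ex : (c.x (i + 1) : ℝ) = c.x i + c.dx i := by rw [dx]; push_cast; ring
  have ey : (c.y (i + 1) : ℝ) = c.y i + c.dy i := by rw [dy]; push_cast; ring
  simp only [ptX, ptY, ex, ey]
  have := c.turn_cases (i + 1)
  rw [add_sub_cancel_right] at this
  rcases this with ⟨h1, h2, h3⟩ | ⟨h1, h2, h3⟩ | ⟨h1, h2, h3⟩ <;> rw [h1, h2]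
  · exact ⟨a - 1, b, by ring, by ring, Or.inl ⟨h3, rfl, rfl⟩⟩
  · exact ⟨b, 1 - a, by push_cast; ring, by push_cast; ring, Or.inr (Or.inl ⟨h3, rfl, rfl⟩)⟩
  · exact ⟨-b, a - 1, by push_cast; ring, by push_cast; ring, Or.inr (Or.inr ⟨h3, rfl, rfl⟩)⟩

theorem exists_par_of_frame {i : ℤ} {a b : ℝ} (hb : |b| < 1 / 4) (h1 : b * c.turn i ≤ a)
    (h2 : a ≤ 1 - b * c.turn (i + 1)) :
    ∃ τ b', |b'| < 1 / 4 ∧ c.ptX i a b = c.parX τ b' ∧ c.ptY i a b = c.parY τ b' := by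
  obtain ⟨s, h0, h3, rfl⟩ := c.exists_along_eq hb.le h1 h2
  exact ⟨i + s, b, hb, (c.parX_add i h0 h3 b).symm, (c.parY_add i h0 h3 b).symm⟩

/-- The open parallels with offsets below `1 / 4` sweep out an open set: a point beyond the bisector at
an end of a step belongs to the piece of the adjacent step. -/
theorem mem_nbhd_iff {z : ℝ × ℝ} :
    z ∈ c.nbhd ↔ ∃ τ b, |b| < 1 / 4 ∧ z = (c.parX τ b, c.parY τ b) := by
  constructor
  · intro hz
    simp only [nbhd, mem_iUnion, mem_ofPred_eq] at hz
    obtain ⟨i, s, ⟨h0, h1⟩, hzx, hzy⟩ := hz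
    obtain ⟨a, b, rfl, ha, hb⟩ := c.exists_frame i z
    have hab : s - 1 / 4 < a ∧ a < s + 1 / 4 ∧ -(1 / 4) < b ∧ b < 1 / 4 := by
      rw [abs_lt] at hzx hzy
      rcases c.dir i with ⟨d1, d2⟩ | ⟨d1, d2⟩ | ⟨d1, d2⟩ | ⟨d1, d2⟩ <;>
      rw [d1, d2] at ha hb <;> rw [d1] at hzx <;> rw [d2] at hzy <;> push_cast at ha hb hzx hzy <;>
      refine ⟨?_, ?_, ?_, ?_⟩ <;> linarith [hzx.1, hzx.2, hzy.1, hzy.2]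
    clear ha hb
    obtain ⟨ha1, ha2, hb1, hb2⟩ := hab
    suffices h : ∃ τ b', |b'| < 1 / 4 ∧ c.ptX i a b = c.parX τ b' ∧ c.ptY i a b = c.parY τ b' by
      obtain ⟨τ, b', hb', h1, h2⟩ := h
      exact ⟨τ, b', hb', by rw [h1, h2]⟩
    by_cases hlo : b * c.turn i ≤ a
    · by_cases hhi : a ≤ 1 - b * c.turn (i + 1)
      · exact c.exists_par_of_frame (abs_lt.2 ⟨hb1, hb2⟩) hlo hhi
      · obtain ⟨a', b', e1, e2, hc⟩ := c.frame_change' i a b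
        rw [e1, e2]
        have hb' : |b'| < 1 / 4 := by
          rw [abs_lt]
          rcases hc with ⟨h3, h4, h5⟩ | ⟨h3, h4, h5⟩ | ⟨h3, h4, h5⟩ <;> rw [h3] at hhi <;>
          push_cast at hhi <;> constructor <;> linarith
        have ht := abs_le.1 (c.abs_mul_turn_le (i + 1 + 1) hb'.le)
        refine c.exists_par_of_frame hb' ?_ ?_ <;>
        rcases hc with ⟨h3, h4, h5⟩ | ⟨h3, h4, h5⟩ | ⟨h3, h4, h5⟩ <;> rw [h3] at hhi <;>
        (try rw [h3]) <;> push_cast at hhi ⊢ <;> linarith [ht.1, ht.2]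
    · obtain ⟨a', b', e1, e2, hc⟩ := c.frame_change i a b
      rw [e1, e2]
      have hb' : |b'| < 1 / 4 := by
        rw [abs_lt]
        rcases hc with ⟨h3, h4, h5⟩ | ⟨h3, h4, h5⟩ | ⟨h3, h4, h5⟩ <;> rw [h3] at hlo <;>
        push_cast at hlo <;> constructor <;> linarith
      have ht := abs_le.1 (c.abs_mul_turn_le (i - 1) hb'.le)
      refine c.exists_par_of_frame hb' ?_ ?_ <;> (try rw [sub_add_cancel]) <;>
      rcases hc with ⟨h3, h4, h5⟩ | ⟨h3, h4, h5⟩ | ⟨h3, h4, h5⟩ <;> rw [h3] at hlo <;>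
      (try rw [h3]) <;> push_cast at hlo ⊢ <;> linarith [ht.1, ht.2]
  · rintro ⟨τ, b, hb, rfl⟩
    have h0 := Int.fract_nonneg τ
    have h1 := (Int.fract_lt_one τ).le
    simp only [nbhd, mem_iUnion, mem_ofPred_eq]
    refine ⟨⌊τ⌋, Int.fract τ, ⟨h0, h1⟩, ?_⟩
    have hbound : ∀ d : ℤ → ℝ, (∀ i, |d i| ≤ 1) → |b * lerp d τ| < 1 / 4 := by
      intro d hd
      have e := lerp_add d ⌊τ⌋ h0 h1
      rw [Int.floor_add_fract] at e
      have d1 := abs_le.1 (hd ⌊τ⌋)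
      have d2 := abs_le.1 (hd (⌊τ⌋ + 1))
      have : |lerp d τ| ≤ 1 := by
        rw [e, abs_le]
        constructor <;> nlinarith
      rw [abs_mul]
      nlinarith [abs_nonneg b, abs_nonneg (lerp d τ)]
    have hd : ∀ i, |(c.turn i * c.dx i - c.dy i : ℝ)| ≤ 1 ∧ |(c.turn i * c.dy i + c.dx i : ℝ)| ≤ 1 := by
      intro i
      have hk : c.turn i = 0 ∨ c.turn i = 1 ∨ c.turn i = -1 := by
        rcases c.turn_cases i with ⟨-, -, h⟩ | ⟨-, -, h⟩ | ⟨-, -, h⟩ <;> simp [h]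
      rcases hk with h | h | h <;>
      rcases c.dir i with ⟨d1, d2⟩ | ⟨d1, d2⟩ | ⟨d1, d2⟩ | ⟨d1, d2⟩ <;> rw [h, d1, d2] <;> norm_num
    have ex : c.parX τ b - (c.x ⌊τ⌋ + Int.fract τ * c.dx ⌊τ⌋) =
        b * lerp (fun i => c.turn i * c.dx i - c.dy i) τ := by
      rw [parX]
      simp only [lerp, dx]
      push_cast
      ring
    have ey : c.parY τ b - (c.y ⌊τ⌋ + Int.fract τ * c.dy ⌊τ⌋) =
        b * lerp (fun i => c.turn i * c.dy i + c.dx i) τ := by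
      rw [parY]
      simp only [lerp, dy]
      push_cast
      ring
    rw [ex, ey]
    exact ⟨hbound _ fun i => (hd i).1, hbound _ fun i => (hd i).2⟩

end LatticeCurve
end

noncomputable section

open Set

/-! ### The class dual to a lattice curve -/

/-- The quotient `k / m`, rounded up. -/
def ceilDiv (m k : ℤ) : ℤ := -(-k / m)

theorem ceilDiv_add_mul {m : ℤ} (hm : 0 < m) (k p : ℤ) : ceilDiv m (k + m * p) = ceilDiv m k + p := by
  rw [ceilDiv, ceilDiv, show -(k + m * p) = -k + m * -p by ring,
    Int.add_mul_ediv_left _ _ hm.ne']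
  ring

theorem ceilDiv_mul_add_one {m : ℤ} (hm : 1 < m) (p : ℤ) : ceilDiv m (m * p + 1) = p + 1 := by
  rw [add_comm, ceilDiv_add_mul (by omega), ceilDiv,
    show -1 / m = -1 from by rw [Int.ediv_eq_iff_of_pos (by omega)]; constructor <;> linarith]
  ring

theorem ceilDiv_mul {m : ℤ} (hm : 0 < m) (p : ℤ) : ceilDiv m (m * p) = p := by
  have := ceilDiv_add_mul hm 0 p
  rw [zero_add] at this
  rw [this]
  simp [ceilDiv]

theorem ceilDiv_add_one {m k : ℤ} (hm : 0 < m) (h : ¬ m ∣ k) : ceilDiv m (k + 1) = ceilDiv m k := by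
  have h1 := Int.emod_nonneg (-k) hm.ne'
  have h2 := Int.emod_lt_of_pos (-k) hm
  have h3 := Int.emod_add_mul_ediv (-k) m
  have h4 : -k % m ≠ 0 := fun h5 => h ((dvd_neg).1 (Int.dvd_of_emod_eq_zero h5))
  have h5 : 1 ≤ -k % m := by omega
  have h6 := mul_comm m (-k / m)
  rw [ceilDiv, ceilDiv, neg_inj, Int.ediv_eq_iff_of_pos hm]
  constructor <;> linarith

/-- A continuous function that grows by `1` on each interval `[N p - 1 / 4, N p + 1 / 4]` and is
constant between them. -/
def ramp (N : ℕ) (x : ℝ) : ℝ := lerp (fun k => ceilDiv (2 * N) k) (2 * x + 1 / 2)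

theorem continuous_ramp (N : ℕ) : Continuous (ramp N) :=
  (continuous_lerp _).comp (by fun_prop)

theorem ramp_add {N : ℕ} (hN : 0 < N) (x : ℝ) (p : ℤ) : ramp N (x + N * p) = ramp N x + p := by
  have := lerp_shift (c := fun k => (ceilDiv (2 * N) k : ℝ)) (L := 2 * N * p) (k := p)
    (fun i => by rw [ceilDiv_add_mul (by omega)]; push_cast; ring) (2 * x + 1 / 2)
  rw [ramp, ramp, ← this]
  congr 1
  push_cast
  ring

theorem ramp_of_abs_le {N : ℕ} (hN : 0 < N) {x : ℝ} (hx : |x| ≤ 1 / 4) :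
    ramp N x = 2 * x + 1 / 2 := by
  have hx := abs_le.1 hx
  have := lerp_add (fun k => (ceilDiv (2 * N) k : ℝ)) 0 (s := 2 * x + 1 / 2) (by linarith)
    (by linarith)
  rw [Int.cast_zero, zero_add, zero_add] at this
  have h0 : ceilDiv (2 * N) 0 = 0 := by simp [ceilDiv]
  have h1 := ceilDiv_mul_add_one (m := 2 * N) (by omega) 0
  rw [mul_zero, zero_add] at h1
  rw [ramp, this, h0, h1]
  push_cast
  ring

theorem exists_ramp_eq_intCast {N : ℕ} (hN : 0 < N) {x : ℝ} (hx : ∀ p : ℤ, 1 / 4 < |x - N * p|) :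
    ∃ n : ℤ, ramp N x = n := by
  have hk : ¬ (2 * N : ℤ) ∣ ⌊2 * x + 1 / 2⌋ := by
    rintro ⟨p, hp⟩
    have h1 := Int.floor_le (2 * x + 1 / 2)
    have h2 := Int.lt_floor_add_one (2 * x + 1 / 2)
    rw [hp] at h1 h2
    push_cast at h1 h2
    refine absurd (hx p) (not_lt.2 (abs_le.2 ⟨?_, ?_⟩)) <;> linarith
  refine ⟨ceilDiv (2 * N) ⌊2 * x + 1 / 2⌋, ?_⟩
  rw [ramp, lerp, ceilDiv_add_one (by omega) hk]
  ring

theorem Circle.exp_sum {ι : Type*} (s : Finset ι) (f : ι → ℝ) :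
    Circle.exp (∑ i ∈ s, f i) = ∏ i ∈ s, Circle.exp (f i) := by
  classical
  induction s using Finset.induction_on with
  | empty => simp
  | insert a s ha ih => rw [Finset.sum_insert ha, Finset.prod_insert ha, Circle.exp_add, ih]

namespace LatticeCurve

variable {N : ℕ} (c : LatticeCurve N)

/-- The signed number of times the `i`-th step crosses the horizontal circle at height `1 / 2`. -/
def jump (i : ℤ) : ℤ := ceilDiv N (c.y (i + 1)) - ceilDiv N (c.y i)

theorem sum_jump : ∑ i ∈ Finset.range c.L, c.jump i = c.my := by
  have h := Finset.sum_range_sub (fun i : ℕ => ceilDiv N (c.y i)) c.L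
  have h1 := c.shift_y 0
  rw [zero_add] at h1
  have hN : (0 : ℤ) < N := by exact_mod_cast c.pos
  rw [h1, ceilDiv_add_mul hN, Nat.cast_zero, add_sub_cancel_left] at h
  rw [← h]
  exact Finset.sum_congr rfl fun i _ => by rw [jump]; push_cast; rfl

/-- A step crosses the circle at height `1 / 2` iff it is vertical with its midpoint at this height. -/
theorem jump_eq_or (i : ℤ) : c.jump i = 0 ∨
    (c.jump i = c.dy i ∧ c.dx i = 0 ∧ ∃ p : ℤ, 2 * c.y i + c.dy i = 1 + 2 * (N * p)) := by
  have hN : (0 : ℤ) < N := by exact_mod_cast c.pos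
  have hN1 : (1 : ℤ) < N := by have := c.four_le; omega
  have hy : c.y (i + 1) = c.y i + c.dy i := by rw [dy]; ring
  rcases c.dir i with ⟨d1, d2⟩ | ⟨d1, d2⟩ | ⟨d1, d2⟩ | ⟨d1, d2⟩
  · exact Or.inl (by rw [jump, hy, d2, add_zero, sub_self])
  · exact Or.inl (by rw [jump, hy, d2, add_zero, sub_self])
  · by_cases h : (N : ℤ) ∣ c.y i
    · obtain ⟨p, hp⟩ := h
      refine Or.inr ⟨?_, d1, p, by rw [d2, hp]; ring⟩
      rw [jump, hy, d2, hp, ceilDiv_mul_add_one hN1, ceilDiv_mul hN]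
      ring
    · exact Or.inl (by rw [jump, hy, d2, ceilDiv_add_one hN h, sub_self])
  · by_cases h : (N : ℤ) ∣ c.y (i + 1)
    · obtain ⟨p, hp⟩ := h
      have hy' : c.y i = N * p + 1 := by rw [← hp, hy, d2]; ring
      refine Or.inr ⟨?_, d1, p, by rw [d2, hy']; ring⟩
      rw [jump, hp, hy', d2, ceilDiv_mul_add_one hN1, ceilDiv_mul hN]
      ring
    · refine Or.inl ?_
      rw [jump, show c.y i = c.y (i + 1) + 1 by rw [hy, d2]; ring, ceilDiv_add_one hN h, sub_self]

theorem jump_eq {i p : ℤ} (h : 2 * c.y i + c.dy i = 1 + 2 * (N * p)) : c.jump i = c.dy i := by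
  have hN : (0 : ℤ) < N := by exact_mod_cast c.pos
  have hN1 : (1 : ℤ) < N := by have := c.four_le; omega
  have hy : c.y (i + 1) = c.y i + c.dy i := by rw [dy]; ring
  rcases c.dir i with ⟨d1, d2⟩ | ⟨d1, d2⟩ | ⟨d1, d2⟩ | ⟨d1, d2⟩ <;> rw [d2] at h ⊢
  · omega
  · omega
  · have : c.y i = N * p := by linarith
    rw [jump, hy, d2, this, ceilDiv_mul_add_one hN1, ceilDiv_mul hN]
    ring
  · have : c.y i = N * p + 1 := by linarith
    rw [jump, hy, d2, this, ceilDiv_mul_add_one hN1, add_neg_cancel_right, ceilDiv_mul hN]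
    ring

theorem abs_dy_mul_le (i : ℤ) {z : ℝ} (hz : |z| ≤ 1 / 4) : |-c.dy i * z| ≤ 1 / 4 := by
  rcases c.dir i with ⟨-, h⟩ | ⟨-, h⟩ | ⟨-, h⟩ | ⟨-, h⟩ <;> rw [h, abs_mul] <;> push_cast <;>
  norm_num at hz ⊢ <;> exact hz

/-- A point of the circle at height `1 / 2` close to a crossing of the curve lies in the annulus. -/
theorem exists_eq_of_near {i p : ℤ} {X : ℝ} (hj : c.jump i ≠ 0) (hX : |X - c.x i - N * p| ≤ 1 / 4) :
    ∃ s, 0 < s ∧ s < 1 ∧ ∃ k q : ℤ,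
      c.parX (i + s) (-c.dy i * (X - c.x i - N * p)) = X + N * k ∧
      c.parY (i + s) (-c.dy i * (X - c.x i - N * p)) = 1 / 2 + N * q := by
  obtain h | ⟨-, hdx, q, hq⟩ := c.jump_eq_or i
  · exact absurd h hj
  have hdy : c.dy i = 1 ∨ c.dy i = -1 := by
    rcases c.dir i with ⟨d1, d2⟩ | ⟨d1, d2⟩ | ⟨d1, d2⟩ | ⟨d1, d2⟩ <;> simp_all
  have hdy2 : (c.dy i : ℝ) * c.dy i = 1 := by rcases hdy with h | h <;> rw [h] <;> norm_num
  have hb := c.abs_dy_mul_le i hX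
  have t1 := abs_le.1 (c.abs_mul_turn_le i hb)
  have t2 := abs_le.1 (c.abs_mul_turn_le (i + 1) hb)
  obtain ⟨s, h0, h1, hs⟩ := c.exists_along_eq (i := i) (a := 1 / 2) hb (by linarith) (by linarith)
  have hq' : (2 * c.y i + c.dy i : ℝ) = 1 + 2 * (N * q) := by exact_mod_cast hq
  refine ⟨s, lt_of_le_of_ne h0 ?_, lt_of_le_of_ne h1 ?_, -p, q, ?_, ?_⟩
  · rintro rfl
    rw [along] at hs
    linarith
  · rintro rfl
    rw [along] at hs
    linarith
  · rw [parX_add _ _ h0 h1, ptX, hdx]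
    push_cast
    linear_combination (X - c.x i - N * p) * hdy2
  · rw [parY_add _ _ h0 h1, ptY, hdx, hs]
    push_cast
    linear_combination hq' / 2

/-- On the circle at height `1 / 2` the map dual to the annulus is the product over the crossings of
the curve with this circle. -/
theorem dual_apply {P : C(Circle × unitInterval, Torus)} (hP : ∀ (τ : ℝ) (t : unitInterval),
      P (Circle.exp (2 * Real.pi * τ / c.L), t) =
        gridPoint N (c.parX τ ((t - 1 / 2) / 2), c.parY τ ((t - 1 / 2) / 2)))
    {q : C(Torus, Circle)}
    (hq : ∀ a, q (P a) = Circle.exp (2 * Real.pi * a.2)) (hq' : ∀ x ∉ range P, q x = 1) (X : ℝ) :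
    q (gridPoint N (X, 1 / 2)) =
      ∏ i ∈ Finset.range c.L, Circle.exp (2 * Real.pi * (-c.jump i * ramp N (X - c.x i))) := by
  have hL := c.L_pos
  have hL0 : 0 < c.L := by exact_mod_cast hL
  have hfar : ∀ i : ℤ, ¬ (c.jump i ≠ 0 ∧ ∃ p : ℤ, |X - c.x i - N * p| ≤ 1 / 4) →
      Circle.exp (2 * Real.pi * (-c.jump i * ramp N (X - c.x i))) = 1 := by
    intro i hi
    by_cases hj : c.jump i = 0
    · rw [hj]; simp
    obtain ⟨n, hn⟩ := exists_ramp_eq_intCast (x := X - c.x i) c.pos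
      (fun p => not_le.1 fun h => hi ⟨hj, p, h⟩)
    rw [hn, Circle.exp_eq_one]
    exact ⟨-c.jump i * n, by push_cast; ring⟩
  by_cases hnear : ∃ i : ℕ, i < c.L ∧ c.jump i ≠ 0 ∧ ∃ p : ℤ, |X - c.x i - N * p| ≤ 1 / 4
  · obtain ⟨i, hi, hj, p, hp⟩ := hnear
    obtain ⟨s, h0, h1, k, l, hk, hl⟩ := c.exists_eq_of_near hj hp
    have hdy : c.jump i = c.dy i ∧ (c.dy i = 1 ∨ c.dy i = -1) := by
      obtain h | ⟨h, hdx, -⟩ := c.jump_eq_or i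
      · exact absurd h hj
      · refine ⟨h, ?_⟩
        rcases c.dir i with ⟨d1, d2⟩ | ⟨d1, d2⟩ | ⟨d1, d2⟩ | ⟨d1, d2⟩ <;> simp_all
    have hb := abs_le.1 (c.abs_dy_mul_le i hp)
    obtain ⟨t, ht⟩ : ∃ t : unitInterval, (t : ℝ) = 1 / 2 + 2 * (-c.dy i * (X - c.x i - N * p)) :=
      ⟨⟨_, by constructor <;> linarith⟩, rfl⟩
    have ht' : ((t : ℝ) - 1 / 2) / 2 = -c.dy i * (X - c.x i - N * p) := by rw [ht]; ring
    rw [Finset.prod_eq_single i]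
    · have hpt : gridPoint N (X, 1 / 2) =
          P (Circle.exp (2 * Real.pi * (((i : ℤ) : ℝ) + s) / c.L), t) := by
        rw [hP, gridPoint_eq_iff c.pos, ht', hk, hl]
        exact ⟨-k, -l, by push_cast; ring, by push_cast; ring⟩
      have hr : ramp N (X - c.x i) = 2 * (X - c.x i - N * p) + 1 / 2 + p := by
        rw [← ramp_of_abs_le c.pos hp, ← ramp_add c.pos, sub_add_cancel]
      rw [hpt, hq, hdy.1, hr, Circle.exp_eq_exp]
      simp only [ht]
      rcases hdy.2 with h | h <;> rw [h]
      · exact ⟨p + 1, by push_cast; ring⟩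
      · exact ⟨-p, by push_cast; ring⟩
    · intro j hjL hji
      refine hfar j fun ⟨hj', p', hp'⟩ => hji ?_
      obtain ⟨s', h0', h1', k', l', hk', hl'⟩ := c.exists_eq_of_near hj' hp'
      obtain ⟨-, n, hn⟩ := c.par_injective (p := k - k') (q := l - l') (c.abs_dy_mul_le i hp)
        (c.abs_dy_mul_le j hp')
        (by rw [hk, hk']; push_cast; ring) (by rw [hl, hl']; push_cast; ring)
      have hlt := Finset.mem_range.1 hjL
      have e1 : ((i : ℤ) : ℝ) < ((j + n * c.L : ℤ) : ℝ) + 1 := by push_cast at hn ⊢; linarith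
      have e2 : ((j + n * c.L : ℤ) : ℝ) < ((i : ℤ) : ℝ) + 1 := by push_cast at hn ⊢; linarith
      have e3 : (i : ℤ) = j + n * c.L := by
        have e1' : (i : ℤ) < j + n * c.L + 1 := by exact_mod_cast e1
        have e2' : (j + n * c.L : ℤ) < i + 1 := by exact_mod_cast e2
        omega
      have hn0 : n = 0 := by
        have a1 : n < 1 := by by_contra! h; nlinarith
        have a2 : -1 < n := by by_contra! h; nlinarith
        omega
      rw [hn0] at e3
      omega
    · exact fun h => absurd (Finset.mem_range.2 hi) h
  · rw [Finset.prod_eq_one fun i hi => hfar (i : ℕ) fun h => hnear ⟨i, Finset.mem_range.1 hi, h⟩]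
    refine hq' _ ?_
    rintro ⟨⟨u, t⟩, hut⟩
    obtain ⟨τ₀, hτ₀⟩ := (exp_two_pi_div_isOpenQuotientMap hL0).surjective u
    -- Choose the parameter in the fundamental interval.
    obtain ⟨τ, hτ0, hτL, hτ⟩ : ∃ τ : ℝ, 0 ≤ τ ∧ τ < c.L ∧
        Circle.exp (2 * Real.pi * τ / c.L) = u := by
      have hd : τ₀ = Int.fract (τ₀ / c.L) * c.L + c.L * ⌊τ₀ / c.L⌋ := by
        have := Int.floor_add_fract (τ₀ / c.L)
        field_simp at this
        linarith
      refine ⟨Int.fract (τ₀ / c.L) * c.L, mul_nonneg (Int.fract_nonneg _) hL.le,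
        by nlinarith [Int.fract_lt_one (τ₀ / c.L)], ?_⟩
      rw [← hτ₀]
      exact ((exp_two_pi_div_eq_iff hL0).2 ⟨_, hd⟩).symm
    have ht : |((t : ℝ) - 1 / 2) / 2| ≤ 1 / 4 := by
      have := t.2
      rw [abs_le]
      constructor <;> linarith [this.1, this.2]
    rw [← hτ, hP, gridPoint_eq_iff c.pos] at hut
    obtain ⟨p, l, h1, h2⟩ := hut
    have s0 := Int.fract_nonneg τ
    have s1 := (Int.fract_lt_one τ).le
    rw [← Int.floor_add_fract τ] at h1 h2
    simp only at h1 h2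
    rw [parX_add _ _ s0 s1, ptX] at h1
    rw [parY_add _ _ s0 s1, ptY] at h2
    have ha := c.along_bounds (i := ⌊τ⌋) s0 s1 ht
    have hb := abs_le.1 ht
    generalize c.along ⌊τ⌋ (Int.fract τ) _ = a at h1 h2 ha
    generalize ((t : ℝ) - 1 / 2) / 2 = b at h1 h2 hb
    obtain ⟨i, hi⟩ := Int.eq_ofNat_of_zero_le (Int.floor_nonneg.2 hτ0)
    rw [hi] at h1 h2
    have hiL : i < c.L := by
      have := Int.floor_le τ
      rw [hi] at this
      exact_mod_cast lt_of_le_of_lt this hτL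
    -- The height of a point of a horizontal piece cannot be a half-integer.
    have key : c.dx i = 0 ∧ 2 * c.y i + c.dy i = 1 + 2 * (N * l) := by
      have hz : ∀ m : ℤ, c.y i = m + N * l → (c.y i : ℝ) = m + N * l := fun m h => by rw [h]; push_cast; ring
      generalize hm : c.y i - N * l = m
      have hm' := hz m (by linarith)
      rw [hm'] at h2
      rcases c.dir i with ⟨d1, d2⟩ | ⟨d1, d2⟩ | ⟨d1, d2⟩ | ⟨d1, d2⟩ <;> rw [d1, d2] at h2 <;>
      push_cast at h2
      · have a1 : (m : ℝ) < ((1 : ℤ) : ℝ) := by push_cast; linarith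
        have a2 : ((0 : ℤ) : ℝ) < m := by push_cast; linarith
        have := Int.cast_lt.1 a1
        have := Int.cast_lt.1 a2
        omega
      · have a1 : (m : ℝ) < ((1 : ℤ) : ℝ) := by push_cast; linarith
        have a2 : ((0 : ℤ) : ℝ) < m := by push_cast; linarith
        have := Int.cast_lt.1 a1
        have := Int.cast_lt.1 a2
        omega
      · have a1 : (m : ℝ) < ((1 : ℤ) : ℝ) := by push_cast; linarith
        have a2 : ((-1 : ℤ) : ℝ) < m := by push_cast; linarith
        have := Int.cast_lt.1 a1
        have := Int.cast_lt.1 a2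
        refine ⟨d1, ?_⟩
        rw [d2]
        linarith [show m = 0 by omega]
      · have a1 : (m : ℝ) < ((2 : ℤ) : ℝ) := by push_cast; linarith
        have a2 : ((0 : ℤ) : ℝ) < m := by push_cast; linarith
        have := Int.cast_lt.1 a1
        have := Int.cast_lt.1 a2
        refine ⟨d1, ?_⟩
        rw [d2]
        linarith [show m = 1 by omega]
    refine hnear ⟨i, hiL, ?_, -p, ?_⟩
    · rw [c.jump_eq key.2]
      intro h0
      have := key.2
      omega
    · rw [key.1] at h1
      push_cast at h1 ⊢
      have e : X - c.x i - N * -p = -(b * c.dy i) := by linarith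
      rw [e, abs_neg]
      rcases c.dir i with ⟨-, h⟩ | ⟨-, h⟩ | ⟨-, h⟩ | ⟨-, h⟩ <;> rw [h] <;> push_cast <;>
      rw [abs_le] <;> constructor <;> linarith [hb.1, hb.2]

/-- The first component of the class dual to the annulus of a lattice curve is given by the number
of its turns in the direction of the second coordinate. -/
theorem class_dual {P : C(Circle × unitInterval, Torus)} (hP : ∀ (τ : ℝ) (t : unitInterval),
      P (Circle.exp (2 * Real.pi * τ / c.L), t) =
        gridPoint N (c.parX τ ((t - 1 / 2) / 2), c.parY τ ((t - 1 / 2) / 2)))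
    {q : C(Torus, Circle)}
    (hq : ∀ a, q (P a) = Circle.exp (2 * Real.pi * a.2)) (hq' : ∀ x ∉ range P, q x = 1) {k l : ℤ}
    (hk : HasClass q k l) : k = -c.my := by
  have hN := c.pos
  have hN' : (N : ℝ) ≠ 0 := by positivity
  rw [← hk.degree_loopX (Circle.exp (2 * Real.pi * (1 / 2) / N))]
  refine circleDegree_eq (θ := fun t => ∑ i ∈ Finset.range c.L,
    2 * Real.pi * (-c.jump i * ramp N (N * t / (2 * Real.pi) - c.x i))) ?_ ?_ ?_
  · have := continuous_ramp N
    fun_prop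
  · intro t
    rw [Circle.exp_sum, ← c.dual_apply hP hq hq']
    rw [gridPoint, show 2 * Real.pi * (N * t / (2 * Real.pi)) / N = t by field_simp]
    rfl
  · intro t
    rw [← c.sum_jump, ← Finset.sum_neg_distrib, Int.cast_sum, Finset.mul_sum,
      ← Finset.sum_add_distrib]
    refine Finset.sum_congr rfl fun i _ => ?_
    have : N * (t + 2 * Real.pi) / (2 * Real.pi) - c.x i =
        N * t / (2 * Real.pi) - c.x i + N * (1 : ℤ) := by
      field_simp
      push_cast
      ring
    rw [this, ramp_add hN]
    push_cast
    ring

/-- The Dehn twist along a lattice curve that closes up in the second direction only. -/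
theorem exists_twist (hmx : c.mx = 0) (hmy : c.my ≠ 0) : ∃ g : Torus ≃ₜ Torus,
    HasMatrix (g : C(Torus, Torus)) !![1, 0; -1, 1] ∧
    ∀ p, (∀ τ b, |b| ≤ 1 / 4 → p ≠ gridPoint N (c.parX τ b, c.parY τ b)) → g p = p := by
  have hL := c.L_pos
  have hL0 : 0 < c.L := by exact_mod_cast hL
  have hN' : (N : ℝ) ≠ 0 := by have := c.pos; positivity
  obtain ⟨P, hP⟩ := c.exists_annulus
  have hpar : ∀ u, ∃ τ : ℝ, Circle.exp (2 * Real.pi * τ / c.L) = u :=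
    (exp_two_pi_div_isOpenQuotientMap hL0).surjective
  have hoff : ∀ t : unitInterval, |((t : ℝ) - 1 / 2) / 2| ≤ 1 / 4 := fun t => by
    have := t.2
    rw [abs_le]
    constructor <;> linarith [this.1, this.2]
  have hinj : Function.Injective P := by
    rintro ⟨u, t⟩ ⟨u', t'⟩ h
    obtain ⟨τ, rfl⟩ := hpar u
    obtain ⟨τ', rfl⟩ := hpar u'
    rw [hP, hP, gridPoint_eq_iff c.pos] at h
    obtain ⟨p, r, h1, h2⟩ := h
    obtain ⟨h3, n, hn⟩ := c.par_injective (hoff t) (hoff t') h1 h2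
    rw [Prod.mk.injEq, exp_two_pi_div_eq_iff hL0]
    exact ⟨⟨n, by rw [hn]; ring⟩, Subtype.ext (by linarith)⟩
  have hopen : IsOpen (P '' {a | a.2 ∈ Ioo (0 : unitInterval) 1}) := by
    have : P '' {a | a.2 ∈ Ioo (0 : unitInterval) 1} = gridPoint N '' c.nbhd := by
      ext p
      constructor
      · rintro ⟨⟨u, t⟩, ht, rfl⟩
        obtain ⟨τ, rfl⟩ := hpar u
        have h0 : (0 : ℝ) < t := ht.1
        have h1 : (t : ℝ) < 1 := ht.2
        refine ⟨_, c.mem_nbhd_iff.2 ⟨τ, (t - 1 / 2) / 2, ?_, rfl⟩, (hP τ t).symm⟩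
        rw [abs_lt]
        constructor <;> linarith
      · rintro ⟨z, hz, rfl⟩
        obtain ⟨τ, b, hb, rfl⟩ := c.mem_nbhd_iff.1 hz
        rw [abs_lt] at hb
        have h0 : (0 : ℝ) < 1 / 2 + 2 * b := by linarith [hb.1]
        have h1 : 1 / 2 + 2 * b < 1 := by linarith [hb.2]
        refine ⟨(Circle.exp (2 * Real.pi * τ / c.L), ⟨1 / 2 + 2 * b, h0.le, h1.le⟩), ⟨h0, h1⟩, ?_⟩
        rw [hP]
        congr 2 <;> congr 1 <;> ring
    rw [this]
    exact (gridPoint_isOpenQuotientMap c.pos).isOpenMap _ c.isOpen_nbhd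
  obtain ⟨g, q, hg, hq, hq', hf⟩ := _root_.exists_twist hinj hopen
  obtain ⟨k, l, hkl⟩ := exists_hasClass q
  set half : unitInterval := ⟨1 / 2, by norm_num, by norm_num⟩ with hhalf
  set core : C(Circle, Torus) :=
    P.comp ((ContinuousMap.id _).prodMk (ContinuousMap.const _ half)) with hcore
  have hcore' : ∀ t, core (Circle.exp t) =
      gridPoint N (lerp (fun i => c.x i) (c.L * t / (2 * Real.pi)),
        lerp (fun i => c.y i) (c.L * t / (2 * Real.pi))) := by
    intro t
    have := hP (c.L * t / (2 * Real.pi)) half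
    rw [show 2 * Real.pi * (c.L * t / (2 * Real.pi)) / c.L = t by field_simp] at this
    change P (Circle.exp t, half) = _
    rw [this, show ((half : ℝ) - 1 / 2) / 2 = 0 by simp [hhalf], parX, parY, zero_mul, zero_mul,
      add_zero, add_zero]
  have hshift : ∀ t, c.L * (t + 2 * Real.pi) / (2 * Real.pi) =
      c.L * t / (2 * Real.pi) + ((c.L : ℤ) : ℝ) := fun t => by
    field_simp
    push_cast
    ring
  have hdx : circleDegree (ContinuousMap.fst.comp core) = 0 := by
    refine circleDegree_eq (θ := fun t =>
      2 * Real.pi * lerp (fun i => c.x i) (c.L * t / (2 * Real.pi)) / N) ?_ (fun t => ?_) fun t => ?_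
    · have := continuous_lerp fun i => (c.x i : ℝ)
      fun_prop
    · rw [ContinuousMap.comp_apply, hcore']
      rfl
    · rw [hshift, lerp_shift (k := 0) fun i => by rw [c.shift_x, hmx]; push_cast; ring]
      simp
  have hdy : circleDegree (ContinuousMap.snd.comp core) = c.my := by
    refine circleDegree_eq (θ := fun t =>
      2 * Real.pi * lerp (fun i => c.y i) (c.L * t / (2 * Real.pi)) / N) ?_ (fun t => ?_) fun t => ?_
    · have := continuous_lerp fun i => (c.y i : ℝ)
      fun_prop
    · rw [ContinuousMap.comp_apply, hcore']
      rfl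
    · rw [hshift, lerp_shift (k := N * c.my) fun i => by rw [c.shift_y]; push_cast; ring]
      field_simp
  have hk : k = -c.my := c.class_dual hP hq hq' hkl
  obtain rfl : l = 0 := by
    have h := hkl.degree_comp core
    have hconst : q.comp core = ContinuousMap.const _ (Circle.exp (2 * Real.pi * half)) := by
      ext u
      exact congrArg _ (hq (u, half))
    rw [hconst, circleDegree_const, hdx, hdy, mul_zero, zero_add] at h
    exact (mul_eq_zero.1 h.symm).resolve_right hmy
  have hkm : k * c.my = -1 := by
    rcases hkl.eq_of_dual hq hq' with h | h | h
    · exact absurd (by omega) hmy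
    · rw [show c.my = -1 by omega, h]; ring
    · rw [show c.my = 1 by omega, h]; ring
  refine ⟨g, ⟨?_, ?_⟩, fun p hp => hg p ?_⟩
  · obtain ⟨v, hv⟩ := hf ContinuousMap.fst half
    refine ⟨v, fun p => (hv p).trans ?_⟩
    rw [← hcore, hdx]
    simp
  · obtain ⟨v, hv⟩ := hf ContinuousMap.snd half
    obtain ⟨w, hw⟩ := hkl
    refine ⟨v + c.my • w, fun p => (hv p).trans ?_⟩
    rw [← hcore, hdy, hw, mul_zpow, mul_zpow, ← zpow_mul, hkm, ContinuousMap.add_apply,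
      Circle.exp_add, ContinuousMap.smul_apply, zsmul_eq_mul, mul_comm (c.my : ℝ),
      Circle.exp_mul_int]
    simp only [ContinuousMap.snd_apply, zpow_zero, one_zpow, mul_one, Matrix.of_apply,
      Matrix.cons_val', Matrix.cons_val_zero, Matrix.cons_val_one, Matrix.cons_val_fin_one, zpow_one]
    rw [mul_comm (p.1 ^ _) p.2]
    simp only [mul_assoc, mul_comm, mul_left_comm]
  · rintro ⟨⟨u, t⟩, rfl⟩
    obtain ⟨τ, rfl⟩ := hpar u
    exact hp τ _ (hoff t) (hP τ t)

end LatticeCurve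
end

noncomputable section

open Set

/-! ### Lattice curves on which a height function avoids the integers -/

/-- A continuous function `r` on the plane that grows by `1` under the period `(N, 0)`, is invariant
under the period `(0, N)`, varies slowly, and differs from `x / N` by a bounded amount. -/
structure IsHeight (N : ℕ) (r : ℝ × ℝ → ℝ) : Prop where
  four_le : 4 ≤ N
  continuous : Continuous r
  shift_x : ∀ x y, r (x + N, y) = r (x, y) + 1
  shift_y : ∀ x y, r (x, y + N) = r (x, y)
  slow : ∀ z w : ℝ × ℝ, |z.1 - w.1| ≤ 2 → |z.2 - w.2| ≤ 2 → |r z - r w| < 1 / 8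
  bounded : ∃ C, ∀ z, |r z - z.1 / N| ≤ C

/-- The lattice points at which `r` is far from the integers `0` and `1`, as a subset of `ℤ²`. -/
def middle (r : ℝ × ℝ → ℝ) : Set (ℤ × ℤ) := {v | r (v.1, v.2) ∈ Ioo (1 / 4 : ℝ) (3 / 4)}

/-- The grid graph on the lattice points of the middle region. -/
def middleGraph (r : ℝ × ℝ → ℝ) : SimpleGraph (ℤ × ℤ) where
  Adj v w := v ∈ middle r ∧ w ∈ middle r ∧ (w.1 - v.1) ^ 2 + (w.2 - v.2) ^ 2 = 1
  symm := ⟨fun v w ⟨h1, h2, h3⟩ => ⟨h2, h1, by linear_combination h3⟩⟩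
  loopless := ⟨fun v ⟨_, _, h⟩ => by simp at h⟩

namespace IsHeight

variable {N : ℕ} {r : ℝ × ℝ → ℝ}

theorem pos (hr : IsHeight N r) : 0 < N := lt_of_lt_of_le (by norm_num) hr.four_le

theorem shift (hr : IsHeight N r) (x y : ℝ) (p q : ℤ) : r (x + N * p, y + N * q) = r (x, y) + p := by
  have h1 : ∀ x y, r (x + N * p, y) = r (x, y) + p := by
    intro x y
    induction p using Int.induction_on with
    | zero => simp
    | succ k ih =>
      have := hr.shift_x (x + N * (k : ℤ)) y
      push_cast at this ih ⊢
      rw [show x + N * ((k : ℝ) + 1) = x + N * k + N by ring, this, ih]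
      ring
    | pred k ih =>
      have := hr.shift_x (x + N * ((-(k : ℤ) - 1 : ℤ) : ℝ)) y
      push_cast at this ih ⊢
      rw [show x + N * (-(k : ℝ) - 1) + N = x + N * -k by ring, ih] at this
      linarith
  have h2 : r (x, y + N * q) = r (x, y) := by
    have hp : Function.Periodic (fun y => r (x, y)) N := fun y => hr.shift_y x y
    have := hp.int_mul q y
    rw [mul_comm]
    exact this
  rw [h1, h2]

/-- Lattice points of the middle region that are congruent modulo `N` differ by a period in the
second direction. -/
theorem eq_add_of_dvd (hr : IsHeight N r) {v w : ℤ × ℤ} (hv : v ∈ middle r) (hw : w ∈ middle r)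
    (h1 : (N : ℤ) ∣ w.1 - v.1) (h2 : (N : ℤ) ∣ w.2 - v.2) : ∃ m : ℤ, w = v + (0, m * N) := by
  obtain ⟨p, hp⟩ := h1
  obtain ⟨q, hq⟩ := h2
  have h3 := hr.shift v.1 v.2 p q
  have e1 : (v.1 + N * p : ℝ) = w.1 := by
    have : v.1 + N * p = w.1 := by linarith
    exact_mod_cast this
  have e2 : (v.2 + N * q : ℝ) = w.2 := by
    have : v.2 + N * q = w.2 := by linarith
    exact_mod_cast this
  rw [e1, e2] at h3
  have a1 : (p : ℝ) < ((1 : ℤ) : ℝ) := by push_cast; linarith [hv.1, hw.2]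
  have a2 : ((-1 : ℤ) : ℝ) < p := by push_cast; linarith [hv.2, hw.1]
  have b1 := Int.cast_lt.1 a1
  have b2 := Int.cast_lt.1 a2
  obtain rfl : p = 0 := by omega
  exact ⟨q, Prod.ext (by simp; linarith) (by simp; linarith)⟩

theorem mem_middle_of_reachable {v w : ℤ × ℤ} (h : (middleGraph r).Reachable v w)
    (hv : v ∈ middle r) : w ∈ middle r := by
  obtain ⟨p⟩ := h
  induction p with
  | nil => exact hv
  | cons h _ ih => exact ih h.2.1

theorem abs_sub_le_length {v w : ℤ × ℤ} (p : (middleGraph r).Walk v w) :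
    |w.2 - v.2| ≤ p.length := by
  induction p with
  | nil => simp
  | @cons u v w h p ih =>
    have h1 : |v.2 - u.2| ≤ 1 := by
      have := h.2.2
      rw [← sq_le_one_iff_abs_le_one]
      nlinarith [sq_nonneg (v.1 - u.1)]
    rw [SimpleGraph.Walk.length_cons]
    have h2 := abs_sub_le w.2 v.2 u.2
    push_cast
    linarith

/-- If no two vertices in a connected component of the middle region differ by a period, then the
components have bounded extent. -/
theorem exists_bound (hr : IsHeight N r)
    (hno : ∀ v ∈ middle r, ∀ m : ℤ, (middleGraph r).Reachable v (v + (0, m * N)) → m = 0) :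
    ∃ B : ℤ, ∀ v ∈ middle r, ∀ w, (middleGraph r).Reachable v w → |w.2 - v.2| ≤ B := by
  have hN : (0 : ℝ) < N := by exact_mod_cast hr.pos
  have hN' : (0 : ℤ) < N := by exact_mod_cast hr.pos
  obtain ⟨C, hC⟩ := hr.bounded
  obtain ⟨I, hI⟩ := exists_nat_ge (N * (C + 1))
  have hx : ∀ v ∈ middle r, -(I : ℤ) ≤ v.1 ∧ v.1 ≤ I := by
    intro v hv
    have h1 := abs_le.1 (hC (v.1, v.2))
    have h2 : (v.1 : ℝ) / N ≤ C + 1 := by linarith [hv.2, h1.1]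
    have h3 : -(C + 1) ≤ (v.1 : ℝ) / N := by linarith [hv.1, h1.2]
    rw [div_le_iff₀ hN] at h2
    rw [le_div_iff₀ hN] at h3
    have h4 : (v.1 : ℝ) ≤ (I : ℤ) := by push_cast; linarith
    have h5 : ((-I : ℤ) : ℝ) ≤ v.1 := by push_cast; linarith
    exact ⟨Int.cast_le.1 h5, Int.cast_le.1 h4⟩
  set S : Finset (ℤ × ℤ) := Finset.Icc (-(I : ℤ)) I ×ˢ Finset.Ico (0 : ℤ) N
  refine ⟨S.card, fun v hv w hw => ?_⟩
  obtain ⟨p, hp⟩ := hw.exists_isPath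
  refine (abs_sub_le_length p).trans ?_
  have hreach : ∀ u ∈ p.support, (middleGraph r).Reachable v u := fun u hu => ⟨p.takeUntil u hu⟩
  have hcard : p.support.toFinset.card ≤ S.card := by
    refine Finset.card_le_card_of_injOn (fun u => (u.1, u.2 % N)) ?_ ?_
    · intro u hu
      have hu' := mem_middle_of_reachable (hreach u (by simpa using hu)) hv
      simp only [S, Finset.coe_product, Finset.coe_Icc, Finset.coe_Ico]
      exact ⟨hx u hu', Int.emod_nonneg _ hN'.ne', Int.emod_lt_of_pos _ hN'⟩
    · intro u hu u' hu' h
      have hu := hreach u (by simpa using hu)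
      have hu' := hreach u' (by simpa using hu')
      have huv := mem_middle_of_reachable hu hv
      have hu'v := mem_middle_of_reachable hu' hv
      obtain ⟨e1, e2⟩ : u.1 = u'.1 ∧ u.2 % N = u'.2 % N := Prod.mk.inj h
      obtain ⟨m, hm⟩ := hr.eq_add_of_dvd huv hu'v (by rw [e1]; simp)
        (Int.ModEq.dvd e2)
      have := hno u huv m (hm ▸ hu.symm.trans hu')
      rw [hm, this]
      ext <;> simp
  rw [List.toFinset_card_of_nodup hp.support_nodup, SimpleGraph.Walk.length_support] at hcard
  have : (p.length : ℤ) + 1 ≤ S.card := by exact_mod_cast hcard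
  linarith

/-- The integer point below a point of the plane. -/
def floorPoint (z : ℝ × ℝ) : ℤ × ℤ := (⌊z.1⌋, ⌊z.2⌋)

theorem mem_middle_of_near (hr : IsHeight N r) {z : ℝ × ℝ} (hz : r z = 1 / 2) {v : ℤ × ℤ}
    (h1 : |(v.1 : ℝ) - z.1| ≤ 2) (h2 : |(v.2 : ℝ) - z.2| ≤ 2) : v ∈ middle r := by
  have := abs_lt.1 (hr.slow (v.1, v.2) z h1 h2)
  rw [hz] at this
  constructor <;> linarith [this.1, this.2]

theorem abs_floor_sub_le (x y : ℝ) (h : |y - x| < 1) : |⌊y⌋ - ⌊x⌋| ≤ 1 ∧ |(⌊y⌋ : ℝ) - x| ≤ 2 := by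
  have h := abs_lt.1 h
  have h1 := Int.floor_le x
  have h2 := Int.lt_floor_add_one x
  have h3 := Int.floor_le y
  have h4 := Int.lt_floor_add_one y
  have h5 : (⌊y⌋ : ℝ) < ((⌊x⌋ + 2 : ℤ) : ℝ) := by push_cast; linarith
  have h6 : (⌊x⌋ : ℝ) < ((⌊y⌋ + 2 : ℤ) : ℝ) := by push_cast; linarith
  have h5 := Int.cast_lt.1 h5
  have h6 := Int.cast_lt.1 h6
  constructor
  · rw [abs_le]; omega
  · rw [abs_le]; constructor <;> linarith

theorem reachable_floorPoint (hr : IsHeight N r) {z w : ℝ × ℝ} (hz : r z = 1 / 2)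
    (h1 : |w.1 - z.1| < 1) (h2 : |w.2 - z.2| < 1) :
    (middleGraph r).Reachable (floorPoint z) (floorPoint w) := by
  have hz1 := (abs_floor_sub_le z.1 z.1 (by simp)).2
  have hz2 := (abs_floor_sub_le z.2 z.2 (by simp)).2
  obtain ⟨a1, b1⟩ := abs_floor_sub_le z.1 w.1 h1
  obtain ⟨a2, b2⟩ := abs_floor_sub_le z.2 w.2 h2
  have hsq : ∀ k : ℤ, |k| ≤ 1 → k = 0 ∨ k ^ 2 = 1 := by
    intro k hk
    rw [abs_le] at hk
    obtain ⟨h1, h2⟩ := hk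
    interval_cases k <;> simp
  have m1 : ((⌊z.1⌋, ⌊z.2⌋) : ℤ × ℤ) ∈ middle r := hr.mem_middle_of_near hz hz1 hz2
  have m2 : ((⌊w.1⌋, ⌊z.2⌋) : ℤ × ℤ) ∈ middle r := hr.mem_middle_of_near hz b1 hz2
  have m3 : ((⌊w.1⌋, ⌊w.2⌋) : ℤ × ℤ) ∈ middle r := hr.mem_middle_of_near hz b1 b2
  have s1 : (middleGraph r).Reachable (⌊z.1⌋, ⌊z.2⌋) (⌊w.1⌋, ⌊z.2⌋) := by
    rcases hsq _ a1 with h | h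
    · rw [sub_eq_zero.1 h]
    · exact SimpleGraph.Adj.reachable ⟨m1, m2, by simpa using h⟩
  have s2 : (middleGraph r).Reachable (⌊w.1⌋, ⌊z.2⌋) (⌊w.1⌋, ⌊w.2⌋) := by
    rcases hsq _ a2 with h | h
    · rw [sub_eq_zero.1 h]
    · exact SimpleGraph.Adj.reachable ⟨m2, m3, by simpa using h⟩
  exact s1.trans s2

/-- Some component of the middle region contains two vertices that differ by a non-trivial period.
Otherwise the components had bounded extent, and pushing the second coordinate to an integer that
depends only on the component would move the plane by a bounded distance off a point. -/
theorem exists_reachable (hr : IsHeight N r) : ∃ v ∈ middle r, ∃ m : ℤ, m ≠ 0 ∧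
    (middleGraph r).Reachable v (v + (0, m * N)) := by
  by_contra! hcon
  obtain ⟨B, hB⟩ := hr.exists_bound fun v hv m h => by_contra fun hm => hcon v hv m hm h
  have hN : (0 : ℝ) < N := by exact_mod_cast hr.pos
  -- The second coordinate of a representative of the component of a point.
  let n : ℝ × ℝ → ℤ := fun z => ((middleGraph r).connectedComponentMk (floorPoint z)).out.2
  have hfloor : ∀ z : ℝ × ℝ, r z = 1 / 2 → floorPoint z ∈ middle r := fun z hz =>
    hr.mem_middle_of_near hz (abs_floor_sub_le z.1 z.1 (by simp)).2
      (abs_floor_sub_le z.2 z.2 (by simp)).2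
  have hn : ∀ z : ℝ × ℝ, r z = 1 / 2 → |z.2 - n z| ≤ B + 1 := by
    intro z hz
    have h1 : (middleGraph r).Reachable (floorPoint z)
        ((middleGraph r).connectedComponentMk (floorPoint z)).out :=
      (SimpleGraph.ConnectedComponent.exact (Quot.out_eq _)).symm
    have h2 : |((n z - ⌊z.2⌋ : ℤ) : ℝ)| ≤ B := by
      rw [← Int.cast_abs]
      exact_mod_cast hB _ (hfloor z hz) _ h1
    push_cast at h2
    rw [abs_le] at h2 ⊢
    have h3 := Int.floor_le z.2
    have h4 := Int.lt_floor_add_one z.2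
    constructor <;> linarith [h2.1, h2.2]
  let Z : Set (ℝ × ℝ) := {z | r z = 1 / 2}
  have hZ : IsClosed Z := isClosed_eq hr.continuous continuous_const
  have hlc : Continuous fun z : Z => (n z : ℝ) := by
    refine (IsLocallyConstant.iff_eventually_eq _).2 (fun z => ?_) |>.continuous
    have hnear : ∀ᶠ w : Z in nhds z, |w.1.1 - z.1.1| < 1 ∧ |w.1.2 - z.1.2| < 1 := by
      have c1 : Continuous fun w : Z => |w.1.1 - z.1.1| := by fun_prop
      have c2 : Continuous fun w : Z => |w.1.2 - z.1.2| := by fun_prop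
      exact (c1.continuousAt.eventually_lt continuousAt_const (by simp)).and
        (c2.continuousAt.eventually_lt continuousAt_const (by simp))
    filter_upwards [hnear] with w hw
    have := hr.reachable_floorPoint z.2 hw.1 hw.2
    simp only [n]
    rw [SimpleGraph.ConnectedComponent.eq.2 this]
  let η : C(Z, ℝ) := ⟨fun z => z.1.2 - n z, by fun_prop⟩
  obtain ⟨g, hg, hgη⟩ := η.exists_restrict_eq_forall_mem_of_closed
    (t := Icc (-|(B + 1 : ℝ)|) |(B + 1 : ℝ)|)
    (fun z => abs_le.1 ((hn z z.2).trans (le_abs_self _)))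
    ⟨0, neg_nonpos.2 (abs_nonneg _), abs_nonneg _⟩ hZ
  obtain ⟨C, hC⟩ := hr.bounded
  have hrc := hr.continuous
  let Φ : ℂ → ℂ := fun z => ⟨N * r (z.re, z.im), z.im - g (z.re, z.im)⟩
  have hΦ : Continuous Φ := by
    have : Φ = fun z => ((N * r (z.re, z.im) : ℝ) : ℂ) +
        ((z.im - g (z.re, z.im) : ℝ) : ℂ) * Complex.I := by
      funext z
      apply Complex.ext <;> simp [Φ]
    rw [this]
    fun_prop
  have hbd : ∀ z, ‖Φ z - z‖ ≤ N * C + |(B + 1 : ℝ)| := by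
    intro z
    refine (Complex.norm_le_abs_re_add_abs_im _).trans (add_le_add ?_ ?_)
    · have := hC (z.re, z.im)
      have e : (Φ z - z).re = N * (r (z.re, z.im) - z.re / N) := by
        simp only [Φ, Complex.sub_re]
        field_simp
      rw [e, abs_mul, abs_of_pos hN]
      exact mul_le_mul_of_nonneg_left this hN.le
    · have e : (Φ z - z).im = -g (z.re, z.im) := by simp [Φ]
      rw [e, abs_neg]
      exact abs_le.2 (hg _)
  obtain ⟨z, hz⟩ := surjective_of_bounded_distance hΦ hbd ⟨N * (1 / 2), 1 / 2⟩
  have hz1 : r (z.re, z.im) = 1 / 2 := mul_left_cancel₀ hN.ne' (congrArg Complex.re hz)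
  have hz2 : z.im - g (z.re, z.im) = 1 / 2 := congrArg Complex.im hz
  have hz3 : g (z.re, z.im) = z.im - n (z.re, z.im) :=
    ContinuousMap.congr_fun hgη ⟨(z.re, z.im), hz1⟩
  rw [hz3, sub_sub_cancel] at hz2
  have h2 : ((2 * n (z.re, z.im) : ℤ) : ℝ) = ((1 : ℤ) : ℝ) := by push_cast; linarith
  have := Int.cast_injective h2
  omega

/-- A shortest path of the middle region joining two vertices that differ by a period projects to a
simple closed curve. -/
theorem exists_latticeCurve (hr : IsHeight N r) : ∃ c : LatticeCurve N, c.mx = 0 ∧ c.my ≠ 0 ∧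
    ∀ i, r (c.x i, c.y i) ∈ Ioo (1 / 4 : ℝ) (3 / 4) := by
  classical
  have hN : (0 : ℤ) < N := by exact_mod_cast hr.pos
  have hex : ∃ L : ℕ, ∃ v ∈ middle r, ∃ m : ℤ, m ≠ 0 ∧
      ∃ p : (middleGraph r).Walk v (v + (0, m * N)), p.length = L := by
    obtain ⟨v, hv, m, hm, ⟨p⟩⟩ := hr.exists_reachable
    exact ⟨p.length, v, hv, m, hm, p, rfl⟩
  obtain ⟨v, hv, m, hm, p₀, hp₀⟩ := Nat.find_spec hex
  have hmin : ∀ v ∈ middle r, ∀ m : ℤ, m ≠ 0 → ∀ p : (middleGraph r).Walk v (v + (0, m * N)),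
      Nat.find hex ≤ p.length := fun v hv m hm p => Nat.find_min' hex ⟨v, hv, m, hm, p, rfl⟩
  set L := Nat.find hex with hL
  obtain ⟨p, hp, hpL⟩ : ∃ p : (middleGraph r).Walk v (v + (0, m * N)), p.IsPath ∧ p.length = L :=
    ⟨p₀.bypass, p₀.bypass_isPath,
      le_antisymm (hp₀ ▸ p₀.length_bypass_le_length) (hmin v hv m hm _)⟩
  have hNL : (N : ℤ) ≤ L := by
    have h := abs_sub_le_length p
    rw [hpL] at h
    simp only [Prod.snd_add, add_sub_cancel_left, abs_mul, Nat.abs_cast] at h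
    have := Int.one_le_abs hm
    nlinarith
  have h4 : (4 : ℤ) ≤ N := by exact_mod_cast hr.four_le
  have hL0 : (0 : ℤ) < L := by omega
  have hmem : ∀ a, p.getVert a ∈ middle r := fun a =>
    mem_middle_of_reachable ⟨p.take a⟩ hv
  -- The periodic continuation of the path.
  let x : ℤ → ℤ := fun i => (p.getVert (i % L).toNat).1
  let y : ℤ → ℤ := fun i => (p.getVert (i % L).toNat).2 + i / L * (m * N)
  have hlt : ∀ (k : ℤ) (a : ℕ), a < L → x (L * k + a) = (p.getVert a).1 ∧
      y (L * k + a) = (p.getVert a).2 + k * (m * N) := by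
    intro k a ha
    have e1 : (L * k + a : ℤ) % L = a := by
      rw [Int.mul_add_emod_self_left]
      exact Int.emod_eq_of_lt (by omega) (by omega)
    have e2 : (L * k + a : ℤ) / L = k := by
      rw [Int.mul_add_ediv_left _ _ hL0.ne', Int.ediv_eq_zero_of_lt (by omega) (by omega), add_zero]
    simp only [x, y, e1, e2, Int.toNat_natCast, and_self]
  have hle : ∀ (k : ℤ) (a : ℕ), a ≤ L → x (L * k + a) = (p.getVert a).1 ∧
      y (L * k + a) = (p.getVert a).2 + k * (m * N) := by
    intro k a ha
    rcases ha.lt_or_eq with h | rfl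
    · exact hlt k a h
    · have h := hlt (k + 1) 0 (by omega)
      rw [show (L * (k + 1) + (0 : ℕ) : ℤ) = L * k + L by push_cast; ring,
        SimpleGraph.Walk.getVert_zero] at h
      have e : p.getVert L = v + (0, m * N) := by rw [← hpL, SimpleGraph.Walk.getVert_length]
      rw [h.1, h.2, e]
      constructor
      · simp
      · simp; ring
  have hdecomp : ∀ i : ℤ, ∃ (k : ℤ) (a : ℕ), a < L ∧ i = L * k + a := by
    intro i
    have h1 := Int.emod_nonneg i hL0.ne'
    have h2 := Int.emod_lt_of_pos i hL0
    refine ⟨i / L, (i % L).toNat, by omega, ?_⟩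
    rw [Int.toNat_of_nonneg h1, Int.mul_ediv_add_emod]
  -- Two vertices of the path that are congruent are equal, by minimality.
  have hsimple : ∀ a b : ℕ, a ≤ b → b < L → (N : ℤ) ∣ (p.getVert b).1 - (p.getVert a).1 →
      (N : ℤ) ∣ (p.getVert b).2 - (p.getVert a).2 → a = b := by
    intro a b hab hb h1 h2
    obtain ⟨m', hm'⟩ := hr.eq_add_of_dvd (hmem a) (hmem b) h1 h2
    by_cases hm0 : m' = 0
    · rw [hm0] at hm'
      refine hp.getVert_injOn (by simp; omega) (by simp; omega) ?_
      rw [hm']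
      ext <;> simp
    · exfalso
      have e : (p.drop a).getVert (b - a) = p.getVert a + (0, m' * N) := by
        rw [SimpleGraph.Walk.drop_getVert, ← hm']
        congr 1
        omega
      have h := hmin _ (hmem a) m' hm0 (((p.drop a).take (b - a)).copy rfl e)
      rw [SimpleGraph.Walk.length_copy, SimpleGraph.Walk.take_length] at h
      omega
  let c : LatticeCurve N :=
    { L := L
      x := x
      y := y
      mx := 0
      my := m
      four_le := hr.four_le
      three_le := by omega
      step := by
        intro i
        obtain ⟨k, a, ha, rfl⟩ := hdecomp i
        have h1 := hle k a ha.le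
        have h2 := hle k (a + 1) ha
        push_cast at h2
        rw [add_assoc, h1.1, h1.2, h2.1, h2.2]
        have := (p.adj_getVert_succ (i := a) (by omega)).2.2
        linear_combination this
      shift_x := by
        intro i
        obtain ⟨k, a, ha, rfl⟩ := hdecomp i
        rw [show (L * k + a + L : ℤ) = L * (k + 1) + a by ring, (hlt _ a ha).1, (hlt _ a ha).1]
        ring
      shift_y := by
        intro i
        obtain ⟨k, a, ha, rfl⟩ := hdecomp i
        rw [show (L * k + a + L : ℤ) = L * (k + 1) + a by ring, (hlt _ a ha).2, (hlt _ a ha).2]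
        ring
      simple := by
        intro i j h1 h2
        obtain ⟨k, a, ha, rfl⟩ := hdecomp i
        obtain ⟨k', b, hb, rfl⟩ := hdecomp j
        rw [(hlt k a ha).1, (hlt k' b hb).1] at h1
        rw [(hlt k a ha).2, (hlt k' b hb).2,
          show (p.getVert a).2 + k * (m * N) - ((p.getVert b).2 + k' * (m * N)) =
            (p.getVert a).2 - (p.getVert b).2 + N * ((k - k') * m) by ring] at h2
        have h2 := (Int.dvd_add_left (Dvd.intro _ rfl)).1 h2
        have hab : a = b := by
          rcases le_total a b with h | h
          · exact hsimple a b h hb ((dvd_sub_comm).1 h1) ((dvd_sub_comm).1 h2)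
          · exact (hsimple b a h ha h1 h2).symm
        exact ⟨k - k', by rw [hab]; ring⟩ }
  refine ⟨c, rfl, hm, fun i => ?_⟩
  obtain ⟨k, a, ha, rfl⟩ := hdecomp i
  change r (x _, y _) ∈ _
  rw [(hlt k a ha).1, (hlt k a ha).2]
  have h := hr.shift (p.getVert a).1 (p.getVert a).2 0 (k * m)
  rw [Int.cast_zero, mul_zero, add_zero, add_zero] at h
  have e : (((p.getVert a).2 + k * (m * N) : ℤ) : ℝ) = (p.getVert a).2 + N * ((k * m : ℤ) : ℝ) := by
    push_cast; ring
  rw [e, h]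
  exact hmem a

end IsHeight
end

noncomputable section

open Set

/-! ### Shears of the torus that fix a closed set -/

theorem dist_circle_exp_le (s t : ℝ) : dist (Circle.exp s) (Circle.exp t) ≤ |s - t| := by
  have h := Real.norm_exp_I_mul_ofReal_sub_one_le (x := s - t)
  change dist (Circle.exp s : ℂ) (Circle.exp t : ℂ) ≤ |s - t|
  rw [dist_eq_norm, Circle.coe_exp, Circle.coe_exp]
  have e : Complex.exp (s * Complex.I) - Complex.exp (t * Complex.I) =
      Complex.exp (t * Complex.I) * (Complex.exp (Complex.I * (s - t : ℝ)) - 1) := by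
    rw [mul_sub, ← Complex.exp_add, mul_one]
    congr 2
    push_cast
    ring
  rw [e, norm_mul, Complex.norm_exp_ofReal_mul_I, one_mul]
  exact h

/-- For a fine grid, the difference of the first coordinate and a function `V` on the torus, both in
units of `2π`, is a height. -/
theorem exists_isHeight (V : C(Torus, ℝ)) : ∃ N, IsHeight N fun z =>
    z.1 / N - V (gridPoint N z) / (2 * Real.pi) := by
  have hpi := Real.pi_pos
  obtain ⟨δ, hδ, hV⟩ := Metric.uniformContinuous_iff.1
    (CompactSpace.uniformContinuous_of_continuous V.continuous) (Real.pi / 8) (by positivity)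
  obtain ⟨N, hN⟩ := exists_nat_gt (max 64 (4 * Real.pi / δ))
  have hN1 : (64 : ℝ) < N := (le_max_left _ _).trans_lt hN
  have hN2 : 4 * Real.pi / δ < N := (le_max_right _ _).trans_lt hN
  have hN0 : (0 : ℝ) < N := by linarith
  rw [div_lt_iff₀ hδ] at hN2
  have hN4 : 64 < N := by exact_mod_cast hN1
  have hgrid : Continuous (gridPoint N) := continuous_gridPoint N
  refine ⟨N, by omega, by fun_prop, fun x y => ?_, fun x y => ?_, fun z w h1 h2 => ?_, ?_⟩
  · have : gridPoint N (x + N, y) = gridPoint N (x, y) :=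
      (gridPoint_eq_iff (by omega)).2 ⟨1, 0, by simp, by simp⟩
    simp only [this]
    field_simp
    ring
  · have : gridPoint N (x, y + N) = gridPoint N (x, y) :=
      (gridPoint_eq_iff (by omega)).2 ⟨0, 1, by simp, by simp⟩
    simp only [this]
  · have hc : ∀ s t : ℝ, |s - t| ≤ 2 → dist (Circle.exp (2 * Real.pi * s / N))
        (Circle.exp (2 * Real.pi * t / N)) < δ := by
      intro s t hst
      refine (dist_circle_exp_le _ _).trans_lt ?_
      rw [show 2 * Real.pi * s / N - 2 * Real.pi * t / N = 2 * Real.pi / N * (s - t) by ring,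
        abs_mul, abs_of_pos (by positivity), div_mul_eq_mul_div, div_lt_iff₀ hN0]
      nlinarith
    have hd : dist (gridPoint N z) (gridPoint N w) < δ := by
      rw [Prod.dist_eq]
      exact max_lt (hc _ _ h1) (hc _ _ h2)
    have h3 := hV hd
    rw [Real.dist_eq] at h3
    have e : z.1 / N - V (gridPoint N z) / (2 * Real.pi) -
        (w.1 / N - V (gridPoint N w) / (2 * Real.pi)) =
        (z.1 - w.1) / N - (V (gridPoint N z) - V (gridPoint N w)) / (2 * Real.pi) := by ring
    simp only [e]
    refine (abs_sub _ _).trans_lt ?_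
    rw [abs_div, abs_div, abs_of_pos hN0, abs_of_pos (by positivity : 0 < 2 * Real.pi)]
    have a1 : |z.1 - w.1| / N < 1 / 16 := by
      rw [div_lt_iff₀ hN0]
      linarith
    have a2 : |V (gridPoint N z) - V (gridPoint N w)| / (2 * Real.pi) < 1 / 16 := by
      rw [div_lt_iff₀ (by positivity)]
      linarith
    linarith
  · obtain ⟨C, hC⟩ := isCompact_univ.exists_bound_of_continuousOn V.continuous.continuousOn
    refine ⟨C / (2 * Real.pi), fun z => ?_⟩
    have := hC (gridPoint N z) (mem_univ _)
    rw [Real.norm_eq_abs] at this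
    rw [sub_sub_cancel_left, abs_neg, abs_div, abs_of_pos (by positivity : 0 < 2 * Real.pi)]
    gcongr

/-- `Realizable K M`: some homeomorphism of the torus fixes `K` pointwise and acts by `M` on the
first homology. -/
def Realizable (K : Set Torus) (M : Matrix (Fin 2) (Fin 2) ℤ) : Prop :=
  ∃ g : Torus ≃ₜ Torus, (∀ p ∈ K, g p = p) ∧ HasMatrix (g : C(Torus, Torus)) M

namespace Realizable

variable {K : Set Torus} {M N A B : Matrix (Fin 2) (Fin 2) ℤ}

theorem one : Realizable K 1 := ⟨Homeomorph.refl _, fun _ _ => rfl, HasMatrix.id⟩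

theorem mul (hM : Realizable K M) (hN : Realizable K N) : Realizable K (M * N) := by
  obtain ⟨g, hg, hgM⟩ := hM
  obtain ⟨g', hg', hgN⟩ := hN
  refine ⟨g'.trans g, fun p hp => ?_, hgM.comp hgN⟩
  rw [Homeomorph.trans_apply, hg' p hp, hg p hp]

theorem of_mul_eq_one (hM : Realizable K M) (h : N * M = 1) : Realizable K N := by
  obtain ⟨g, hg, hgM⟩ := hM
  obtain ⟨N', hN'⟩ := exists_hasMatrix (g.symm : C(Torus, Torus))
  have h1 : M * N' = 1 := hgM.mul_symm hN'
  obtain rfl : N' = N := by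
    rw [← one_mul N', ← h, mul_assoc, h1, mul_one]
  exact ⟨g.symm, fun p hp => by rw [Homeomorph.symm_apply_eq, hg p hp], hN'⟩

theorem conj (hAB : A * B = 1) (hBA : B * A = 1) (hM : Realizable (linearMap A '' K) M) :
    Realizable K (B * M * A) := by
  obtain ⟨g, hg, hgM⟩ := hM
  refine ⟨((linearHomeo A B hAB).trans g).trans (linearHomeo B A hBA), fun p hp => ?_, ?_⟩
  · have h1 : g (linearMap A p) = linearMap A p := hg _ (mem_image_of_mem _ hp)
    have h2 : linearMap B (linearMap A p) = p := by rw [← linearMap_mul, hBA, linearMap_one]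
    exact (congrArg (linearMap B) h1).trans h2
  · have e : (((linearHomeo A B hAB).trans g).trans (linearHomeo B A hBA) : C(Torus, Torus)) =
        (linearMap B).comp ((g : C(Torus, Torus)).comp (linearMap A)) :=
      ContinuousMap.ext fun p => rfl
    rw [mul_assoc, e]
    exact (hasMatrix_linearMap B).comp (hgM.comp (hasMatrix_linearMap A))

/-- If the first coordinate has a logarithm on `K`, there is a Dehn twist off `K` along a curve in
the direction of the second coordinate. -/
theorem shear_neg (V : C(Torus, ℝ)) (hV : ∀ p ∈ K, p.1 = Circle.exp (V p)) :
    Realizable K !![1, 0; -1, 1] := by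
  obtain ⟨N, hr⟩ := exists_isHeight V
  obtain ⟨c, hmx, hmy, hc⟩ := hr.exists_latticeCurve
  obtain ⟨g, hgM, hg⟩ := c.exists_twist hmx hmy
  refine ⟨g, fun p hp => hg p fun τ b hb hpt => ?_, hgM⟩
  set i := ⌊τ⌋
  have h0 := Int.fract_nonneg τ
  have h1 := (Int.fract_lt_one τ).le
  have hb' := abs_le.1 hb
  have ha := c.along_bounds (i := i) h0 h1 hb
  have hX := c.parX_add i h0 h1 b
  have hY := c.parY_add i h0 h1 b
  rw [Int.floor_add_fract] at hX hY
  rw [LatticeCurve.ptX] at hX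
  rw [LatticeCurve.ptY] at hY
  -- The point lies close to a vertex of the curve, where the height is far from the integers.
  have hs := hr.slow (c.parX τ b, c.parY τ b) (c.x i, c.y i) (by
      rw [abs_le, hX]
      rcases c.dir i with ⟨d1, d2⟩ | ⟨d1, d2⟩ | ⟨d1, d2⟩ | ⟨d1, d2⟩ <;> rw [d1, d2] <;>
      push_cast <;> constructor <;> linarith [ha.1, ha.2, hb'.1, hb'.2]) (by
      rw [abs_le, hY]
      rcases c.dir i with ⟨d1, d2⟩ | ⟨d1, d2⟩ | ⟨d1, d2⟩ | ⟨d1, d2⟩ <;> rw [d1, d2] <;>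
      push_cast <;> constructor <;> linarith [ha.1, ha.2, hb'.1, hb'.2])
  have hs := abs_lt.1 hs
  have hi := hc i
  obtain ⟨hi1, hi2⟩ := hi
  have hN : (N : ℝ) ≠ 0 := by have := hr.pos; positivity
  have hpi := Real.pi_pos
  have hexp := hV p hp
  rw [hpt] at hexp
  obtain ⟨k, hk⟩ := Circle.exp_eq_exp.1 hexp
  have hint : c.parX τ b / N - V (gridPoint N (c.parX τ b, c.parY τ b)) / (2 * Real.pi) = k := by
    simp only at hk
    have : c.parX τ b / N = 2 * Real.pi * c.parX τ b / N / (2 * Real.pi) := by field_simp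
    rw [this, hk]
    field_simp
    ring
  simp only [hint] at hs
  have a1 : (k : ℝ) < ((1 : ℤ) : ℝ) := by push_cast; linarith [hs.1, hs.2]
  have a2 : ((0 : ℤ) : ℝ) < k := by push_cast; linarith [hs.1, hs.2]
  have := Int.cast_lt.1 a1
  have := Int.cast_lt.1 a2
  omega

theorem shear (V : C(Torus, ℝ)) (hV : ∀ p ∈ K, p.1 = Circle.exp (V p)) (n : ℤ) :
    Realizable K !![1, 0; n, 1] := by
  have h1 := shear_neg V hV
  have h2 : Realizable K !![1, 0; 1, 1] := h1.of_mul_eq_one (by simp [Matrix.one_fin_two])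
  induction n using Int.induction_on with
  | zero => simpa [Matrix.one_fin_two] using one (K := K)
  | succ k ih => simpa using ih.mul h2
  | pred k ih => simpa [sub_eq_add_neg] using ih.mul h1

/-- If `X ^ a * Y ^ b` with coprime `a`, `b` has a logarithm on `K`, the transvections that fix its
class are realizable. -/
theorem transvection {a b : ℤ} (hab : IsCoprime a b) (V : C(Torus, ℝ))
    (hV : ∀ p ∈ K, p.1 ^ a * p.2 ^ b = Circle.exp (V p)) (n : ℤ) :
    Realizable K !![1 - n * a * b, -n * b ^ 2; n * a ^ 2, 1 + n * a * b] := by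
  obtain ⟨d, c, hdc⟩ := hab
  have h1 : (!![a, b; -c, d] : Matrix (Fin 2) (Fin 2) ℤ) * !![d, -b; c, a] = 1 := by
    rw [Matrix.mul_fin_two, Matrix.one_fin_two]
    ext i j
    fin_cases i <;> fin_cases j <;> simp <;> first | ring1 | linear_combination hdc
  have h2 : (!![d, -b; c, a] : Matrix (Fin 2) (Fin 2) ℤ) * !![a, b; -c, d] = 1 :=
    mul_eq_one_comm.1 h1
  have h3 : Realizable (linearMap !![a, b; -c, d] '' K) !![1, 0; n, 1] := by
    refine shear (V.comp (linearMap !![d, -b; c, a])) ?_ n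
    rintro _ ⟨p, hp, rfl⟩
    rw [ContinuousMap.comp_apply, ← linearMap_mul, h2, linearMap_one, ← hV p hp]
    simp [linearMap]
  have h4 := h3.conj h1 h2
  convert h4 using 1
  rw [Matrix.mul_fin_two, Matrix.mul_fin_two]
  ext i j
  fin_cases i <;> fin_cases j <;> simp <;> first | ring1 | linear_combination -hdc

/-- If all circle-valued maps of the torus have a logarithm on `K`, every orientation-preserving
homology action is realizable. -/
theorem of_det_eq_one (V W : C(Torus, ℝ)) (hV : ∀ p ∈ K, p.1 = Circle.exp (V p))
    (hW : ∀ p ∈ K, p.2 = Circle.exp (W p)) (hM : M.det = 1) : Realizable K M := by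
  have hlow : ∀ n : ℤ, Realizable K !![1, 0; n, 1] := shear V hV
  have hup : ∀ n : ℤ, Realizable K !![1, -n; 0, 1] := fun n => by
    simpa using transvection (K := K) (a := 0) (b := 1) isCoprime_one_right W (by simpa using hW) n
  have key : ∀ A : Matrix.SpecialLinearGroup (Fin 2) ℤ, Realizable K A.1 := by
    intro A
    have hA : A ∈ Subgroup.closure {ModularGroup.S, ModularGroup.T} := by
      rw [SpecialLinearGroup.SL2Z_generators]
      trivial
    induction hA using Subgroup.closure_induction with
    | mem x hx =>
      rcases hx with rfl | rfl
      · have := ((hup 1).mul (hlow 1)).mul (hup 1)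
        simpa [ModularGroup.S] using this
      · have := hup (-1)
        simpa [ModularGroup.T] using this
    | one => exact one
    | mul x y _ _ hx hy => exact hx.mul hy
    | inv x _ hx =>
      refine hx.of_mul_eq_one ?_
      rw [← Matrix.SpecialLinearGroup.coe_mul, inv_mul_cancel, Matrix.SpecialLinearGroup.coe_one]
  exact key ⟨M, hM⟩

end Realizable
end

noncomputable section

open Set

/-! ### Correcting the action on homology -/

/-- An integer matrix of determinant `1` that fixes a primitive vector is a transvection. -/
theorem exists_eq_transvection {D : Matrix (Fin 2) (Fin 2) ℤ} (hD : D.det = 1) {p q : ℤ}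
    (hpq : IsCoprime p q) (h0 : D 0 0 * p + D 0 1 * q = p) (h1 : D 1 0 * p + D 1 1 * q = q) :
    ∃ n : ℤ, D = !![1 - n * -q * p, -n * p ^ 2; n * (-q) ^ 2, 1 + n * -q * p] := by
  obtain ⟨c, d, hcd⟩ := hpq
  rw [Matrix.det_fin_two] at hD
  obtain ⟨u, hu1, hu2⟩ : ∃ u, D 0 0 = 1 - q * u ∧ D 0 1 = p * u :=
    ⟨c * D 0 1 - d * (D 0 0 - 1), by linear_combination (1 - D 0 0) * hcd + c * h0,
      by linear_combination (-D 0 1) * hcd + d * h0⟩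
  obtain ⟨w, hw1, hw2⟩ : ∃ w, D 1 1 = 1 + p * w ∧ D 1 0 = -(q * w) :=
    ⟨c * (D 1 1 - 1) - d * D 1 0, by linear_combination (1 - D 1 1) * hcd + d * h1,
      by linear_combination (-D 1 0) * hcd + c * h1⟩
  have huw : p * w = q * u := by
    rw [hu1, hu2, hw1, hw2] at hD
    linear_combination hD
  have hnp : -(c * u + d * w) * p = -u := by linear_combination (-u) * hcd - d * huw
  have hnq : -(c * u + d * w) * q = -w := by linear_combination (-w) * hcd + c * huw
  refine ⟨-(c * u + d * w), ?_⟩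
  generalize -(c * u + d * w) = n at hnp hnq
  ext i j
  fin_cases i <;> fin_cases j <;> simp
  · linear_combination hu1 - q * hnp
  · linear_combination hu2 + p * hnp
  · linear_combination hw2 - q * hnq
  · linear_combination hw1 + p * hnq

/-- The homology classes `(x, y)` of the cycles of a graph with point set `K`, and their inverse
images `(x', y')` under a homeomorphism of the torus acting by `A`, decide whether the
homeomorphism can be changed to one acting by a lower triangular matrix with diagonal `(δ, δ)`. If the
classes span a lattice of rank `2`, then `A` is already of this form; if they are multiples of a
primitive class, then `A` is corrected by a transvection fixing this class; if they all vanish, every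
matrix can be realized by a homeomorphism that fixes `K`. -/
theorem exists_correction {K : Set Torus} {A : Matrix (Fin 2) (Fin 2) ℤ} (hA : A.det = 1)
    {ι : Type*} {x y x' y' : ι → ℤ} {δ : ℤ} (hδ : δ * δ = 1)
    (hx : ∀ i, x i = A 0 0 * x' i + A 0 1 * y' i) (hy : ∀ i, y i = A 1 0 * x' i + A 1 1 * y' i)
    (hxδ : ∀ i, x' i = δ * x i) (hdvd : ∀ i, x i ∣ y' i - δ * y i)
    (hlog : ∀ a b : ℤ, (∀ i, a * x i + b * y i = 0) →
      ∃ V : C(Torus, ℝ), ∀ p ∈ K, p.1 ^ a * p.2 ^ b = Circle.exp (V p)) :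
    ∃ M, Realizable K M ∧ M.det = 1 ∧ (M * A) 0 1 = 0 ∧ (M * A) 1 1 = δ := by
  have hdet := hA
  rw [Matrix.det_fin_two] at hdet
  have hx' : ∀ i, x' i = A 1 1 * x i - A 0 1 * y i := fun i => by
    rw [hx, hy]; linear_combination (-x' i) * hdet
  have hy' : ∀ i, y' i = A 0 0 * y i - A 1 0 * x i := fun i => by
    rw [hx, hy]; linear_combination (-y' i) * hdet
  -- The matrix that turns `A` into the matrix with rows `(δ, 0)` and `(k, δ)`.
  let D : ℤ → Matrix (Fin 2) (Fin 2) ℤ := fun k =>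
    !![δ * A 1 1, -(δ * A 0 1); k * A 1 1 - δ * A 1 0, δ * A 0 0 - k * A 0 1]
  have hD : ∀ k, (D k).det = 1 ∧ (D k * A) 0 1 = 0 ∧ (D k * A) 1 1 = δ := by
    intro k
    refine ⟨?_, ?_, ?_⟩
    · simp [D, Matrix.det_fin_two]
      linear_combination δ * δ * hdet + hδ
    · simp [D, Matrix.mul_apply, Fin.sum_univ_two]
      ring
    · simp [D, Matrix.mul_apply, Fin.sum_univ_two]
      linear_combination δ * hdet
  by_cases h0 : ∀ i, x i = 0 ∧ y i = 0
  · obtain ⟨V, hV⟩ := hlog 1 0 fun i => by rw [(h0 i).1, (h0 i).2]; ring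
    obtain ⟨W, hW⟩ := hlog 0 1 fun i => by rw [(h0 i).1, (h0 i).2]; ring
    exact ⟨D 0, .of_det_eq_one V W (by simpa using hV) (by simpa using hW) (hD 0).1, hD 0⟩
  push Not at h0
  obtain ⟨i₀, hi₀⟩ := h0
  by_cases h1 : ∀ i, x i₀ * y i - y i₀ * x i = 0
  · have hg : 0 < Int.gcd (x i₀) (y i₀) := Int.gcd_pos_iff.2 (by
      by_contra! h
      exact hi₀ h.1 h.2)
    obtain ⟨p, q, hpq, hp, hq⟩ := Int.exists_gcd_one hg
    have hg0 : (Int.gcd (x i₀) (y i₀) : ℤ) ≠ 0 := by exact_mod_cast hg.ne'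
    generalize (Int.gcd (x i₀) (y i₀) : ℤ) = g at hp hq hg0
    have hpq : IsCoprime p q := Int.isCoprime_iff_gcd_eq_one.2 hpq
    obtain ⟨V, hV⟩ := hlog (-q) p fun i => by
      have := h1 i
      rw [hp, hq] at this
      refine mul_left_cancel₀ hg0 ?_
      linear_combination this
    have hδp : A 1 1 * p - A 0 1 * q = δ * p := by
      have := (hx' i₀).symm.trans (hxδ i₀)
      rw [hp, hq] at this
      refine mul_left_cancel₀ hg0 ?_
      linear_combination this
    obtain ⟨s, hs⟩ : p ∣ A 0 0 * q - A 1 0 * p - δ * q := by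
      have := hdvd i₀
      rw [hy', hp, hq] at this
      refine (mul_dvd_mul_iff_right hg0).1 (this.trans (dvd_of_eq ?_))
      ring
    obtain ⟨n, hn⟩ := exists_eq_transvection (hD (-s)).1 hpq
      (by simp [D]; linear_combination δ * hδp + p * hδ)
      (by simp [D]; linear_combination (-s) * hδp + δ * hs + q * hδ)
    refine ⟨D (-s), ?_, hD (-s)⟩
    rw [hn]
    exact Realizable.transvection (isCoprime_comm.1 hpq).neg_left V hV n
  · push Not at h1
    obtain ⟨j, hj⟩ := h1
    have e1 := (hx' i₀).symm.trans (hxδ i₀)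
    have e2 := (hx' j).symm.trans (hxδ j)
    have e3 : A 1 1 = δ := sub_eq_zero.1 ((mul_eq_zero.1 (show (A 1 1 - δ) *
      (x i₀ * y j - y i₀ * x j) = 0 by linear_combination y j * e1 - y i₀ * e2)).resolve_right hj)
    have e4 : A 0 1 = 0 := (mul_eq_zero.1 (show A 0 1 * (x i₀ * y j - y i₀ * x j) = 0 by
      rw [e3] at e1 e2
      linear_combination x j * e1 - x i₀ * e2)).resolve_right hj
    exact ⟨1, .one, Matrix.det_one, by rw [one_mul, e4], by rw [one_mul, e3]⟩

/-! ### Degrees of curves on the boundary torus -/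

/-- Reversing a closed curve changes the sign of the degree. -/
theorem circleDegree_comp_reverseCurve {X : Type*} [TopologicalSpace X] (f : C(X, Circle))
    (c : C(Circle, X)) : circleDegree (f.comp (reverseCurve c)) = -circleDegree (f.comp c) := by
  obtain ⟨θ, hθ, h1, h2⟩ := exists_degree_lift (f.comp c)
  refine circleDegree_eq (θ := fun t => θ (-t)) (by fun_prop) (fun t => ?_) fun t => ?_
  · rw [← h1, Circle.exp_neg]
    rfl
  · have := h2 (-t - 2 * Real.pi)
    rw [sub_add_cancel] at this
    rw [this, neg_add']
    push_cast
    ring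

namespace SolidTorus

variable {V V₁ V₂ : Type*} [TopologicalSpace V] [TopologicalSpace V₁] [TopologicalSpace V₂]

/-- The degree of a closed curve on the boundary torus in the longitudinal direction. -/
def degX (e : SolidTorus V) (c : C(Circle, e.Boundary)) : ℤ := circleDegree (e.coordX.comp c)

/-- The degree of a closed curve on the boundary torus in the meridional direction. -/
def degY (e : SolidTorus V) (c : C(Circle, e.Boundary)) : ℤ := circleDegree (e.coordY.comp c)

theorem deg_comp {e₁ : SolidTorus V₁} {e₂ : SolidTorus V₂} {h : e₁.Boundary ≃ₜ e₂.Boundary}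
    {M : Matrix (Fin 2) (Fin 2) ℤ} (hM : HasMatrix (inCoords e₁ e₂ h : C(Torus, Torus)) M)
    (c : C(Circle, e₁.Boundary)) :
    e₂.degX ((h : C(e₁.Boundary, e₂.Boundary)).comp c) = M 0 0 * e₁.degX c + M 0 1 * e₁.degY c ∧
    e₂.degY ((h : C(e₁.Boundary, e₂.Boundary)).comp c) = M 1 0 * e₁.degX c + M 1 1 * e₁.degY c := by
  have h1 := hM.1.degree_comp ((e₁.boundaryHomeo : C(e₁.Boundary, Torus)).comp c)
  have h2 := hM.2.degree_comp ((e₁.boundaryHomeo : C(e₁.Boundary, Torus)).comp c)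
  refine ⟨Eq.trans (congrArg circleDegree ?_) h1, Eq.trans (congrArg circleDegree ?_) h2⟩ <;>
  ext1 u
  · exact (congrArg Prod.fst (inCoords_apply e₁ e₂ h (c u))).symm
  · exact (congrArg Prod.snd (inCoords_apply e₁ e₂ h (c u))).symm

theorem homotopic_iff {e : SolidTorus V} {c d : C(Circle, e.Boundary)} :
    c.Homotopic d ↔ e.degX c = e.degX d ∧ e.degY c = e.degY d := by
  have h := homotopic_torus_iff (c := (e.boundaryHomeo : C(e.Boundary, Torus)).comp c)
    (d := (e.boundaryHomeo : C(e.Boundary, Torus)).comp d)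
  refine Iff.trans ⟨fun hcd => (ContinuousMap.Homotopic.refl _).comp hcd, fun hcd => ?_⟩ h
  have := (ContinuousMap.Homotopic.refl (e.boundaryHomeo.symm : C(Torus, e.Boundary))).comp hcd
  have hid : ∀ c : C(Circle, e.Boundary), (e.boundaryHomeo.symm : C(Torus, e.Boundary)).comp
      ((e.boundaryHomeo : C(e.Boundary, Torus)).comp c) = c := fun c => by
    ext1 u
    exact e.boundaryHomeo.symm_apply_apply _
  rwa [hid, hid] at this

/-- `w` and `v` have the homology classes of a meridian, with orientation sign `ε`, and of a parallel
to it. -/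
def IsMeridianPair (e : SolidTorus V) (w v : C(Circle, e.Boundary)) (ε : ℤ) : Prop :=
  ε * ε = 1 ∧ e.degX w = 0 ∧ e.degY w = ε ∧ e.degX v = -ε

theorem IsChosenCycle.isMeridianPair {e : SolidTorus V} {w v : C(Circle, e.Boundary)}
    (hw : e.IsChosenCycle w) (hv : e.IsParallel w v) : e.IsMeridianPair w v (e.degY w) := by
  have h0 : e.degX w = 0 := hw.degree_coordX
  have h1 : e.degX w * e.degY v - e.degY w * e.degX v = 1 := hv.intersection
  rw [h0] at h1
  have h2 : e.degY w * -e.degX v = 1 := by linear_combination h1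
  rcases Int.isUnit_iff.1 (IsUnit.of_mul_eq_one _ h2) with h | h <;> rw [h] at h2 <;>
  refine ⟨by rw [h]; ring, h0, rfl, by omega⟩

theorem IsMeridianPair.reverse {e : SolidTorus V} {w v : C(Circle, e.Boundary)} {ε : ℤ}
    (h : e.IsMeridianPair w v ε) : e.IsMeridianPair (reverseCurve w) (reverseCurve v) (-ε) := by
  obtain ⟨h1, h2, h3, h4⟩ := h
  refine ⟨by linear_combination h1, ?_, ?_, ?_⟩
  · rw [degX, circleDegree_comp_reverseCurve, ← degX, h2, neg_zero]
  · rw [degY, circleDegree_comp_reverseCurve, ← degY, h3]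
  · rw [degX, circleDegree_comp_reverseCurve, ← degX, h4]

variable {e₁ : SolidTorus V₁} {e₂ : SolidTorus V₂} {G₁ : EmbeddedGraph e₁.Boundary}
  {G₂ : EmbeddedGraph e₂.Boundary} (φ : EmbeddedGraph.Iso G₁ G₂)

/-- The condition on the homology classes of corresponding cycles that is equivalent to the equality
of the invariants, where `δ` is the product of the orientation signs of the chosen cycles. -/
def Compatible (φ : EmbeddedGraph.Iso G₁ G₂) (δ : ℤ) : Prop :=
  ∀ z : G₂.Cycle, e₁.degX (φ.cycleSymm z).curve = δ * e₂.degX z.curve ∧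
    e₂.degX z.curve ∣ e₁.degY (φ.cycleSymm z).curve - δ * e₂.degY z.curve

/-- In terms of classes, `α = ε x` and `β` is the residue modulo `ε x` of `ε y` plus a multiple of `x`;
so the equality of the invariants does not depend on the choice of the parallels. -/
theorem invariants_eq_iff {w₁ v₁ : C(Circle, e₁.Boundary)} {w₂ v₂ : C(Circle, e₂.Boundary)}
    {ε₁ ε₂ : ℤ} (h₁ : e₁.IsMeridianPair w₁ v₁ ε₁) (h₂ : e₂.IsMeridianPair w₂ v₂ ε₂) :
    (φ.transport (e₁.alpha w₁) = e₂.alpha w₂ ∧ φ.transport (e₁.beta w₁ v₁) = e₂.beta w₂ v₂) ↔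
      Compatible φ (ε₁ * ε₂) := by
  obtain ⟨s1, a1, b1, c1⟩ := h₁
  obtain ⟨s2, a2, b2, c2⟩ := h₂
  rw [funext_iff, funext_iff, ← forall_and]
  refine forall_congr' fun z => ?_
  simp only [EmbeddedGraph.Iso.transport, beta, alpha, intersectionNumber]
  change (degX _ _ * degY _ _ - degY _ _ * degX _ _ = degX _ _ * degY _ _ - degY _ _ * degX _ _ ∧
    (degX _ _ * degY _ _ - degY _ _ * degX _ _) % (degX _ _ * degY _ _ - degY _ _ * degX _ _) =
    (degX _ _ * degY _ _ - degY _ _ * degX _ _) % (degX _ _ * degY _ _ - degY _ _ * degX _ _)) ↔ _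
  rw [a1, b1, c1, a2, b2, c2]
  generalize e₁.degX (φ.cycleSymm z).curve = x'
  generalize e₁.degY (φ.cycleSymm z).curve = y'
  generalize e₂.degX z.curve = x
  generalize e₂.degY z.curve = y
  generalize e₁.degY v₁ = t₁
  generalize e₂.degY v₂ = t₂
  have hα : x' * ε₁ - y' * 0 = x * ε₂ - y * 0 ↔ x' = ε₁ * ε₂ * x :=
    ⟨fun h => by linear_combination ε₁ * h - x' * s1, fun h => by
      rw [h]; linear_combination ε₂ * x * s1⟩
  rw [hα]
  refine and_congr_right fun hx => ?_
  rw [hα.2 hx]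
  have hmod : ∀ a b n : ℤ, a % n = b % n ↔ n ∣ b - a := fun a b n => Int.modEq_iff_dvd
  rw [hmod]
  constructor
  · rintro ⟨k, hk⟩
    refine ⟨ε₁ * t₂ - ε₁ * ε₂ * k - ε₂ * t₁, ?_⟩
    rw [hx] at hk
    linear_combination (-ε₁) * hk - (y' + ε₂ * x * t₁) * s1
  · rintro ⟨k, hk⟩
    refine ⟨ε₂ * t₂ - ε₁ * t₁ - ε₁ * ε₂ * k, ?_⟩
    rw [hx]
    linear_combination (-ε₁) * hk + (ε₁ * x * k - x * t₂) * s2 - ε₂ * y * s1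

/-- The point set of the graph in the standard torus satisfies the hypothesis on logarithms of
`exists_correction`. -/
theorem exists_log_image (G : EmbeddedGraph e₂.Boundary) {a b : ℤ}
    (hdeg : ∀ z : G.Cycle, a * e₂.degX z.curve + b * e₂.degY z.curve = 0) :
    ∃ W : C(Torus, ℝ), ∀ p ∈ e₂.boundaryHomeo '' G.carrier,
      p.1 ^ a * p.2 ^ b = Circle.exp (W p) := by
  have : T2Space e₂.Boundary := e₂.boundaryHomeo.symm.t2Space
  have : CompactSpace e₂.Boundary := e₂.boundaryHomeo.symm.compactSpace
  let m : C(Torus, Circle) := ⟨fun p => p.1 ^ a * p.2 ^ b, by fun_prop⟩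
  have hm : HasClass m a b := ⟨0, fun p => by simp [m]⟩
  obtain ⟨v, hv⟩ := EmbeddedGraph.exists_log_carrier (G := G)
    (f := m.comp (e₂.boundaryHomeo : C(e₂.Boundary, Torus))) fun z => by
      rw [ContinuousMap.comp_assoc, hm.degree_comp]
      exact hdeg z
  refine ⟨v.comp (e₂.boundaryHomeo.symm : C(Torus, e₂.Boundary)), ?_⟩
  rintro _ ⟨x, hx, rfl⟩
  refine (hv x hx).trans ?_
  simp

/-- A cycle of the second graph is the image of the corresponding cycle of the first one. -/
theorem comp_cycleSymm_curve {h : e₁.Boundary ≃ₜ e₂.Boundary} (hφ : φ.ExtendedBy h) (z : G₂.Cycle) :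
    (h : C(e₁.Boundary, e₂.Boundary)).comp (φ.cycleSymm z).curve = z.curve := by
  ext1 u
  refine (hφ (φ.toHomeomorph.symm (z.1 u))).trans ?_
  rw [Homeomorph.apply_symm_apply]
  rfl

/-- If `φ` extends to an orientation-preserving homeomorphism of the boundary tori at all, it extends to
one that extends over the solid tori and acts on the class of the meridian by `δ = ± 1` iff the
classes of corresponding cycles are compatible. -/
theorem exists_extension_iff {δ : ℤ} (hδ : δ * δ = 1)
    (hφ : ∃ h : e₁.Boundary ≃ₜ e₂.Boundary, OrientationPreserving e₁ e₂ h ∧ φ.ExtendedBy h) :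
    (∃ h : e₁.Boundary ≃ₜ e₂.Boundary, OrientationPreserving e₁ e₂ h ∧ φ.ExtendedBy h ∧
      ExtendsToSolidTori e₁ e₂ h ∧
      ∃ M, HasMatrix (inCoords e₁ e₂ h : C(Torus, Torus)) M ∧ M 1 1 = δ) ↔ Compatible φ δ := by
  constructor
  · rintro ⟨h, hor, hext, hsol, M, hM, hMδ⟩ z
    have h01 := hsol.apply_zero_one hM
    have hdet := (orientationPreserving_iff hM).1 hor
    rw [Matrix.det_fin_two, h01, hMδ] at hdet
    have h00 : M 0 0 = δ := by linear_combination δ * hdet - M 0 0 * hδ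
    obtain ⟨hX, hY⟩ := deg_comp hM (φ.cycleSymm z).curve
    rw [comp_cycleSymm_curve φ hext, h00, h01] at hX
    rw [comp_cycleSymm_curve φ hext, hMδ] at hY
    refine ⟨by rw [hX]; linear_combination (-e₁.degX (φ.cycleSymm z).curve) * hδ,
      -(M 1 0), ?_⟩
    rw [hX, hY]
    linear_combination (-e₁.degY (φ.cycleSymm z).curve) * hδ
  · intro hc
    obtain ⟨h, hor, hext⟩ := hφ
    obtain ⟨A, hA⟩ := exists_hasMatrix (inCoords e₁ e₂ h : C(Torus, Torus))
    have hdet := (orientationPreserving_iff hA).1 hor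
    have hrel : ∀ z : G₂.Cycle, _ := fun z => deg_comp hA (φ.cycleSymm z).curve
    simp only [comp_cycleSymm_curve φ hext] at hrel
    obtain ⟨M, ⟨g, hg, hgM⟩, hMdet, h01, h11⟩ := exists_correction
      (K := e₂.boundaryHomeo '' G₂.carrier) hdet hδ (fun z => (hrel z).1) (fun z => (hrel z).2)
      (fun z => (hc z).1) (fun z => (hc z).2) (fun a b hab => exists_log_image G₂ hab)
    let h' : e₁.Boundary ≃ₜ e₂.Boundary :=
      h.trans ((e₂.boundaryHomeo.trans g).trans e₂.boundaryHomeo.symm)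
    have hM' : HasMatrix (inCoords e₁ e₂ h' : C(Torus, Torus)) (M * A) := by
      have e : (inCoords e₁ e₂ h' : C(Torus, Torus)) =
          (g : C(Torus, Torus)).comp (inCoords e₁ e₂ h : C(Torus, Torus)) :=
        ContinuousMap.ext fun p => e₂.boundaryHomeo.apply_symm_apply _
      rw [e]
      exact hgM.comp hA
    have hdet' : (M * A).det = 1 := by rw [Matrix.det_mul, hMdet, hdet, one_mul]
    have h00 : (M * A) 0 0 = δ := by
      have := hdet'
      rw [Matrix.det_fin_two, h01, h11] at this
      linear_combination δ * this - (M * A) 0 0 * hδ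
    refine ⟨h', (orientationPreserving_iff hM').2 hdet', fun x => ?_,
      extendsToSolidTori_of_hasMatrix hM' ?_ h01, M * A, hM', h11⟩
    · have h1 : h x = φ.toHomeomorph x := hext x
      change e₂.boundaryHomeo.symm (g (e₂.boundaryHomeo (h x))) = _
      rw [h1, hg _ (mem_image_of_mem _ (φ.toHomeomorph x).2), Homeomorph.symm_apply_apply]
    · rw [h00]
      exact Int.isUnit_iff.1 (IsUnit.of_mul_eq_one _ hδ)

end SolidTorus
end

theorem lemma1 {V₁ V₂ : Type*} [TopologicalSpace V₁] [TopologicalSpace V₂]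
    (e₁ : SolidTorus V₁) (e₂ : SolidTorus V₂)
    (w₁ v₁ : C(Circle, e₁.Boundary)) (w₂ v₂ : C(Circle, e₂.Boundary))
    (hw₁ : e₁.IsChosenCycle w₁) (hv₁ : e₁.IsParallel w₁ v₁)
    (hw₂ : e₂.IsChosenCycle w₂) (hv₂ : e₂.IsParallel w₂ v₂)
    (G₁ : EmbeddedGraph e₁.Boundary) (G₂ : EmbeddedGraph e₂.Boundary)
    (φ : EmbeddedGraph.Iso G₁ G₂)
    (hφ : ∃ h : e₁.Boundary ≃ₜ e₂.Boundary,
      SolidTorus.OrientationPreserving e₁ e₂ h ∧ φ.ExtendedBy h) :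
    ((∃ h : e₁.Boundary ≃ₜ e₂.Boundary,
        SolidTorus.OrientationPreserving e₁ e₂ h ∧ φ.ExtendedBy h ∧
          SolidTorus.ExtendsToSolidTori e₁ e₂ h ∧
          ContinuousMap.Homotopic ((h : C(e₁.Boundary, e₂.Boundary)).comp w₁) w₂) ↔
      (φ.transport (e₁.alpha w₁) = e₂.alpha w₂ ∧
        φ.transport (e₁.beta w₁ v₁) = e₂.beta w₂ v₂)) ∧
    ((∃ h : e₁.Boundary ≃ₜ e₂.Boundary,
        SolidTorus.OrientationPreserving e₁ e₂ h ∧ φ.ExtendedBy h ∧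
          SolidTorus.ExtendsToSolidTori e₁ e₂ h) ↔
      ((φ.transport (e₁.alpha w₁) = e₂.alpha w₂ ∧
          φ.transport (e₁.beta w₁ v₁) = e₂.beta w₂ v₂) ∨
        (φ.transport (e₁.alpha w₁) = e₂.alpha (reverseCurve w₂) ∧
          φ.transport (e₁.beta w₁ v₁) =
            e₂.beta (reverseCurve w₂) (reverseCurve v₂)))) := by
  have h₁ := hw₁.isMeridianPair hv₁
  have h₂ := hw₂.isMeridianPair hv₂
  have hδ : e₁.degY w₁ * e₂.degY w₂ * (e₁.degY w₁ * e₂.degY w₂) = 1 := by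
    linear_combination e₂.degY w₂ * e₂.degY w₂ * h₁.1 + h₂.1
  have hδ' : e₁.degY w₁ * -e₂.degY w₂ * (e₁.degY w₁ * -e₂.degY w₂) = 1 := by
    linear_combination hδ
  rw [SolidTorus.invariants_eq_iff φ h₁ h₂, SolidTorus.invariants_eq_iff φ h₁ h₂.reverse,
    ← SolidTorus.exists_extension_iff φ hδ hφ, ← SolidTorus.exists_extension_iff φ hδ' hφ]
  constructor
  · refine exists_congr fun h => and_congr_right fun hor => and_congr_right fun _ =>
      and_congr_right fun hsol => ?_
    obtain ⟨M, hM⟩ := exists_hasMatrix (SolidTorus.inCoords e₁ e₂ h : C(Torus, Torus))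
    have h01 := hsol.apply_zero_one hM
    obtain ⟨hX, hY⟩ := SolidTorus.deg_comp hM w₁
    rw [SolidTorus.homotopic_iff, hX, hY, h₁.2.1, h01, h₂.2.1]
    constructor
    · rintro ⟨-, h11⟩
      refine ⟨M, hM, ?_⟩
      linear_combination e₁.degY w₁ * h11 - M 1 1 * h₁.1
    · rintro ⟨M', hM', h11⟩
      obtain rfl := hM'.unique hM
      refine ⟨by ring, ?_⟩
      rw [h11]
      linear_combination e₂.degY w₂ * h₁.1
  · constructor
    · rintro ⟨h, hor, hext, hsol⟩
      obtain ⟨M, hM⟩ := exists_hasMatrix (SolidTorus.inCoords e₁ e₂ h : C(Torus, Torus))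
      have hdet := (SolidTorus.orientationPreserving_iff hM).1 hor
      rw [Matrix.det_fin_two, hsol.apply_zero_one hM] at hdet
      have hunit : M 1 1 * M 0 0 = 1 := by linear_combination hdet
      have hsq : (M 1 1) * (M 1 1) = 1 := by
        rcases Int.isUnit_iff.1 (IsUnit.of_mul_eq_one _ hunit) with h | h <;> rw [h] <;> ring
      have hcases : (M 1 1 - e₁.degY w₁ * e₂.degY w₂) * (M 1 1 - e₁.degY w₁ * -e₂.degY w₂) = 0 := by
        linear_combination hsq - hδ
      rcases mul_eq_zero.1 hcases with h0 | h0
      · exact Or.inl ⟨h, hor, hext, hsol, M, hM, sub_eq_zero.1 h0⟩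
      · exact Or.inr ⟨h, hor, hext, hsol, M, hM, sub_eq_zero.1 h0⟩
    · rintro (⟨h, hor, hext, hsol, -⟩ | ⟨h, hor, hext, hsol, -⟩) <;> exact ⟨h, hor, hext, hsol⟩
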